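/- **Setting.** A piece of paper is an open set $D\subset\mathbb R^2$; it is hole-free if it is simply connected. A *curved crease–rule pattern* on $D$ consists of finitely many creases and a set of rule segments. Each crease is an arc-length-parameterized $C^2$ curve $x_i:(0,\ell_i)\to D$ with nowhere vanishing signed curvature, extending continuously to its endpoints; creases meet themselves and each other at most at endpoints. The rule segments are pairwise disjoint open straight segments that cover $D$ minus the creases and each end on creases or on the boundary of $D$. The pattern is *vertex-free* if all crease endpoints lie outside $D$ (that is, on $\partial D$); *uniquely ruled* if each point of a crease has exactly one rule segment on either side; and it has *reflecting rulings* if, whenever a rule segment ends at a point $x_i(s)$ of a crease, the pattern has a rule segment starting at $x_i(s)$ in the direction mirrored in the tangent line of the crease. A *folding* of the pattern is a continuous map $f:D\to\mathbb R^3$ that is $C^2$ on each face (component of $D$ minus the creases) up to the creases bounding it, is isometric on each face, and maps each rule segment to a straight segment along which the tangent plane of the folded surface is constant. Self-intersections are ignored. The *fold angle* at a crease point is the signed angle $\rho$ from the right to the left surface normal, in the right-screw direction of the tangent of the folded crease. The folding is a *properly folded state* if at every crease point it has a fold angle $\rho\in(-\pi,\pi)\setminus\{0\}$. A *rigid-ruling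 folding motion* of the pattern is a family $(F_u)_{u\in[0,1]}$ such that $F_u(x)$ is jointly continuous in $(u,x)\in[0,1]\times D$, $F_0$ is the restriction of an isometric affine embedding of the plane (the flat state), and, for every $u\in(0,1]$, $F_u$ is a properly folded state of the same crease–rule pattern. **Theorem.** Let $f$ be a properly folded state of a vertex-free uniquely ruled curved crease–rule pattern with reflecting rulings on hole-free flat paper. Then the fold angle of $f$ is constant along each crease $i$, say $\rho_i\in(-\pi,\pi)\setminus\{0\}$, and there is a rigid-ruling folding motion $(F_u)_{u\in[0,1]}$ of the pattern with $F_1=f$ such that, for every $u\in[0,1]$ and every crease $i$, the fold angle of $F_u$ is constant along crease $i$, equal to the $\rho_i(u)\in(-\pi,\pi)$ with $$\tan\frac{\rho_i(u)}{2}=u\,\tan\frac{\rho_i}{2}.$$ -/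

import Mathlib

open Set Filter Topology

noncomputable section

namespace CurvedCrease

/-- The plane containing the unfolded sheet. -/
abbrev Plane := EuclideanSpace ℝ (Fin 2)

/-- The space in which the sheet is folded. -/
abbrev Space := EuclideanSpace ℝ (Fin 3)

/-- Counterclockwise quarter turn of the plane. -/
def quarterTurn (v : Plane) : Plane := !₂[-v 1, v 0]

/-- The cross product of Euclidean 3-space. -/
def cross (v w : Space) : Space :=
  WithLp.toLp 2 (crossProduct (WithLp.ofLp v) (WithLp.ofLp w))

/-- The top-side normal of the surface `f` at `x`, the image of `e_z`; it is a unit vector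
wherever the differential of `f` is isometric. -/
def surfaceNormal (f : Plane → Space) (x : Plane) : Space :=
  cross (fderiv ℝ f x !₂[1, 0]) (fderiv ℝ f x !₂[0, 1])

/-- A crease–rule pattern on a flat piece of paper, with creases indexed by `ι`.  The paper is an
open planar set.  Each crease is an arc-length-parameterized `C²` curve on `(0, len i)`, with
nowhere vanishing curvature, extended by its two endpoints.  Creases may meet, themselves or
others, only at endpoints.  The rule segments partition the paper minus the creases into disjoint
open segments, each of which ends on creases or on the boundary of the paper. -/
structure CreaseRulePattern (ι : Type*) where
  paper : Set Plane
  paper_open : IsOpen paper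
  len : ι → ℝ
  len_pos : ∀ i, 0 < len i
  crease : ι → ℝ → Plane
  crease_continuous : ∀ i, ContinuousOn (crease i) (Icc 0 (len i))
  crease_contDiff : ∀ i, ContDiffOn ℝ 2 (crease i) (Ioo 0 (len i))
  crease_unit_speed : ∀ i, ∀ s ∈ Ioo 0 (len i), ‖deriv (crease i) s‖ = 1
  crease_curved : ∀ i, ∀ s ∈ Ioo 0 (len i),
    inner ℝ (deriv (deriv (crease i)) s) (quarterTurn (deriv (crease i) s)) ≠ 0
  crease_mem : ∀ i, ∀ s ∈ Ioo 0 (len i), crease i s ∈ paper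
  crease_embedded : ∀ i j, ∀ s ∈ Ioo 0 (len i), ∀ t ∈ Icc 0 (len j),
    crease i s = crease j t → i = j ∧ s = t
  /-- Rule segments, given by their ordered pairs of endpoints, in both orders. -/
  rules : Set (Plane × Plane)
  rule_symm : ∀ a b, (a, b) ∈ rules → (b, a) ∈ rules
  rule_ne : ∀ a b, (a, b) ∈ rules → a ≠ b
  rule_subset : ∀ a b, (a, b) ∈ rules →
    openSegment ℝ a b ⊆ paper \ ⋃ i, crease i '' Icc 0 (len i)
  rule_end : ∀ a b, (a, b) ∈ rules → a ∉ paper \ ⋃ i, crease i '' Icc 0 (len i)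
  rule_disjoint : ∀ a b a' b', (a, b) ∈ rules → (a', b') ∈ rules →
    (openSegment ℝ a b ∩ openSegment ℝ a' b').Nonempty →
      (a' = a ∧ b' = b) ∨ (a' = b ∧ b' = a)
  rule_cover : ∀ x ∈ paper \ ⋃ i, crease i '' Icc 0 (len i),
    ∃ a b, (a, b) ∈ rules ∧ x ∈ openSegment ℝ a b

namespace CreaseRulePattern

variable {ι : Type*} (P : CreaseRulePattern ι)

/-- The paper with all creases (and their endpoints) removed: the union of the open faces. -/
def uncreased : Set Plane := P.paper \ ⋃ i, P.crease i '' Icc 0 (P.len i)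

/-- Unit tangent of the unfolded crease. -/
def tangent (i : ι) (s : ℝ) : Plane := deriv (P.crease i) s

/-- Left unit normal of the unfolded crease. -/
def leftNormal (i : ι) (s : ℝ) : Plane := quarterTurn (P.tangent i s)

/-- Signed curvature of the unfolded crease. -/
def curvature (i : ι) (s : ℝ) : ℝ :=
  inner ℝ (deriv (deriv (P.crease i)) s) (P.leftNormal i s)

/-- No vertices in the interior of the paper: every crease ends outside of the (open) paper. -/
def VertexFree : Prop :=
  ∀ i, P.crease i 0 ∉ P.paper ∧ P.crease i (P.len i) ∉ P.paper

/-- Hole-free paper: an open topological disk. -/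
def HoleFree : Prop := SimplyConnectedSpace P.paper

/-- Directions in which a straight segment leaves the crease point to its left.  A crease lies on
the side of its tangent line to which it turns, so a tangent segment is to the left of the crease
exactly where the crease turns right. -/
def LeavesLeft (i : ι) (s : ℝ) (v : Plane) : Prop :=
  0 < inner ℝ v (P.leftNormal i s) ∨ (inner ℝ v (P.leftNormal i s) = 0 ∧ P.curvature i s < 0)

/-- Directions in which a straight segment leaves the crease point to its right. -/
def LeavesRight (i : ι) (s : ℝ) (v : Plane) : Prop :=
  inner ℝ v (P.leftNormal i s) < 0 ∨ (inner ℝ v (P.leftNormal i s) = 0 ∧ 0 < P.curvature i s)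

/-- Every crease point has exactly one rule segment on either side. -/
def UniquelyRuled : Prop :=
  ∀ i, ∀ s ∈ Ioo 0 (P.len i),
    (∃! b, (P.crease i s, b) ∈ P.rules ∧ P.LeavesLeft i s (b - P.crease i s)) ∧
    (∃! b, (P.crease i s, b) ∈ P.rules ∧ P.LeavesRight i s (b - P.crease i s))

/-- Wherever a rule segment touches a crease, its reflection in the tangent line of the crease is,
near the crease point, a rule segment as well. -/
def ReflectingRulings : Prop :=
  ∀ i, ∀ s ∈ Ioo 0 (P.len i), ∀ b, (P.crease i s, b) ∈ P.rules →
    ∃ b', (P.crease i s, b') ∈ P.rules ∧ ∃ r : ℝ, 0 < r ∧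
      b' - P.crease i s = r • (Submodule.span ℝ {P.tangent i s}).reflection (b - P.crease i s)

/-- `f` is a nonstretching folding of the paper that is creased at most along the creases of the
pattern and ruled by its rule segments: it is continuous, `C²` on each face up to the creases
bounding it, isometric, and maps each rule segment to a straight segment along which the tangent
plane of the (developable) surface does not change.  Self-intersections are not considered. -/
structure IsFolding (f : Plane → Space) : Prop where
  continuousOn : ContinuousOn f P.paper
  contDiffOn_face : ∀ x ∈ P.uncreased,
    ContDiffOn ℝ 2 f (P.paper ∩ closure (connectedComponentIn P.uncreased x))
  isometric : ∀ x ∈ P.uncreased, ∀ v : Plane, ‖fderiv ℝ f x v‖ = ‖v‖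
  rule_straight : ∀ a b, (a, b) ∈ P.rules → ∀ x ∈ openSegment ℝ a b, ∀ y ∈ openSegment ℝ a b,
    dist (f x) (f y) = dist x y
  rule_normal : ∀ a b, (a, b) ∈ P.rules → ∀ x ∈ openSegment ℝ a b, ∀ y ∈ openSegment ℝ a b,
    surfaceNormal f x = surfaceNormal f y

/-- `ρ` is a signed fold angle of `f` at the point with parameter `s` of crease `i`: rotation by
`ρ`, in the right-screw direction of the tangent of the folded crease, takes the right surface
normal at the crease to the left one. -/
def HasFoldAngle (f : Plane → Space) (i : ι) (s ρ : ℝ) : Prop :=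
  ∃ PL PR : Space,
    Tendsto (fun ε : ℝ => surfaceNormal f (P.crease i s + ε • P.leftNormal i s))
      (𝓝[>] 0) (𝓝 PL) ∧
    Tendsto (fun ε : ℝ => surfaceNormal f (P.crease i s - ε • P.leftNormal i s))
      (𝓝[>] 0) (𝓝 PR) ∧
    PL = Real.cos ρ • PR + Real.sin ρ • cross (deriv (fun r => f (P.crease i r)) s) PR

/-- A properly folded state of the pattern: a folding in which each crease point is really folded,
and not folded flat. -/
def IsProperlyFolded (f : Plane → Space) : Prop :=
  P.IsFolding f ∧ ∀ i, ∀ s ∈ Ioo 0 (P.len i),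
    ∃ ρ ∈ Ioo (-Real.pi) Real.pi, ρ ≠ 0 ∧ P.HasFoldAngle f i s ρ

/-- A rigid-ruling folding motion, with time `u` from `0` to `1`: a continuous motion out of the
flat state through properly folded states of one and the same crease–rule pattern. -/
structure IsRigidRulingMotion (F : ℝ → Plane → Space) : Prop where
  continuousOn : ContinuousOn (fun q : ℝ × Plane => F q.1 q.2) (Icc (0 : ℝ) 1 ×ˢ P.paper)
  flat : ∃ e : Plane →ᵃⁱ[ℝ] Space, EqOn (F 0) e P.paper
  folded : ∀ u ∈ Ioc (0 : ℝ) 1, P.IsProperlyFolded (F u)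

end CreaseRulePattern

end CurvedCrease

end

/-!
The proof describes the folded sheet by its moving frame: at each point `y` off the creases, the
rotation `E y` of space that carries the frame of the flat sheet to the tangent directions and the
normal of `f` at `y`. Along a rule segment the rigid motion `w ↦ E y w + (f y - E y y)` does not
change (`IsFolding.frame_eq_of_rule`). So near a point, `f` is given by a curve of rigid motions,
pulled back along the map `t` that sends a point to the parameter of its rule segment. The motion of
the theorem scales the bending: its frame at time `u` has `u` times the body velocity of `E`. For
the curve of rigid motions this is a linear differential equation (`exists_isBending`), with
solution `f` for `u = 1` and a resting flat sheet for `u = 0`. The map `t` is only Lipschitz. This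
suffices, because the new surface is a function of `t` whose velocity is a linear image of that of
the old one, and the old one is differentiable (`HasFDerivWithinAt.transfer`). Thus the new surface
has the regularity of `f`, and its frame is again constant along the rule segments
(`IsDevelopment.rule`).

Along a crease, write the frames of both sides with respect to the tangent of the folded crease.
They differ by the rotation `twist ρ` about the tangent, and turn with the body velocities
`bend κ τ + k • spin`, where `k` is the curvature of the unfolded crease, `κ` the normal curvature
and `τ` the geodesic torsion of the respective side. Differentiating the tangent of the folded
crease on both sides gives `κ_L = -k * tan (ρ / 2)` and `κ_R = -κ_L` (`curvature_eq_of_twist`). In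
particular `κ_L` and `κ_R` do not vanish, so no rule segment is tangent to the crease. The surface
does not curve in the direction of its rule segment, which determines the ratio of `τ` to `κ`.
Reflected rule segments therefore have `τ_L = τ_R` (`IsCreaseChart.secondForm_eq`). These are the
relations under which the twist between the two frames has derivative zero (`twist_mul_bend`), and
the fold angle is constant. If `κ` and `τ` are multiplied by `u`, the relations persist for the
angle with tangent of half `u * tan (ρ / 2)` (`twist_cond`). So both sides, bent by the same factor,
still fit along the crease (`IsBending.across`). Near the crease, `t` is the parameter of the point
at which the rule segment ends on the crease. Rule segments there do reach the crease, as they are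
uniformly transversal to it (`IsSideFrame.exists_foot`), and `t` is Lipschitz because it can be read
off from the surface normal (`IsSideFrame.exists_footMap`).

This solves the problem near every point of the paper (`IsDevelopment`). Two local solutions differ
by a rigid motion that depends on time only: off the creases because their frames turn alike, and
across a crease because its fold angle is prescribed (`IsDevelopment.exists_carries`). These
differences form a locally constant cocycle, which is trivial because the paper is simply connected
(`exists_section_of_cocycle`), so that the local solutions can be moved to fit together
(`exists_global_development`).
-/


noncomputable section

namespace CurvedCrease

/-! ### Linear algebra of frames -/

section

/-- The algebra of linear endomorphisms of space, as a normed star algebra.  It is a type of its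
own, so that its algebraic structure is found without unfolding that of Euclidean space. -/
def Op : Type := Space →L[ℝ] Space

namespace Op

instance : NormedRing Op := inferInstanceAs (NormedRing (Space →L[ℝ] Space))
instance : NormedAlgebra ℝ Op := inferInstanceAs (NormedAlgebra ℝ (Space →L[ℝ] Space))
instance : CompleteSpace Op := inferInstanceAs (CompleteSpace (Space →L[ℝ] Space))
instance : StarRing Op := inferInstanceAs (StarRing (Space →L[ℝ] Space))
instance : StarModule ℝ Op :=
  ⟨fun c A => (star_smul c (show Space →L[ℝ] Space from A) :)⟩
instance : ContinuousStar Op :=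
  ⟨(ContinuousLinearMap.adjoint : (Space →L[ℝ] Space) ≃ₗᵢ⋆[ℝ] (Space →L[ℝ] Space)).continuous⟩

/-- The action of operators on vectors. -/
def act : Op →L[ℝ] (Space →L[ℝ] Space) :=
  LinearMap.mkContinuous
    { toFun := fun A => A, map_add' := fun _ _ => rfl, map_smul' := fun _ _ => rfl } 1
    (fun A => by rw [one_mul]; exact le_rfl)

/-- An endomorphism as an element of the operator algebra. -/
def of (A : Space →L[ℝ] Space) : Op := A

/-- The inverse of `act`. -/
def ofL : (Space →L[ℝ] Space) →L[ℝ] Op :=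
  LinearMap.mkContinuous
    { toFun := of, map_add' := fun _ _ => rfl, map_smul' := fun _ _ => rfl } 1
    (fun A => by rw [one_mul]; exact le_rfl)

instance : CoeFun Op (fun _ => Space → Space) := ⟨fun A => act A⟩

@[simp] lemma act_of (A : Space →L[ℝ] Space) : act (of A) = A := rfl
@[simp] lemma mul_apply (A B : Op) (v : Space) : (A * B) v = A (B v) := rfl
@[simp] lemma one_apply (v : Space) : (1 : Op) v = v := rfl

@[ext] lemma ext {A B : Op} (h : ∀ v, A v = B v) : A = B :=
  ContinuousLinearMap.ext (f := act A) (g := act B) h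

lemma inner_star (A : Op) (v w : Space) : (inner ℝ v (star A w) : ℝ) = inner ℝ (A v) w :=
  ContinuousLinearMap.adjoint_inner_right (act A) v w

end Op

/-- The flat sheet, as the horizontal plane of space. -/
def emb : Plane →L[ℝ] Space :=
  LinearMap.toContinuousLinearMap
    { toFun := fun v => !₂[v 0, v 1, 0]
      map_add' := fun v w => by ext i; fin_cases i <;> simp
      map_smul' := fun c v => by ext i; fin_cases i <;> simp }

/-- The top-side normal of the flat sheet. -/
def e3 : Space := !₂[0, 0, 1]

lemma inner3 (v w : Space) : inner ℝ v w = v 0 * w 0 + v 1 * w 1 + v 2 * w 2 := by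
  simp [PiLp.inner_apply, Fin.sum_univ_three, mul_comm]

lemma inner2 (v w : Plane) : inner ℝ v w = v 0 * w 0 + v 1 * w 1 := by
  simp [PiLp.inner_apply, Fin.sum_univ_two, mul_comm]

@[simp] lemma cross_zero_coord (v w : Space) : cross v w 0 = v 1 * w 2 - v 2 * w 1 := by
  simp [cross, cross_apply]
@[simp] lemma cross_one_coord (v w : Space) : cross v w 1 = v 2 * w 0 - v 0 * w 2 := by
  simp [cross, cross_apply]
@[simp] lemma cross_two_coord (v w : Space) : cross v w 2 = v 0 * w 1 - v 1 * w 0 := by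
  simp [cross, cross_apply]

lemma space_ext {v w : Space} (h0 : v 0 = w 0) (h1 : v 1 = w 1) (h2 : v 2 = w 2) : v = w := by
  ext i; fin_cases i <;> assumption

lemma plane_ext {v w : Plane} (h0 : v 0 = w 0) (h1 : v 1 = w 1) : v = w := by
  ext i; fin_cases i <;> assumption

@[simp] lemma emb_zero_coord (v : Plane) : emb v 0 = v 0 := rfl
@[simp] lemma emb_one_coord (v : Plane) : emb v 1 = v 1 := rfl
@[simp] lemma emb_two_coord (v : Plane) : emb v 2 = 0 := rfl
@[simp] lemma e3_zero_coord : e3 0 = 0 := rfl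
@[simp] lemma e3_one_coord : e3 1 = 0 := rfl
@[simp] lemma e3_two_coord : e3 2 = 1 := rfl
@[simp] lemma quarterTurn_zero_coord (v : Plane) : quarterTurn v 0 = - v 1 := rfl
@[simp] lemma quarterTurn_one_coord (v : Plane) : quarterTurn v 1 = v 0 := rfl

lemma inner_emb (v w : Plane) : inner ℝ (emb v) (emb w) = inner ℝ v w := by
  simp [inner3, inner2]

lemma norm_emb (v : Plane) : ‖emb v‖ = ‖v‖ := by
  have h := inner_emb v v
  rw [real_inner_self_eq_norm_sq, real_inner_self_eq_norm_sq] at h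
  exact (pow_left_inj₀ (norm_nonneg _) (norm_nonneg _) two_ne_zero).1 h

/-- The quarter turn as a continuous linear map. -/
def qt : Plane →L[ℝ] Plane :=
  LinearMap.toContinuousLinearMap
    { toFun := quarterTurn
      map_add' := fun v w => by apply plane_ext <;> simp; ring
      map_smul' := fun c v => by apply plane_ext <;> simp }

lemma qt_apply (v : Plane) : qt v = quarterTurn v := rfl

/-- The cross product as a continuous bilinear map. -/
def crossL : Space →L[ℝ] Space →L[ℝ] Space :=
  LinearMap.toContinuousBilinearMap
    (LinearMap.mk₂ ℝ cross
      (fun v v' w => by apply space_ext <;> simp <;> ring)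
      (fun c v w => by apply space_ext <;> simp <;> ring)
      (fun v w w' => by apply space_ext <;> simp <;> ring)
      (fun c v w => by apply space_ext <;> simp <;> ring))

lemma crossL_apply (v w : Space) : crossL v w = cross v w := rfl

/-- The operator with prescribed values on the standard basis. -/
def cols (a b c : Space) : Op := Op.of <|
  (EuclideanSpace.proj (0 : Fin 3) : Space →L[ℝ] ℝ).smulRight a +
    (EuclideanSpace.proj (1 : Fin 3) : Space →L[ℝ] ℝ).smulRight b +
    (EuclideanSpace.proj (2 : Fin 3) : Space →L[ℝ] ℝ).smulRight c

@[simp] lemma cols_apply (a b c w : Space) : cols a b c w = w 0 • a + w 1 • b + w 2 • c := by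
  simp [cols]

/-- The first basis vector of the plane. -/
def p1 : Plane := !₂[1, 0]
/-- The second basis vector of the plane. -/
def p2 : Plane := !₂[0, 1]
@[simp] lemma p1_zero_coord : p1 0 = 1 := rfl
@[simp] lemma p1_one_coord : p1 1 = 0 := rfl
@[simp] lemma p2_zero_coord : p2 0 = 0 := rfl
@[simp] lemma p2_one_coord : p2 1 = 1 := rfl

lemma norm_eq_one_of_inner {E : Type*} [NormedAddCommGroup E] [InnerProductSpace ℝ E] {v : E}
    (h : (inner ℝ v v : ℝ) = 1) : ‖v‖ = 1 := by
  rw [real_inner_self_eq_norm_sq] at h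
  exact (pow_eq_one_iff_of_nonneg (norm_nonneg _) two_ne_zero).1 h

@[simp] lemma norm_p1 : ‖p1‖ = 1 := norm_eq_one_of_inner (by rw [inner2]; simp)
@[simp] lemma norm_p2 : ‖p2‖ = 1 := norm_eq_one_of_inner (by rw [inner2]; simp)
@[simp] lemma norm_e3 : ‖e3‖ = 1 := norm_eq_one_of_inner (by rw [inner3]; simp)

lemma space_decomp (w : Space) : w = w 0 • emb p1 + w 1 • emb p2 + w 2 • e3 := by
  apply space_ext <;> simp

lemma plane_decomp (w : Plane) : w = w 0 • p1 + w 1 • p2 := by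
  apply plane_ext <;> simp

lemma eq_cols (A : Op) : A = cols (A (emb p1)) (A (emb p2)) (A e3) := by
  ext1 w
  conv_lhs => rw [space_decomp w]
  simp

/-- Orientation-preserving linear isometries of space. -/
def IsRot (A : Op) : Prop :=
  star A * A = 1 ∧ ∀ v w, cross (A v) (A w) = A (cross v w)

lemma star_mul_self_eq_one_iff (A : Op) :
    star A * A = 1 ↔ ∀ v w, (inner ℝ (A v) (A w) : ℝ) = inner ℝ v w := by
  constructor
  · intro h v w
    have := congrArg (fun B : Op => (inner ℝ v (B w) : ℝ)) h
    simpa [Op.inner_star] using this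
  · intro h
    ext1 w
    refine ext_inner_left ℝ fun v => ?_
    simpa [Op.inner_star] using h v w

lemma op_mul_eq_one_symm {A B : Op} (h : A * B = 1) : B * A = 1 := by
  have h' : (Op.act A : Space →ₗ[ℝ] Space) * (Op.act B : Space →ₗ[ℝ] Space) = 1 := by
    ext1 v; exact congrArg (fun C : Op => C v) h
  have := mul_eq_one_symm h'
  ext1 v; exact congrArg (fun C : Space →ₗ[ℝ] Space => C v) this

namespace IsRot

variable {A B : Op}

lemma mul_star (h : IsRot A) : A * star A = 1 := op_mul_eq_one_symm h.1

lemma inner_map (h : IsRot A) (v w : Space) : (inner ℝ (A v) (A w) : ℝ) = inner ℝ v w :=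
  (star_mul_self_eq_one_iff A).1 h.1 v w

lemma norm_map (h : IsRot A) (v : Space) : ‖A v‖ = ‖v‖ := by
  have h := h.inner_map v v
  rw [real_inner_self_eq_norm_sq, real_inner_self_eq_norm_sq] at h
  exact (pow_left_inj₀ (norm_nonneg _) (norm_nonneg _) two_ne_zero).1 h

lemma star_apply_self (h : IsRot A) (v : Space) : star A (A v) = v :=
  congrArg (fun C : Op => C v) h.1

lemma self_apply_star (h : IsRot A) (v : Space) : A (star A v) = v :=
  congrArg (fun C : Op => C v) h.mul_star

lemma one : IsRot 1 := ⟨by simp, fun v w => rfl⟩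

lemma mul (hA : IsRot A) (hB : IsRot B) : IsRot (A * B) := by
  refine ⟨?_, fun v w => ?_⟩
  · rw [star_mul, mul_assoc, ← mul_assoc (star A), hA.1, one_mul, hB.1]
  · simp only [Op.mul_apply, hA.2, hB.2]

lemma star (hA : IsRot A) : IsRot (star A) := by
  refine ⟨by rw [star_star, hA.mul_star], fun v w => ?_⟩
  have := hA.2 (Star.star A v) (Star.star A w)
  rw [hA.self_apply_star, hA.self_apply_star] at this
  rw [this, hA.star_apply_self]

end IsRot

lemma cross_e1_e2 : cross (emb p1) (emb p2) = e3 := by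
  apply space_ext <;> simp

/-- A linear isometry is a rotation if it respects one cross product of basis vectors. -/
lemma isRot_of_orthonormal {A : Op} (h : star A * A = 1)
    (hc : cross (A (emb p1)) (A (emb p2)) = A e3) : IsRot A := by
  refine ⟨h, fun v w => ?_⟩
  rw [star_mul_self_eq_one_iff] at h
  set a := A (emb p1) with ha
  set b := A (emb p2) with hb
  have haa : (inner ℝ a a : ℝ) = 1 := by rw [h]; simp [norm_emb]
  have hbb : (inner ℝ b b : ℝ) = 1 := by rw [h]; simp [norm_emb]
  have hab : (inner ℝ a b : ℝ) = 0 := by rw [h]; simp [inner3]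
  rw [inner3] at haa hbb hab
  rw [eq_cols A, ← ha, ← hb, ← hc]
  have h1 : cross b (cross a b) = a := by
    apply space_ext <;> simp
    · linear_combination a 0 * hbb - b 0 * hab
    · linear_combination a 1 * hbb - b 1 * hab
    · linear_combination a 2 * hbb - b 2 * hab
  have h2 : cross (cross a b) a = b := by
    apply space_ext <;> simp
    · linear_combination b 0 * haa - a 0 * hab
    · linear_combination b 1 * haa - a 1 * hab
    · linear_combination b 2 * haa - a 2 * hab
  have key : ∀ c : Space, cross (v 0 • a + v 1 • b + v 2 • c) (w 0 • a + w 1 • b + w 2 • c)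
      = (v 1 * w 2 - v 2 * w 1) • cross b c + (v 2 * w 0 - v 0 * w 2) • cross c a
        + (v 0 * w 1 - v 1 * w 0) • cross a b := by
    intro c
    apply space_ext <;> simp <;> ring
  simp only [cols_apply, key, h1, h2, cross_zero_coord, cross_one_coord, cross_two_coord]

lemma star_cols_mul_self {a b c : Space} (haa : (inner ℝ a a : ℝ) = 1)
    (hbb : (inner ℝ b b : ℝ) = 1) (hcc : (inner ℝ c c : ℝ) = 1) (hab : (inner ℝ a b : ℝ) = 0)
    (hac : (inner ℝ a c : ℝ) = 0) (hbc : (inner ℝ b c : ℝ) = 0) :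
    star (cols a b c) * cols a b c = 1 := by
  rw [star_mul_self_eq_one_iff]
  intro v w
  have hba : (inner ℝ b a : ℝ) = 0 := by rw [real_inner_comm]; exact hab
  have hca : (inner ℝ c a : ℝ) = 0 := by rw [real_inner_comm]; exact hac
  have hcb : (inner ℝ c b : ℝ) = 0 := by rw [real_inner_comm]; exact hbc
  simp only [cols_apply, inner_add_left, inner_add_right, inner_smul_left, inner_smul_right,
    haa, hbb, hcc, hab, hac, hbc, hba, hca, hcb, inner3 v w, conj_trivial]
  ring

lemma isRot_cols_cross {a b : Space} (haa : (inner ℝ a a : ℝ) = 1)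
    (hbb : (inner ℝ b b : ℝ) = 1) (hab : (inner ℝ a b : ℝ) = 0) :
    IsRot (cols a b (cross a b)) := by
  refine isRot_of_orthonormal (star_cols_mul_self haa hbb ?_ hab ?_ ?_) (by simp)
  · rw [inner3] at *
    simp only [cross_zero_coord, cross_one_coord, cross_two_coord]
    linear_combination (b 0 * b 0 + b 1 * b 1 + b 2 * b 2) * haa + hbb
      - (a 0 * b 0 + a 1 * b 1 + a 2 * b 2) * hab
  · rw [inner3]; simp; ring
  · rw [inner3]; simp; ring

/-- The frame of a surface with differential `A`: it carries the frame of the flat sheet to the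
partial derivatives and the top-side normal of the surface. -/
def frameOf (A : Plane →L[ℝ] Space) : Op := cols (A p1) (A p2) (cross (A p1) (A p2))

lemma frameOf_emb (A : Plane →L[ℝ] Space) (v : Plane) : frameOf A (emb v) = A v := by
  conv_rhs => rw [plane_decomp v]
  simp [frameOf]

lemma frameOf_e3 (A : Plane →L[ℝ] Space) : frameOf A e3 = cross (A p1) (A p2) := by
  simp [frameOf]

lemma inner_map_of_norm_map {A : Plane →L[ℝ] Space} (h : ∀ v, ‖A v‖ = ‖v‖) (v w : Plane) :
    (inner ℝ (A v) (A w) : ℝ) = inner ℝ v w := by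
  rw [real_inner_eq_norm_add_mul_self_sub_norm_mul_self_sub_norm_mul_self_div_two,
    real_inner_eq_norm_add_mul_self_sub_norm_mul_self_sub_norm_mul_self_div_two,
    ← map_add, h, h, h]

lemma isRot_frameOf {A : Plane →L[ℝ] Space} (h : ∀ v, ‖A v‖ = ‖v‖) : IsRot (frameOf A) := by
  apply isRot_cols_cross <;> rw [inner_map_of_norm_map h] <;> simp [inner2]

lemma IsRot.eq_frameOf {A : Op} (h : IsRot A) : A = frameOf ((Op.act A).comp emb) := by
  conv_lhs => rw [eq_cols A]
  simp [frameOf, h.2, cross_e1_e2]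

lemma surfaceNormal_eq (f : Plane → Space) (x : Plane) :
    surfaceNormal f x = frameOf (fderiv ℝ f x) e3 := by
  rw [frameOf_e3]; rfl

lemma isClosed_isRot : IsClosed {A : Op | IsRot A} := by
  have : {A : Op | IsRot A} = (⋂ v, ⋂ w, {A | (inner ℝ (A v) (A w) : ℝ) = inner ℝ v w}) ∩ ⋂ v, ⋂ w,
      {A | crossL (A v) (A w) = A (cross v w)} := by
    ext A; simp [IsRot, crossL_apply, star_mul_self_eq_one_iff]
  rw [this]
  refine (isClosed_iInter fun v => isClosed_iInter fun w => isClosed_eq (by fun_prop)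
    continuous_const).inter (isClosed_iInter fun v => isClosed_iInter fun w => isClosed_eq ?_ ?_)
  · fun_prop
  · fun_prop

/-- A continuous family of linear isometries on a connected set keeps its orientation. -/
lemma isRot_of_isPreconnected {s : Set ℝ} (hs : IsPreconnected s) {e : ℝ → Op}
    (he : ContinuousOn e s) (h : ∀ t ∈ s, star (e t) * e t = 1) {t₀ : ℝ} (ht₀ : t₀ ∈ s)
    (h₀ : IsRot (e t₀)) : ∀ t ∈ s, IsRot (e t) := by
  let σ : ℝ → ℝ := fun t => inner ℝ (crossL (e t (emb p1)) (e t (emb p2))) (e t e3)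
  have hσc : ContinuousOn σ s := by
    have h1 : Continuous fun A : Op =>
        (inner ℝ (crossL (A (emb p1)) (A (emb p2))) (A e3) : ℝ) := by fun_prop
    exact h1.comp_continuousOn he
  have key : ∀ t ∈ s, crossL (e t (emb p1)) (e t (emb p2)) = σ t • e t e3 ∧ σ t ^ 2 = 1 := by
    intro t ht
    have hi := (star_mul_self_eq_one_iff _).1 (h t ht)
    set a := e t (emb p1) with ha
    set b := e t (emb p2) with hb
    have haa : (inner ℝ a a : ℝ) = 1 := by rw [hi]; simp [norm_emb]
    have hbb : (inner ℝ b b : ℝ) = 1 := by rw [hi]; simp [norm_emb]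
    have hab : (inner ℝ a b : ℝ) = 0 := by rw [hi]; simp [inner3]
    have hr := isRot_cols_cross haa hbb hab
    -- `e t e3` is a multiple of the cross product of the first two columns
    have hc : e t e3 = σ t • cross a b := by
      have h1 := hr.self_apply_star (e t e3)
      set w := star (cols a b (cross a b)) (e t e3) with hw
      have hw0 : w 0 = 0 := by
        have : (inner ℝ (emb p1) w : ℝ) = w 0 := by simp [inner3]
        rw [← this, hw, Op.inner_star]
        simp only [cols_apply, emb_zero_coord, emb_one_coord, emb_two_coord, p1_zero_coord,
          p1_one_coord, one_smul, zero_smul, add_zero]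
        rw [ha, hi]; simp [inner3]
      have hw1 : w 1 = 0 := by
        have : (inner ℝ (emb p2) w : ℝ) = w 1 := by simp [inner3]
        rw [← this, hw, Op.inner_star]
        simp only [cols_apply, emb_zero_coord, emb_one_coord, emb_two_coord, p2_zero_coord,
          p2_one_coord, one_smul, zero_smul, add_zero, zero_add]
        rw [hb, hi]; simp [inner3]
      have hw2 : w 2 = σ t := by
        have : (inner ℝ e3 w : ℝ) = w 2 := by simp [inner3]
        rw [← this, hw, Op.inner_star]
        simp [σ, crossL_apply, ha, hb]
      rw [← h1, cols_apply, hw0, hw1, hw2]; simp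
    have h33 : (inner ℝ (e t e3) (e t e3) : ℝ) = 1 := by rw [hi]; simp
    have hσ2 : σ t ^ 2 = 1 := by
      have h2 : (inner ℝ (e t e3) (e t e3) : ℝ) = σ t * σ t := by
        conv_lhs => rw [hc, inner_smul_left]
        rw [← hc]; simp [σ, crossL_apply, ha, hb]
      rw [sq, ← h2, h33]
    refine ⟨?_, hσ2⟩
    rw [hc, smul_smul, ← sq, hσ2, one_smul, crossL_apply]
  have h1 : EqOn σ (fun _ => 1) s := by
    refine hs.eq_of_sq_eq hσc continuousOn_const (fun t ht => ?_) (fun _ => one_ne_zero) ht₀ ?_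
    · simpa using (key t ht).2
    · have hi := (star_mul_self_eq_one_iff _).1 h₀.1
      show (inner ℝ (cross (e t₀ (emb p1)) (e t₀ (emb p2))) (e t₀ e3) : ℝ) = 1
      rw [h₀.2, cross_e1_e2, hi]; simp
  intro t ht
  refine isRot_of_orthonormal (h t ht) ?_
  have := (key t ht).1
  rw [h1 ht, one_smul] at this
  exact this

end

/-! ### Darboux frames, twists and bending -/

section

/-- The frame of the flat sheet adapted to the direction `T`. -/
def darboux (T : Plane) : Op := cols (emb T) (emb (quarterTurn T)) e3

/-- Rotation by `ρ` about the first basis vector. -/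
def twist (ρ : ℝ) : Op :=
  cols (emb p1) (Real.cos ρ • emb p2 + Real.sin ρ • e3) (Real.cos ρ • e3 - Real.sin ρ • emb p2)

/-- The infinitesimal rotation of a Darboux frame due to bending of the surface, with normal
curvature `κ` and geodesic torsion `τ`. -/
def bend (κ τ : ℝ) : Op := cols (κ • e3) (τ • e3) (-κ • emb p1 - τ • emb p2)

/-- The infinitesimal rotation about the vertical axis. -/
def spin : Op := cols (emb p2) (-emb p1) 0

lemma op_ext {A B : Op} (h1 : A (emb p1) = B (emb p1)) (h2 : A (emb p2) = B (emb p2))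
    (h3 : A e3 = B e3) : A = B := by
  rw [eq_cols A, eq_cols B, h1, h2, h3]

lemma inner_self_of_norm_one {E : Type*} [NormedAddCommGroup E] [InnerProductSpace ℝ E] {v : E}
    (h : ‖v‖ = 1) : (inner ℝ v v : ℝ) = 1 := by
  rw [real_inner_self_eq_norm_sq, h]; norm_num

lemma isRot_darboux {T : Plane} (hT : ‖T‖ = 1) : IsRot (darboux T) := by
  have h := inner_self_of_norm_one hT
  rw [inner2] at h
  refine isRot_of_orthonormal (star_cols_mul_self ?_ ?_ ?_ ?_ ?_ ?_) ?_
  · rw [inner3]; simpa using h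
  · rw [inner3]; simp; linarith
  · rw [inner3]; simp
  · rw [inner3]; simp; ring
  · rw [inner3]; simp
  · rw [inner3]; simp
  · apply space_ext <;> simp [darboux]; linarith

lemma isRot_twist (ρ : ℝ) : IsRot (twist ρ) := by
  have h := Real.sin_sq_add_cos_sq ρ
  refine isRot_of_orthonormal (star_cols_mul_self ?_ ?_ ?_ ?_ ?_ ?_) ?_
  · rw [inner3]; simp
  · rw [inner3]; simp; linarith
  · rw [inner3]; simp; linarith
  · rw [inner3]; simp
  · rw [inner3]; simp
  · rw [inner3]; simp; ring
  · apply space_ext <;> simp [twist]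

/-- The compatibility condition of the two sides of a crease: bending with opposite normal
curvatures and equal geodesic torsions is transported by the twist through the fold angle. -/
lemma twist_mul_bend {ρ κ τ k : ℝ} (h1 : κ * Real.sin ρ = -k * (1 - Real.cos ρ))
    (h2 : κ * (1 + Real.cos ρ) = -k * Real.sin ρ) :
    twist ρ * (bend κ τ + k • spin) = (bend (-κ) τ + k • spin) * twist ρ := by
  apply op_ext <;> apply space_ext <;> simp [twist, bend, spin] <;>
    first
    | ring1
    | linear_combination h1
    | linear_combination -h1
    | linear_combination h2
    | linear_combination -h2

/-- The normal curvature `-k * m`, with `m = tan (ρ / 2)`, satisfies the conditions of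
`twist_mul_bend`. -/
lemma twist_cond (m k : ℝ) :
    (-k * m) * Real.sin (2 * Real.arctan m) = -k * (1 - Real.cos (2 * Real.arctan m)) ∧
    (-k * m) * (1 + Real.cos (2 * Real.arctan m)) = -k * Real.sin (2 * Real.arctan m) := by
  have hc := Real.cos_arctan_pos m
  have hs : Real.sin (Real.arctan m) = m * Real.cos (Real.arctan m) := by
    have := Real.tan_arctan m
    rw [Real.tan_eq_sin_div_cos, div_eq_iff hc.ne'] at this
    exact this
  have h1 := Real.sin_sq_add_cos_sq (Real.arctan m)
  rw [Real.sin_two_mul, Real.cos_two_mul', hs] at *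
  constructor
  · linear_combination -k * h1
  · linear_combination k * m * h1

/-- A crease of curvature `k` that is folded by the angle `ρ` has second derivative
`κ • e3 + k • emb p2` in the frame of the left side and `κ' • e3 + k • emb p2` in that of the right
side. If these vectors agree up to the twist, then `ρ` determines the normal curvatures. -/
lemma curvature_eq_of_twist {ρ κ κ' k : ℝ} (hρ : ρ ∈ Ioo (-Real.pi) Real.pi) (h0 : ρ ≠ 0)
    (h : twist ρ (κ • e3 + k • emb p2) = κ' • e3 + k • emb p2) :
    κ = -k * Real.tan (ρ / 2) ∧ κ' = -κ := by
  have e1 : -(Real.sin ρ) * κ + k * Real.cos ρ = k := by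
    have := congrArg (fun v : Space => v 1) h
    simp [twist] at this
    linarith
  have e2 : κ * Real.cos ρ + k * Real.sin ρ = κ' := by
    have := congrArg (fun v : Space => v 2) h
    simp [twist] at this
    linarith
  have hc : 0 < Real.cos (ρ / 2) :=
    Real.cos_pos_of_mem_Ioo ⟨by linarith [hρ.1], by linarith [hρ.2]⟩
  have hs : Real.sin (ρ / 2) ≠ 0 := by
    intro hs
    have := (Real.sin_eq_zero_iff_of_lt_of_lt (by linarith [hρ.1, Real.pi_pos])
      (by linarith [hρ.2, Real.pi_pos])).1 hs
    exact h0 (by linarith)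
  have hρ2 : ρ = 2 * (ρ / 2) := by ring
  have hsq := Real.sin_sq_add_cos_sq (ρ / 2)
  rw [hρ2, Real.sin_two_mul, Real.cos_two_mul'] at e1 e2
  set s := Real.sin (ρ / 2)
  set c := Real.cos (ρ / 2)
  have e3 : κ * c = -k * s := by
    have : s * (κ * c + k * s) = 0 := by
      linear_combination -(1 / 2) * e1 + k / 2 * hsq
    have := (mul_eq_zero.1 this).resolve_left hs
    linarith
  have e4 : κ = -k * Real.tan (ρ / 2) := by
    rw [Real.tan_eq_sin_div_cos, ← mul_div_assoc, eq_div_iff hc.ne']; exact e3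
  refine ⟨e4, ?_⟩
  rw [← e2]
  linear_combination 2 * c * e3 - κ * hsq

/-! ### Linear differential equations with a scalar parameter -/

/-- Local solutions of `φ' = u • L φ` depend continuously on time and on the parameter `u`. -/
lemma exists_linear_flow {W : Type*} [NormedAddCommGroup W] [NormedSpace ℝ W] [CompleteSpace W]
    (L : ℝ → W →L[ℝ] W) {t₀ a : ℝ} (ha : 0 < a) (hL : ContinuousOn L (Icc (t₀ - a) (t₀ + a)))
    (w₀ : W) :
    ∃ δ ∈ Ioc 0 a, ∃ φ : ℝ → ℝ → W,
      ContinuousOn (fun q : ℝ × ℝ => φ q.1 q.2) (Icc 0 1 ×ˢ Ioo (t₀ - δ) (t₀ + δ)) ∧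
      ∀ u ∈ Icc (0 : ℝ) 1, φ u t₀ = w₀ ∧
        ∀ t ∈ Ioo (t₀ - δ) (t₀ + δ), HasDerivAt (φ u) (u • L t (φ u t)) t := by
  obtain ⟨M, hM⟩ : ∃ M, ∀ t ∈ Icc (t₀ - a) (t₀ + a), ‖L t‖ ≤ M :=
    isCompact_Icc.exists_bound_of_continuousOn hL
  have hM0 : 0 ≤ M := (norm_nonneg _).trans (hM t₀ ⟨by linarith, by linarith⟩)
  -- on the unit ball around `(w₀, 1 / 2)`, which contains the parameters `u ∈ [0, 1]` in its half,
  -- the vector field is bounded by `B` and Lipschitz with constant `K`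
  set B : ℝ := 2 * M * (‖w₀‖ + 1) with hB
  have hB0 : 0 ≤ B := by positivity
  set K : ℝ := M * (‖w₀‖ + 1) + 2 * M with hK
  have hK0 : 0 ≤ K := by positivity
  set δ : ℝ := min a (1 / (2 * (B + 1))) with hδ
  have hδ0 : 0 < δ := lt_min ha (by positivity)
  have hsub : Icc (t₀ - δ) (t₀ + δ) ⊆ Icc (t₀ - a) (t₀ + a) :=
    Icc_subset_Icc (by linarith [min_le_left a (1 / (2 * (B + 1)))])
      (by linarith [min_le_left a (1 / (2 * (B + 1)))])
  -- the parameter is made part of the state, so that it can be varied as an initial value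
  let f : ℝ → W × ℝ → W × ℝ := fun t x => (x.2 • L t x.1, 0)
  let x₀ : W × ℝ := (w₀, 1 / 2)
  have hball : ∀ x ∈ Metric.closedBall x₀ 1, ‖x.1‖ ≤ ‖w₀‖ + 1 ∧ |x.2| ≤ 2 := by
    intro x hx
    rw [Metric.mem_closedBall, dist_eq_norm, Prod.norm_def, max_le_iff] at hx
    simp only [Prod.fst_sub, Prod.snd_sub, x₀] at hx
    constructor
    · have := norm_sub_norm_le x.1 w₀; linarith [hx.1]
    · have h2 := hx.2
      rw [Real.norm_eq_abs, abs_le] at h2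
      rw [abs_le]; constructor <;> linarith [h2.1, h2.2]
  have ht₀ : t₀ ∈ Icc (t₀ - δ) (t₀ + δ) := ⟨by linarith, by linarith⟩
  have hPL : IsPicardLindelof f (⟨t₀, ht₀⟩ : Icc (t₀ - δ) (t₀ + δ)) x₀ 1 (1 / 2)
      (⟨B, hB0⟩ : NNReal) (⟨K, hK0⟩ : NNReal) := by
    constructor
    · intro t ht
      apply LipschitzOnWith.of_dist_le_mul
      intro x hx y hy
      have hx := hball x (by simpa using hx)
      have hy := hball y (by simpa using hy)
      have hLt := hM t (hsub ht)
      have h1 : ‖x.1 - y.1‖ ≤ dist x y := by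
        rw [dist_eq_norm]; exact norm_fst_le (x - y)
      have h2 : |x.2 - y.2| ≤ dist x y := by
        rw [dist_eq_norm]; exact norm_snd_le (x - y)
      have h3 : x.2 • L t x.1 - y.2 • L t y.1 = (x.2 - y.2) • L t x.1 + y.2 • L t (x.1 - y.1) := by
        rw [map_sub, sub_smul, smul_sub]; abel
      have h4 : ‖x.2 • L t x.1 - y.2 • L t y.1‖ ≤ K * dist x y := by
        rw [h3]
        refine (norm_add_le _ _).trans ?_
        rw [norm_smul, norm_smul, Real.norm_eq_abs, Real.norm_eq_abs]
        have h5 : ‖L t x.1‖ ≤ M * (‖w₀‖ + 1) :=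
          ((L t).le_opNorm _).trans (mul_le_mul hLt hx.1 (norm_nonneg _) hM0)
        have h6 : ‖L t (x.1 - y.1)‖ ≤ M * dist x y :=
          ((L t).le_opNorm _).trans (mul_le_mul hLt h1 (norm_nonneg _) hM0)
        calc _ ≤ dist x y * (M * (‖w₀‖ + 1)) + 2 * (M * dist x y) := by
              gcongr
              exact hy.2
          _ = K * dist x y := by rw [hK]; ring
      show dist (f t x) (f t y) ≤ K * dist x y
      rw [dist_eq_norm, Prod.norm_def]
      simp only [f, Prod.fst_sub, Prod.snd_sub, sub_zero, norm_zero]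
      exact max_le h4 (by positivity)
    · intro x hx
      have := hL.mono hsub
      exact (continuousOn_const.smul (this.clm_apply continuousOn_const)).prodMk continuousOn_const
    · intro t ht x hx
      have hx := hball x (by simpa using hx)
      have hLt := hM t (hsub ht)
      show ‖f t x‖ ≤ B
      rw [Prod.norm_def]
      simp only [f, norm_zero]
      refine max_le ?_ hB0
      rw [norm_smul, Real.norm_eq_abs]
      have h5 : ‖L t x.1‖ ≤ M * (‖w₀‖ + 1) :=
        ((L t).le_opNorm _).trans (mul_le_mul hLt hx.1 (norm_nonneg _) hM0)
      calc |x.2| * ‖L t x.1‖ ≤ 2 * (M * (‖w₀‖ + 1)) := by gcongr; exact hx.2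
        _ = B := by rw [hB]; ring
    · show B * max (t₀ + δ - t₀) (t₀ - (t₀ - δ)) ≤ _
      have h1 : max (t₀ + δ - t₀) (t₀ - (t₀ - δ)) = δ := by
        rw [add_sub_cancel_left, sub_sub_cancel, max_self]
      have h2 : δ ≤ 1 / (2 * (B + 1)) := min_le_right _ _
      rw [h1]
      have h3 : B * δ ≤ 1 / 2 := by
        calc B * δ ≤ (B + 1) * (1 / (2 * (B + 1))) := by gcongr; linarith
          _ = 1 / 2 := by field_simp
      push_cast
      linarith
  obtain ⟨α, hα, hαc⟩ := hPL.exists_forall_mem_closedBall_eq_hasDerivWithinAt_continuousOn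
  have hmem : ∀ u ∈ Icc (0 : ℝ) 1,
      ((w₀, u) : W × ℝ) ∈ Metric.closedBall x₀ ((1 / 2 : NNReal) : ℝ) := by
    intro u hu
    rw [Metric.mem_closedBall, dist_eq_norm, Prod.norm_def]
    simp only [x₀, Prod.fst_sub, Prod.snd_sub, sub_self, norm_zero]
    push_cast
    refine max_le (by norm_num) ?_
    rw [Real.norm_eq_abs, abs_le]
    constructor <;> linarith [hu.1, hu.2]
  have hsnd : ∀ u ∈ Icc (0 : ℝ) 1, ∀ t ∈ Icc (t₀ - δ) (t₀ + δ), (α ((w₀, u), t)).2 = u := by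
    intro u hu t ht
    obtain ⟨h0, hd⟩ := hα _ (hmem u hu)
    have h1 : ∀ s ∈ Icc (t₀ - δ) (t₀ + δ),
        HasDerivWithinAt (fun s => (α ((w₀, u), s)).2) 0 (Icc (t₀ - δ) (t₀ + δ)) s := by
      intro s hs
      exact (hd s hs).snd
    have h2 := (convex_Icc _ _).norm_image_sub_le_of_norm_hasDerivWithin_le h1
      (C := 0) (fun s hs => by simp) ht₀ ht
    simp only [zero_mul, norm_le_zero_iff, sub_eq_zero] at h2
    rw [h2]
    exact congrArg Prod.snd h0
  refine ⟨δ, ⟨hδ0, min_le_left _ _⟩, fun u t => (α ((w₀, u), t)).1, ?_, fun u hu => ⟨?_, ?_⟩⟩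
  · have h1 : ContinuousOn (fun q : ℝ × ℝ => (((w₀, q.1) : W × ℝ), q.2))
        (Icc 0 1 ×ˢ Ioo (t₀ - δ) (t₀ + δ)) := by fun_prop
    exact (hαc.comp h1 fun q hq => ⟨hmem _ hq.1, Ioo_subset_Icc_self hq.2⟩).fst
  · exact congrArg Prod.fst (hα _ (hmem u hu)).1
  · intro t ht
    have h1 := ((hα _ (hmem u hu)).2 t (Ioo_subset_Icc_self ht)).hasDerivAt (Icc_mem_nhds ht.1 ht.2)
    have h2 := h1.fst
    simp only [f] at h2
    rwa [hsnd u hu t (Ioo_subset_Icc_self ht)] at h2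

end

section

/-- Composition of operators as a continuous bilinear map. -/
def mulL : Op →L[ℝ] Op →L[ℝ] Op := ContinuousLinearMap.mul ℝ Op

@[simp] lemma mulL_apply (A B : Op) : mulL A B = A * B := rfl

/-! ### Scaling the bending of a one-parameter family of frames -/

lemma eq_of_hasDerivAt_zero {W : Type*} [NormedAddCommGroup W] [NormedSpace ℝ W] {s : Set ℝ}
    (hs : Convex ℝ s) {g : ℝ → W} (h : ∀ t ∈ s, HasDerivAt g 0 t) {x y : ℝ} (hx : x ∈ s)
    (hy : y ∈ s) : g x = g y := by
  have h2 := hs.norm_image_sub_le_of_norm_hasDerivWithin_le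
    (fun t ht => (h t ht).hasDerivWithinAt) (C := 0) (fun s hs => by simp) hy hx
  simpa [sub_eq_zero] using h2

/-- `e`, `p` describe a family of rigid motions `w ↦ e t w + p t`, with time derivatives `e'`, `p'`.
The family `eu u`, `pu u`, where `u ∈ [0, 1]`, has `u` times the body velocity of `e`, `p`; it is
the given family for `u = 1` and rests at `A`, `b` for `u = 0`. -/
structure IsBending (e e' : ℝ → Op) (p p' : ℝ → Space) (J : Set ℝ) (A : Op) (b : Space)
    (eu : ℝ → ℝ → Op) (pu : ℝ → ℝ → Space) : Prop where
  continuousOn_rot : ContinuousOn (fun q : ℝ × ℝ => eu q.1 q.2) (Icc 0 1 ×ˢ J)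
  continuousOn_trans : ContinuousOn (fun q : ℝ × ℝ => pu q.1 q.2) (Icc 0 1 ×ˢ J)
  isRot : ∀ u ∈ Icc (0 : ℝ) 1, ∀ t ∈ J, IsRot (eu u t)
  deriv_rot : ∀ u ∈ Icc (0 : ℝ) 1, ∀ t ∈ J,
    HasDerivAt (eu u) (u • (eu u t * star (e t) * e' t)) t
  deriv_trans : ∀ u ∈ Icc (0 : ℝ) 1, ∀ t ∈ J,
    HasDerivAt (pu u) (u • (eu u t * star (e t)) (p' t)) t
  one : ∀ t ∈ J, eu 1 t = e t ∧ pu 1 t = p t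
  zero : ∀ t ∈ J, eu 0 t = A ∧ pu 0 t = b

/-- The body velocity of a family of rotations is skew. -/
lemma skew_of_isRot {e : ℝ → Op} {e' : Op} {t : ℝ} (he : HasDerivAt e e' t)
    (hr : ∀ᶠ s in 𝓝 t, IsRot (e s)) : star (star (e t) * e') = -(star (e t) * e') := by
  have h1 : HasDerivAt (fun s => star (e s) * e s) (star e' * e t + star (e t) * e') t :=
    he.star.mul he
  have h2 : HasDerivAt (fun s => star (e s) * e s) 0 t :=
    (hasDerivAt_const t (1 : Op)).congr_of_eventuallyEq (hr.mono fun s hs => hs.1)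
  have h3 := h1.unique h2
  rw [star_mul, star_star]
  exact eq_neg_of_add_eq_zero_left h3

lemma continuousOn_block {V W : Type*} [NormedAddCommGroup V] [NormedSpace ℝ V]
    [NormedAddCommGroup W] [NormedSpace ℝ W] {s : Set ℝ} {A : ℝ → V →L[ℝ] V} {B : ℝ → V →L[ℝ] W}
    (hA : ContinuousOn A s) (hB : ContinuousOn B s) :
    ContinuousOn (fun t => (ContinuousLinearMap.inl ℝ V W).comp
        ((A t).comp (ContinuousLinearMap.fst ℝ V W)) +
      (ContinuousLinearMap.inr ℝ V W).comp ((B t).comp (ContinuousLinearMap.fst ℝ V W))) s :=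
  (continuousOn_const.clm_comp (hA.clm_comp continuousOn_const)).add
    (continuousOn_const.clm_comp (hB.clm_comp continuousOn_const))

/-- A continuously differentiable family of rigid motions can, for a short time, be bent. -/
lemma exists_isBending {e e' : ℝ → Op} {p p' : ℝ → Space} {t₀ a : ℝ} (ha : 0 < a)
    (he : ∀ t ∈ Ioo (t₀ - a) (t₀ + a), HasDerivAt e (e' t) t)
    (hp : ∀ t ∈ Ioo (t₀ - a) (t₀ + a), HasDerivAt p (p' t) t)
    (he' : ContinuousOn e' (Ioo (t₀ - a) (t₀ + a)))
    (hp' : ContinuousOn p' (Ioo (t₀ - a) (t₀ + a)))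
    (hr : ∀ t ∈ Ioo (t₀ - a) (t₀ + a), IsRot (e t)) :
    ∃ δ ∈ Ioo 0 a, ∃ eu pu,
      IsBending e e' p p' (Ioo (t₀ - δ) (t₀ + δ)) (e t₀) (p t₀) eu pu := by
  have hec : ContinuousOn e (Ioo (t₀ - a) (t₀ + a)) := fun t ht =>
    (he t ht).continuousAt.continuousWithinAt
  let L : ℝ → (Op × Space) →L[ℝ] (Op × Space) := fun t =>
    (ContinuousLinearMap.inl ℝ Op Space).comp
        (((mulL).flip (star (e t) * e' t)).comp
          (ContinuousLinearMap.fst ℝ Op Space)) +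
      (ContinuousLinearMap.inr ℝ Op Space).comp
        ((Op.act.flip (star (e t) (p' t))).comp
          (ContinuousLinearMap.fst ℝ Op Space))
  have hLa : ∀ t x, L t x = (x.1 * (star (e t) * e' t), x.1 (star (e t) (p' t))) := by
    intro t x
    simp [L]
  have hstar : ContinuousOn (fun t => star (e t)) (Ioo (t₀ - a) (t₀ + a)) :=
    continuous_star.comp_continuousOn hec
  have hLc : ContinuousOn L (Ioo (t₀ - a) (t₀ + a)) := by
    refine continuousOn_block ?_ ?_
    · exact (ContinuousLinearMap.continuous _).comp_continuousOn (hstar.mul he')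
    · exact (ContinuousLinearMap.continuous _).comp_continuousOn
        ((Op.act.continuous.comp_continuousOn hstar).clm_apply hp')
  have hsub : Icc (t₀ - a / 2) (t₀ + a / 2) ⊆ Ioo (t₀ - a) (t₀ + a) := fun t ht =>
    ⟨by linarith [ht.1], by linarith [ht.2]⟩
  obtain ⟨δ, hδ, φ, hφc, hφ⟩ := exists_linear_flow L (half_pos ha) (hLc.mono hsub) (e t₀, p t₀)
  have hJ : Ioo (t₀ - δ) (t₀ + δ) ⊆ Ioo (t₀ - a) (t₀ + a) := fun t ht =>
    ⟨by linarith [ht.1, hδ.2], by linarith [ht.2, hδ.2]⟩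
  have ht₀ : t₀ ∈ Ioo (t₀ - δ) (t₀ + δ) := ⟨by linarith [hδ.1], by linarith [hδ.1]⟩
  have hd1 : ∀ u ∈ Icc (0 : ℝ) 1, ∀ t ∈ Ioo (t₀ - δ) (t₀ + δ),
      HasDerivAt (fun t => (φ u t).1) (u • ((φ u t).1 * star (e t) * e' t)) t := by
    intro u hu t ht
    have := hasFDerivAt_fst.comp_hasDerivAt t ((hφ u hu).2 t ht)
    rw [hLa] at this
    exact this.congr_deriv (by simp [mul_assoc])
  have hd2 : ∀ u ∈ Icc (0 : ℝ) 1, ∀ t ∈ Ioo (t₀ - δ) (t₀ + δ),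
      HasDerivAt (fun t => (φ u t).2) (u • ((φ u t).1 * star (e t)) (p' t)) t := by
    intro u hu t ht
    have := hasFDerivAt_snd.comp_hasDerivAt t ((hφ u hu).2 t ht)
    rw [hLa] at this
    exact this.congr_deriv (by simp)
  have hskew : ∀ t ∈ Ioo (t₀ - a) (t₀ + a), star (star (e t) * e' t) = -(star (e t) * e' t) :=
    fun t ht => skew_of_isRot (he t ht) (Filter.eventually_of_mem (isOpen_Ioo.mem_nhds ht) hr)
  have hrot : ∀ u ∈ Icc (0 : ℝ) 1, ∀ t ∈ Ioo (t₀ - δ) (t₀ + δ), IsRot (φ u t).1 := by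
    intro u hu
    have h1 : ∀ t ∈ Ioo (t₀ - δ) (t₀ + δ), (φ u t).1 * star (φ u t).1 = 1 := by
      intro t ht
      have h2 : ∀ t ∈ Ioo (t₀ - δ) (t₀ + δ),
          HasDerivAt (fun t => (φ u t).1 * star (φ u t).1) 0 t := by
        intro t ht
        refine ((hd1 u hu t ht).mul (hd1 u hu t ht).star).congr_deriv ?_
        rw [mul_assoc, star_smul, star_mul, hskew t (hJ ht)]
        simp [mul_assoc]
      have h3 := eq_of_hasDerivAt_zero (convex_Ioo _ _) h2 ht ht₀
      simp only [(hφ u hu).1] at h3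
      rw [h3, (hr t₀ (hJ ht₀)).mul_star]
    refine isRot_of_isPreconnected isPreconnected_Ioo
      (fun t ht => (hd1 u hu t ht).continuousAt.continuousWithinAt)
      (fun t ht => op_mul_eq_one_symm (h1 t ht)) ht₀ ?_
    simp only [(hφ u hu).1]
    exact hr t₀ (hJ ht₀)
  have h11 : (1 : ℝ) ∈ Icc (0 : ℝ) 1 := ⟨zero_le_one, le_rfl⟩
  have h00 : (0 : ℝ) ∈ Icc (0 : ℝ) 1 := ⟨le_rfl, zero_le_one⟩
  have hone : ∀ t ∈ Ioo (t₀ - δ) (t₀ + δ), (φ 1 t).1 = e t := by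
    intro t ht
    have h2 : ∀ t ∈ Ioo (t₀ - δ) (t₀ + δ), HasDerivAt (fun t => (φ 1 t).1 * star (e t)) 0 t := by
      intro t ht
      refine ((hd1 1 h11 t ht).mul (he t (hJ ht)).star).congr_deriv ?_
      have h3 := hskew t (hJ ht)
      rw [star_mul, star_star] at h3
      have h4 : star (e' t) = -(star (e t) * e' t) * star (e t) := by
        rw [← h3, mul_assoc, (hr t (hJ ht)).mul_star, mul_one]
      rw [h4]
      simp [mul_assoc]
    have h3 := eq_of_hasDerivAt_zero (convex_Ioo _ _) h2 ht ht₀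
    simp only [(hφ 1 h11).1, (hr t₀ (hJ ht₀)).mul_star] at h3
    calc (φ 1 t).1 = (φ 1 t).1 * star (e t) * e t := by
          rw [mul_assoc, (hr t (hJ ht)).1, mul_one]
      _ = e t := by rw [h3, one_mul]
  refine ⟨δ, ⟨hδ.1, by linarith [hδ.2]⟩, fun u t => (φ u t).1, fun u t => (φ u t).2, hφc.fst,
    hφc.snd, hrot, hd1, hd2, fun t ht => ⟨hone t ht, ?_⟩, fun t ht => ⟨?_, ?_⟩⟩
  · have h2 : ∀ t ∈ Ioo (t₀ - δ) (t₀ + δ), HasDerivAt (fun t => (φ 1 t).2 - p t) 0 t := by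
      intro t ht
      refine ((hd2 1 h11 t ht).sub (hp t (hJ ht))).congr_deriv ?_
      rw [hone t ht, (hr t (hJ ht)).mul_star]
      simp
    have h3 := eq_of_hasDerivAt_zero (convex_Ioo _ _) h2 ht ht₀
    simp only [(hφ 1 h11).1, sub_self] at h3
    exact sub_eq_zero.1 h3
  · have h2 := eq_of_hasDerivAt_zero (convex_Ioo _ _)
      (fun t ht => by simpa using hd1 0 h00 t ht) ht ht₀
    simpa only [(hφ 0 h00).1] using h2
  · have h2 := eq_of_hasDerivAt_zero (convex_Ioo _ _)
      (fun t ht => by simpa using hd2 0 h00 t ht) ht ht₀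
    simpa only [(hφ 0 h00).1] using h2

/-! ### Framed surfaces -/

/-- On the set `R`, the surface `f` is `C²` with isometric differential, `E` is its frame, and
`E'` is the differential of the frame. -/
structure IsFramed (f : Plane → Space) (R : Set Plane) (E : Plane → Op)
    (E' : Plane → Plane →L[ℝ] Op) : Prop where
  isRot : ∀ y ∈ R, IsRot (E y)
  deriv_surface : ∀ y ∈ R, HasFDerivWithinAt f ((Op.act (E y)).comp emb) R y
  deriv_frame : ∀ y ∈ R, HasFDerivWithinAt E (E' y) R y
  continuousOn : ContinuousOn E' R

namespace IsFramed

variable {f : Plane → Space} {R : Set Plane} {E : Plane → Op} {E' : Plane → Plane →L[ℝ] Op}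

lemma continuousOn_frame (h : IsFramed f R E E') : ContinuousOn E R :=
  fun y hy => (h.deriv_frame y hy).continuousWithinAt

lemma continuousOn_surface (h : IsFramed f R E E') : ContinuousOn f R :=
  fun y hy => (h.deriv_surface y hy).continuousWithinAt

lemma mono (h : IsFramed f R E E') {R' : Set Plane} (hR : R' ⊆ R) : IsFramed f R' E E' :=
  ⟨fun y hy => h.isRot y (hR hy), fun y hy => (h.deriv_surface y (hR hy)).mono hR,
    fun y hy => (h.deriv_frame y (hR hy)).mono hR, h.continuousOn.mono hR⟩

lemma contDiffOn (h : IsFramed f R E E') : ContDiffOn ℝ 2 f R := by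
  intro y hy
  have hR : R ∈ 𝓝[insert y R] y := by rw [insert_eq_of_mem hy]; exact self_mem_nhdsWithin
  have h1 : ContDiffWithinAt ℝ 1 E R y := by
    have := (contDiffWithinAt_succ_iff_hasFDerivWithinAt (𝕜 := ℝ) (f := E) (s := R) (x := y)
      (n := 0) (by simp)).2 ⟨R, hR, by simp, E', h.deriv_frame, ?_⟩
    · simpa using this
    · exact (contDiffOn_zero.2 h.continuousOn) y hy
  have := (contDiffWithinAt_succ_iff_hasFDerivWithinAt (𝕜 := ℝ) (f := f) (s := R) (x := y)
      (n := 1) (by simp)).2 ⟨R, hR, by simp, fun y => (Op.act (E y)).comp emb, h.deriv_surface, ?_⟩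
  · norm_num at this
    exact this
  · exact (Op.act.contDiff.comp_contDiffWithinAt h1).clm_comp contDiffWithinAt_const

/-- The translation parts of the frames turn with the frames. -/
lemma deriv_trans (h : IsFramed f R E E') {y : Plane} (hy : y ∈ R) :
    HasFDerivWithinAt (fun y => f y - E y (emb y)) (-(Op.act.comp (E' y)).flip (emb y)) R y := by
  refine ((h.deriv_surface y hy).sub
    ((Op.act.hasFDerivAt.comp_hasFDerivWithinAt y (h.deriv_frame y hy)).clm_apply
      emb.hasFDerivWithinAt)).congr_fderiv ?_
  simp

end IsFramed

/-- A function that factors through a scalar Lipschitz function `t` is differentiable as soon as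
another function that factors through `t` is, provided that the velocities of the two curves
are related linearly; `t` itself need not be differentiable. -/
lemma HasFDerivWithinAt.transfer {V W W' : Type*} [NormedAddCommGroup V] [NormedSpace ℝ V]
    [NormedAddCommGroup W] [NormedSpace ℝ W] [NormedAddCommGroup W'] [NormedSpace ℝ W']
    {R : Set V} {y : V} {t : V → ℝ} {φ : ℝ → W} {φ' : W} {ψ : ℝ → W'} {ψ' : W'}
    (hφ : HasDerivAt φ φ' (t y)) (hψ : HasDerivAt ψ ψ' (t y)) (L : W →L[ℝ] W') (hL : ψ' = L φ')
    (ht : (fun y' => t y' - t y) =O[𝓝[R] y] (fun y' => y' - y)) {Φ : V → W} {Φ' : V →L[ℝ] W}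
    (hΦ : HasFDerivWithinAt Φ Φ' R y) (hΦt : ∀ y' ∈ R, Φ y' = φ (t y')) (hy : y ∈ R) :
    HasFDerivWithinAt (fun y' => ψ (t y')) (L.comp Φ') R y := by
  have htt : Tendsto t (𝓝[R] y) (𝓝 (t y)) := by
    have h1 : Tendsto (fun y' => t y' - t y) (𝓝[R] y) (𝓝 0) := by
      refine ht.trans_tendsto ?_
      have : Tendsto (fun y' : V => y' - y) (𝓝 y) (𝓝 (y - y)) :=
        (continuous_id.sub continuous_const).tendsto y
      rw [sub_self] at this
      exact this.mono_left nhdsWithin_le_nhds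
    simpa using h1.add_const (t y)
  -- `ψ (t y') - L (φ (t y'))` varies by `o(t y' - t y)`, hence by `o(y' - y)`
  have h1 := ((hasDerivAt_iff_isLittleO.1 hψ).comp_tendsto htt).trans_isBigO ht
  have h2 := (L.isBigO_comp _ _).trans_isLittleO
    (((hasDerivAt_iff_isLittleO.1 hφ).comp_tendsto htt).trans_isBigO ht)
  have h3 := (L.isBigO_comp _ _).trans_isLittleO (hasFDerivWithinAt_iff_isLittleO.1 hΦ)
  rw [hasFDerivWithinAt_iff_isLittleO]
  refine ((h1.sub h2).add h3).congr' ?_ EventuallyEq.rfl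
  filter_upwards [self_mem_nhdsWithin] with y' hy'
  simp only [Function.comp_apply, map_sub, map_smul, hΦt y' hy', hΦt y hy, hL,
    ContinuousLinearMap.comp_apply]
  abel

/-- A surface whose frames form a one-parameter family is bent along with that family. -/
lemma IsBending.isFramed {e e' : ℝ → Op} {p p' : ℝ → Space} {J : Set ℝ} {A : Op} {b : Space}
    {eu : ℝ → ℝ → Op} {pu : ℝ → ℝ → Space} (h : IsBending e e' p p' J A b eu pu)
    {f : Plane → Space} {R : Set Plane} {E : Plane → Op} {E' : Plane → Plane →L[ℝ] Op}
    (hf : IsFramed f R E E') {t : Plane → ℝ} (htJ : MapsTo t R J)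
    (ht : ∀ y ∈ R, (fun y' => t y' - t y) =O[𝓝[R] y] (fun y' => y' - y))
    (he : ∀ s ∈ J, HasDerivAt e (e' s) s) (hp : ∀ s ∈ J, HasDerivAt p (p' s) s)
    (hE : ∀ y ∈ R, E y = e (t y)) (hP : ∀ y ∈ R, f y - E y (emb y) = p (t y))
    {u : ℝ} (hu : u ∈ Icc (0 : ℝ) 1) :
    IsFramed (fun y => pu u (t y) + eu u (t y) (emb y)) R (fun y => eu u (t y))
      (fun y => u • (mulL (eu u (t y) * star (E y))).comp (E' y)) := by
  have hd1 : ∀ y ∈ R, HasFDerivWithinAt (fun y => eu u (t y))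
      (u • (mulL (eu u (t y) * star (E y))).comp (E' y)) R y := by
    intro y hy
    have := HasFDerivWithinAt.transfer (he _ (htJ hy)) (h.deriv_rot u hu _ (htJ hy))
      (u • mulL (eu u (t y) * star (E y)))
      (by simp [hE y hy]) (ht y hy) (hf.deriv_frame y hy) hE hy
    refine this.congr_fderiv ?_
    rfl
  refine ⟨fun y hy => h.isRot u hu _ (htJ hy), fun y hy => ?_, hd1, ?_⟩
  · have h2 := HasFDerivWithinAt.transfer (hp _ (htJ hy)) (h.deriv_trans u hu _ (htJ hy))
      (u • Op.act (eu u (t y) * star (E y)))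
      (by simp [hE y hy]) (ht y hy) (hf.deriv_trans hy) hP hy
    refine (h2.add ((Op.act.hasFDerivAt.comp_hasFDerivWithinAt y (hd1 y hy)).clm_apply
      emb.hasFDerivWithinAt)).congr_fderiv ?_
    ext1 v
    simp
  · have hc : ContinuousOn (fun y => eu u (t y)) R := fun y hy => (hd1 y hy).continuousWithinAt
    refine ContinuousOn.const_smul ?_ u
    refine ContinuousOn.clm_comp ?_ hf.continuousOn
    exact (ContinuousLinearMap.continuous _).comp_continuousOn
      (hc.mul (continuous_star.comp_continuousOn hf.continuousOn_frame))

end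

/-! ### The frame of a folded sheet -/

section

/-- The frame of the surface `f` at `y`. -/
def frame (f : Plane → Space) (y : Plane) : Op := frameOf (fderiv ℝ f y)

lemma contDiff_frameOf {n : WithTop ℕ∞} : ContDiff ℝ n frameOf := by
  have h : frameOf = fun A : Plane →L[ℝ] Space => Op.ofL
      (ContinuousLinearMap.smulRightL ℝ Space Space (EuclideanSpace.proj (0 : Fin 3)) (A p1) +
      ContinuousLinearMap.smulRightL ℝ Space Space (EuclideanSpace.proj (1 : Fin 3)) (A p2) +
      ContinuousLinearMap.smulRightL ℝ Space Space (EuclideanSpace.proj (2 : Fin 3))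
        (crossL (A p1) (A p2))) := by
    funext A; rfl
  rw [h]
  fun_prop

/-- `A'` is a possible differential at a point with frame `A` of the frame of a surface without
stretching: the frame turns rigidly, and second derivatives are normal to the surface. -/
structure IsBendingForm (A : Op) (A' : Plane →L[ℝ] Op) : Prop where
  skew : ∀ v, star (star A * A' v) = -(star A * A' v)
  normal : ∀ v w w', (inner ℝ (A' v (emb w)) (A (emb w')) : ℝ) = 0

lemma isClosed_isBendingForm : IsClosed {q : Op × (Plane →L[ℝ] Op) | IsBendingForm q.1 q.2} := by
  have : {q : Op × (Plane →L[ℝ] Op) | IsBendingForm q.1 q.2} =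
      (⋂ v, {q | star (star q.1 * q.2 v) = -(star q.1 * q.2 v)}) ∩
      ⋂ v, ⋂ w, ⋂ w', {q | (inner ℝ (Op.act (q.2 v) (emb w)) (Op.act q.1 (emb w')) : ℝ) = 0} := by
    ext q
    simp only [mem_ofPred_eq, mem_inter_iff, mem_iInter]
    exact ⟨fun h => ⟨h.skew, h.normal⟩, fun h => ⟨h.1, h.2⟩⟩
  rw [this]
  refine (isClosed_iInter fun v => isClosed_eq ?_ ?_).inter
    (isClosed_iInter fun v => isClosed_iInter fun w => isClosed_iInter fun w' =>
      isClosed_eq ?_ continuous_const)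
  · have : Continuous fun q : Op × (Plane →L[ℝ] Op) => q.2 v := by fun_prop
    exact ((continuous_star.comp continuous_fst).mul this).star
  · have : Continuous fun q : Op × (Plane →L[ℝ] Op) => q.2 v := by fun_prop
    exact ((continuous_star.comp continuous_fst).mul this).neg
  · fun_prop

variable {ι : Type*} {P : CreaseRulePattern ι} {f : Plane → Space}

lemma isOpen_uncreased [Finite ι] (P : CreaseRulePattern ι) : IsOpen P.uncreased := by
  refine P.paper_open.sdiff (isClosed_iUnion_of_finite fun i => ?_)
  exact (isCompact_Icc.image_of_continuousOn (P.crease_continuous i)).isClosed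

lemma CreaseRulePattern.IsFolding.contDiffAt [Finite ι] (hf : P.IsFolding f) {y : Plane}
    (hy : y ∈ P.uncreased) : ContDiffAt ℝ 2 f y := by
  refine (hf.contDiffOn_face y hy).contDiffAt (inter_mem (P.paper_open.mem_nhds hy.1) ?_)
  exact mem_of_superset ((isOpen_uncreased P).connectedComponentIn.mem_nhds
    (mem_connectedComponentIn hy)) subset_closure

lemma CreaseRulePattern.IsFolding.isRot_frame (hf : P.IsFolding f) {y : Plane}
    (hy : y ∈ P.uncreased) : IsRot (frame f y) := isRot_frameOf (hf.isometric y hy)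

lemma CreaseRulePattern.IsFolding.hasFDerivAt [Finite ι] (hf : P.IsFolding f) {y : Plane}
    (hy : y ∈ P.uncreased) : HasFDerivAt f ((Op.act (frame f y)).comp emb) y := by
  refine ((hf.contDiffAt hy).differentiableAt (by norm_num)).hasFDerivAt.congr_fderiv ?_
  ext1 v
  exact (frameOf_emb _ v).symm

lemma CreaseRulePattern.IsFolding.contDiffAt_frame [Finite ι] (hf : P.IsFolding f) {y : Plane}
    (hy : y ∈ P.uncreased) : ContDiffAt ℝ 1 (frame f) y :=
  contDiff_frameOf.contDiffAt.comp y ((hf.contDiffAt hy).fderiv_right (by norm_num))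

lemma CreaseRulePattern.IsFolding.isFramed [Finite ι] (hf : P.IsFolding f) :
    IsFramed f P.uncreased (frame f) (fderiv ℝ (frame f)) where
  isRot _ hy := hf.isRot_frame hy
  deriv_surface _ hy := (hf.hasFDerivAt hy).hasFDerivWithinAt
  deriv_frame _ hy :=
    ((hf.contDiffAt_frame hy).differentiableAt (by norm_num)).hasFDerivAt.hasFDerivWithinAt
  continuousOn _ hy :=
    ((hf.contDiffAt_frame hy).fderiv_right (m := 0) (by norm_num)).continuousAt.continuousWithinAt

/-- Second derivatives of the surface are symmetric. -/
lemma CreaseRulePattern.IsFolding.fderiv_frame_symm [Finite ι] (hf : P.IsFolding f) {y : Plane}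
    (hy : y ∈ P.uncreased) (v w : Plane) :
    fderiv ℝ (frame f) y v (emb w) = fderiv ℝ (frame f) y w (emb v) := by
  have hd : HasFDerivAt (frame f) (fderiv ℝ (frame f) y) y :=
    ((hf.contDiffAt_frame hy).differentiableAt (by norm_num)).hasFDerivAt
  have h2 : HasFDerivAt (fderiv ℝ f) (fderiv ℝ (fderiv ℝ f) y) y :=
    (((hf.contDiffAt hy).fderiv_right (m := 1) (by norm_num)).differentiableAt
      (by norm_num)).hasFDerivAt
  have key : ∀ v w : Plane, fderiv ℝ (frame f) y v (emb w) = fderiv ℝ (fderiv ℝ f) y v w := by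
    intro v w
    have h3 : HasFDerivAt (fun y => Op.act (frame f y) (emb w))
        ((Op.act.flip (emb w)).comp (fderiv ℝ (frame f) y)) y :=
      (Op.act.flip (emb w)).hasFDerivAt.comp y hd
    have h4 : HasFDerivAt (fun y => fderiv ℝ f y w)
        ((ContinuousLinearMap.apply ℝ Space w).comp (fderiv ℝ (fderiv ℝ f) y)) y :=
      (ContinuousLinearMap.apply ℝ Space w).hasFDerivAt.comp y h2
    have h5 : (fun y => Op.act (frame f y) (emb w)) = fun y => fderiv ℝ f y w :=
      funext fun y => frameOf_emb _ w
    rw [h5] at h3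
    exact congrArg (fun A : Plane →L[ℝ] Space => A v) (h3.unique h4)
  rw [key, key]
  exact (hf.contDiffAt hy).isSymmSndFDerivAt (by simp) v w

/-- Off the creases, second derivatives of the folded surface are normal to it, as those of any
isometric immersion. -/
lemma CreaseRulePattern.IsFolding.isBendingForm [Finite ι] (hf : P.IsFolding f) {y : Plane}
    (hy : y ∈ P.uncreased) : IsBendingForm (frame f y) (fderiv ℝ (frame f) y) := by
  have hd : HasFDerivAt (frame f) (fderiv ℝ (frame f) y) y :=
    ((hf.contDiffAt_frame hy).differentiableAt (by norm_num)).hasFDerivAt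
  have hskew : ∀ v, star (star (frame f y) * fderiv ℝ (frame f) y v) =
      -(star (frame f y) * fderiv ℝ (frame f) y v) := by
    intro v
    have hl : HasDerivAt (fun t : ℝ => y + t • v) v 0 := by
      simpa using ((hasDerivAt_id (0 : ℝ)).smul_const v).const_add y
    have hd0 : HasFDerivAt (frame f) (fderiv ℝ (frame f) y) (y + (0 : ℝ) • v) := by simpa using hd
    have h1 := hd0.comp_hasDerivAt (0 : ℝ) hl
    have h2 : ∀ᶠ t : ℝ in 𝓝 0, IsRot (frame f (y + t • v)) := by
      have h3 : Tendsto (fun t : ℝ => y + t • v) (𝓝 0) (𝓝 y) := by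
        simpa using hl.continuousAt.tendsto
      exact (h3.eventually ((isOpen_uncreased P).mem_nhds hy)).mono fun t ht => hf.isRot_frame ht
    simpa using skew_of_isRot h1 h2
  refine ⟨hskew, ?_⟩
  have hr := hf.isRot_frame hy
  set E := frame f y
  set E' := fderiv ℝ (frame f) y
  -- `c` is symmetric in its first two arguments and alternating in the last two
  let c : Plane → Plane → Plane → ℝ := fun v w w' => inner ℝ (E' v (emb w)) (E (emb w'))
  have h1 : ∀ v w w', c v w w' = c w v w' := fun v w w' => by
    simp only [c]; rw [hf.fderiv_frame_symm hy]
  have h2 : ∀ v w w', c v w w' = -c v w' w := by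
    intro v w w'
    have h3 : c v w w' = inner ℝ ((star E * E' v) (emb w)) (emb w') := by
      rw [real_inner_comm, Op.mul_apply, Op.inner_star, real_inner_comm]
    have h4 : c v w' w = inner ℝ (emb w) ((star E * E' v) (emb w')) := by
      rw [Op.mul_apply, Op.inner_star, real_inner_comm]
    have h5 : (inner ℝ (emb w) (star (star E * E' v) (emb w')) : ℝ) =
        inner ℝ ((star E * E' v) (emb w)) (emb w') := Op.inner_star _ _ _
    rw [h3, h4, ← h5, hskew v]
    simp
  intro v w w'
  show c v w w' = 0
  -- six exchanges of arguments lead from `c v w w'` to its negative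
  linarith [h1 v w w', h2 v w w', h1 v w' w, h2 w v w', h1 w w' v, h2 w' w v, h1 w' v w,
    h2 w w' v, h2 w' v w]

/-! ### Rule segments -/

/-- A rotation is determined by its values at one tangent direction and at the normal. -/
lemma IsRot.ext_of {A B : Op} (hA : IsRot A) (hB : IsRot B) {d : Plane} (hd : d ≠ 0)
    (h1 : A (emb d) = B (emb d)) (h2 : A e3 = B e3) : A = B := by
  have hq : cross e3 (emb d) = emb (quarterTurn d) := by
    apply space_ext <;> simp
  have h3 : A (emb (quarterTurn d)) = B (emb (quarterTurn d)) := by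
    rw [← hq, ← hA.2, ← hB.2, h1, h2]
  have hn : d 0 * d 0 + d 1 * d 1 ≠ 0 := by
    rw [← inner2]
    exact inner_self_ne_zero.2 hd
  have hv : ∀ v : Plane, A (emb v) = B (emb v) := by
    intro v
    have hdec : (d 0 * d 0 + d 1 * d 1) • v =
        (v 0 * d 0 + v 1 * d 1) • d + (v 1 * d 0 - v 0 * d 1) • quarterTurn d := by
      apply plane_ext <;> simp <;> ring
    have h4 : ∀ C : Op, (d 0 * d 0 + d 1 * d 1) • C (emb v) =
        (v 0 * d 0 + v 1 * d 1) • C (emb d) +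
          (v 1 * d 0 - v 0 * d 1) • C (emb (quarterTurn d)) := by
      intro C
      rw [← map_smul, ← map_smul, hdec, map_add, map_add, map_smul, map_smul, map_smul, map_smul]
    have h5 := h4 A
    rw [h1, h3, ← h4 B] at h5
    exact smul_right_injective _ hn h5
  exact op_ext (hv p1) (hv p2) h2

lemma mem_uncreased_of_rule {a b : Plane} (hab : (a, b) ∈ P.rules) {x : Plane}
    (hx : x ∈ openSegment ℝ a b) : x ∈ P.uncreased := P.rule_subset a b hab hx

/-- The moving frame, as a rigid motion, is constant along rule segments. -/
lemma CreaseRulePattern.IsFolding.frame_eq_of_rule [Finite ι] (hf : P.IsFolding f) {a b : Plane}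
    (hab : (a, b) ∈ P.rules) {x y : Plane} (hx : x ∈ openSegment ℝ a b)
    (hy : y ∈ openSegment ℝ a b) :
    frame f x = frame f y ∧ f x - frame f x (emb x) = f y - frame f y (emb y) := by
  set d := b - a with hd
  have hd0 : d ≠ 0 := sub_ne_zero.2 (P.rule_ne a b hab).symm
  let c : ℝ → Plane := fun l => a + l • d
  have hc : ∀ l ∈ Ioo (0 : ℝ) 1, c l ∈ openSegment ℝ a b := by
    intro l hl; rw [openSegment_eq_image']; exact ⟨l, hl, rfl⟩
  -- the image of the segment runs straight in the direction of the frame at any of its points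
  have hX : ∀ m ∈ Ioo (0 : ℝ) 1, ∀ l ∈ Ioo (0 : ℝ) 1,
      f (c m) - f (c l) = (m - l) • frame f (c m) (emb d) := by
    intro m hm l hl
    have hdist : ∀ m ∈ Ioo (0 : ℝ) 1, ‖f (c m) - f (c l)‖ ^ 2 = (m - l) ^ 2 * ‖d‖ ^ 2 := by
      intro m hm
      rw [← dist_eq_norm, hf.rule_straight a b hab _ (hc m hm) _ (hc l hl), dist_eq_norm]
      have : c m - c l = (m - l) • d := by simp only [c]; rw [sub_smul]; abel
      rw [this, norm_smul, mul_pow, Real.norm_eq_abs, sq_abs]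
    have hcd : HasDerivAt c d m := by
      show HasDerivAt (fun l : ℝ => a + l • d) d m
      simpa using ((hasDerivAt_id m).smul_const d).const_add a
    have h1 : HasDerivAt (fun m => f (c m)) (frame f (c m) (emb d)) m :=
      (hf.hasFDerivAt (mem_uncreased_of_rule hab (hc m hm))).comp_hasDerivAt m hcd
    have h2 := (h1.sub_const (f (c l))).norm_sq
    have h3 : HasDerivAt (fun m : ℝ => (m - l) ^ 2 * ‖d‖ ^ 2) (2 * (m - l) * ‖d‖ ^ 2) m := by
      simpa using (((hasDerivAt_id m).sub_const l).pow 2).mul_const (‖d‖ ^ 2)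
    have h4 : (fun m => ‖f (c m) - f (c l)‖ ^ 2) =ᶠ[𝓝 m] fun m => (m - l) ^ 2 * ‖d‖ ^ 2 :=
      Filter.eventually_of_mem (isOpen_Ioo.mem_nhds hm) hdist
    have h5 := h2.unique (h3.congr_of_eventuallyEq h4)
    have h6 := hdist m hm
    have h7 : ‖frame f (c m) (emb d)‖ = ‖d‖ := by
      rw [(hf.isRot_frame (mem_uncreased_of_rule hab (hc m hm))).norm_map, norm_emb]
    have h8 : ‖(f (c m) - f (c l)) - (m - l) • frame f (c m) (emb d)‖ ^ 2 = 0 := by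
      rw [norm_sub_sq_real, inner_smul_right, norm_smul, h7, h6, mul_pow, Real.norm_eq_abs, sq_abs]
      linear_combination -(m - l) * h5
    exact sub_eq_zero.1 (norm_eq_zero.1 (pow_eq_zero_iff two_ne_zero |>.1 h8))
  have key : ∀ m ∈ Ioo (0 : ℝ) 1, ∀ l ∈ Ioo (0 : ℝ) 1, m ≠ l → frame f (c m) = frame f (c l) := by
    intro m hm l hl hml
    refine (hf.isRot_frame (mem_uncreased_of_rule hab (hc m hm))).ext_of
      (hf.isRot_frame (mem_uncreased_of_rule hab (hc l hl))) hd0 ?_ ?_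
    · have h1 := hX m hm l hl
      have h2 := hX l hl m hm
      have h3 : (m - l) • frame f (c m) (emb d) = (m - l) • frame f (c l) (emb d) := by
        rw [← h1, ← neg_sub (f (c l)), h2, ← neg_smul, neg_sub]
      exact smul_right_injective _ (sub_ne_zero.2 hml) h3
    · have := hf.rule_normal a b hab _ (hc m hm) _ (hc l hl)
      rwa [surfaceNormal_eq, surfaceNormal_eq] at this
  rw [openSegment_eq_image'] at hx hy
  obtain ⟨m, hm, rfl⟩ := hx
  obtain ⟨l, hl, rfl⟩ := hy
  by_cases hml : m = l
  · subst hml; exact ⟨rfl, rfl⟩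
  have h1 := key m hm l hl hml
  refine ⟨h1, ?_⟩
  have h2 := hX m hm l hl
  simp only [c] at h1 h2
  rw [← hd, ← h1, sub_eq_sub_iff_sub_eq_sub, h2, ← map_sub, ← map_sub, add_sub_add_left_eq_sub,
    ← sub_smul, map_smul, map_smul]

/-- The frame of the surface does not turn in the direction of a rule segment, and its normal
curvature form vanishes on that direction. -/
lemma CreaseRulePattern.IsFolding.fderiv_frame_rule [Finite ι] (hf : P.IsFolding f) {a b : Plane}
    (hab : (a, b) ∈ P.rules) {y : Plane} (hy : y ∈ openSegment ℝ a b) (v : Plane) :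
    fderiv ℝ (frame f) y (b - a) = 0 ∧ fderiv ℝ (frame f) y v (emb (b - a)) = 0 := by
  have hyu := mem_uncreased_of_rule hab hy
  have hd : HasFDerivAt (frame f) (fderiv ℝ (frame f) y) y :=
    ((hf.contDiffAt_frame hyu).differentiableAt (by norm_num)).hasFDerivAt
  have h0 : fderiv ℝ (frame f) y (b - a) = 0 := by
    rw [openSegment_eq_image'] at hy
    obtain ⟨l, hl, rfl⟩ := hy
    have hcd : HasDerivAt (fun l : ℝ => a + l • (b - a)) (b - a) l := by
      simpa using ((hasDerivAt_id l).smul_const (b - a)).const_add a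
    have h1 := hd.comp_hasDerivAt l hcd
    refine h1.unique ((hasDerivAt_const l (frame f (a + l • (b - a)))).congr_of_eventuallyEq ?_)
    refine Filter.eventually_of_mem (isOpen_Ioo.mem_nhds hl) fun m hm => ?_
    refine (hf.frame_eq_of_rule hab ?_ ?_).1 <;> rw [openSegment_eq_image']
    exacts [⟨m, hm, rfl⟩, ⟨l, hl, rfl⟩]
  refine ⟨h0, ?_⟩
  rw [hf.fderiv_frame_symm hyu, h0]
  simp

end

/-! ### Developments -/

section

variable {ι : Type*} {P : CreaseRulePattern ι} {f : Plane → Space}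

/-- A local solution of the folding problem, with time `u`, on the open set `U`: the surfaces `F u`
have the frames `E u`, which turn `u` times as fast as the frame of `f`, and the tangent of half
their fold angle along crease `i` is `u * m i`. The last condition is stated in terms of the limits
`EL`, `ER` of the frames on the two sides of the crease. -/
structure IsDevelopment (P : CreaseRulePattern ι) (f : Plane → Space) (m : ι → ℝ) (U : Set Plane)
    (E : unitInterval → Plane → Op) (F : unitInterval → Plane → Space) : Prop where
  isRot : ∀ u, ∀ y ∈ U ∩ P.uncreased, IsRot (E u y)
  continuous_frame : ∀ y ∈ U ∩ P.uncreased, Continuous fun u => E u y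
  continuousOn : ContinuousOn (fun q : unitInterval × Plane => F q.1 q.2) (univ ×ˢ U)
  deriv_frame : ∀ u, ∀ y ∈ U ∩ P.uncreased, HasFDerivAt (E u)
    ((u : ℝ) • (mulL (E u y * star (frame f y))).comp (fderiv ℝ (frame f) y)) y
  deriv_surface : ∀ u, ∀ y ∈ U ∩ P.uncreased, HasFDerivAt (F u) ((Op.act (E u y)).comp emb) y
  contDiffOn : ∀ u, ∀ x ∈ P.uncreased,
    ContDiffOn ℝ 2 (F u) (U ∩ closure (connectedComponentIn P.uncreased x))
  crease : ∀ u, ∀ i, ∀ s ∈ Ioo 0 (P.len i), P.crease i s ∈ U → ∃ EL ER : Op,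
    Tendsto (fun ε : ℝ => E u (P.crease i s + ε • P.leftNormal i s)) (𝓝[>] 0) (𝓝 EL) ∧
    Tendsto (fun ε : ℝ => E u (P.crease i s - ε • P.leftNormal i s)) (𝓝[>] 0) (𝓝 ER) ∧
    EL * darboux (P.tangent i s) =
      ER * darboux (P.tangent i s) * twist (2 * Real.arctan (u * m i)) ∧
    HasDerivAt (fun r => F u (P.crease i r)) (ER (emb (P.tangent i s))) s
  one : ∀ y ∈ U, F 1 y = f y
  zero : ∃ e : Plane →ᵃⁱ[ℝ] Space, EqOn (F 0) e U

/-- A rigid placement of the flat sheet in space. -/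
def flatPlacement {A : Op} (hA : IsRot A) (b : Space) : Plane →ᵃⁱ[ℝ] Space where
  toFun v := b + A (emb v)
  linear := ((Op.act A).comp emb : Plane →L[ℝ] Space)
  map_vadd' v w := by simp [map_add]; abel
  norm_map v := by simp [hA.norm_map, norm_emb]

lemma flatPlacement_apply {A : Op} (hA : IsRot A) (b : Space) (v : Plane) :
    flatPlacement hA b v = b + A (emb v) := rfl

/-! ### Away from the creases -/

lemma inner_quarterTurn_self (r : Plane) : (inner ℝ (quarterTurn r) r : ℝ) = 0 := by
  rw [inner2]; simp; ring

lemma norm_quarterTurn (r : Plane) : ‖quarterTurn r‖ = ‖r‖ := by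
  have h : (inner ℝ (quarterTurn r) (quarterTurn r) : ℝ) = inner ℝ r r := by
    rw [inner2, inner2]; simp; ring
  rw [real_inner_self_eq_norm_sq, real_inner_self_eq_norm_sq] at h
  exact (pow_left_inj₀ (norm_nonneg _) (norm_nonneg _) two_ne_zero).1 h

lemma eq_combo_of_norm_one {r : Plane} (hr : ‖r‖ = 1) (v : Plane) :
    v = (inner ℝ v (quarterTurn r) : ℝ) • quarterTurn r + (inner ℝ v r : ℝ) • r := by
  have h := inner_self_of_norm_one hr
  rw [inner2] at h
  apply plane_ext <;> simp [inner2]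
  · linear_combination -(v 0) * h
  · linear_combination -(v 1) * h

lemma norm_sq_combo {r : Plane} (hr : ‖r‖ = 1) (x s : ℝ) :
    ‖x • quarterTurn r + s • r‖ ^ 2 = x ^ 2 + s ^ 2 := by
  have h := inner_self_of_norm_one hr
  rw [inner2] at h
  rw [← real_inner_self_eq_norm_sq, inner2]
  simp
  linear_combination (x ^ 2 + s ^ 2) * h

/-- Rule segments run across every ball free of creases. -/
lemma mem_rule_of_mem_ball {z : Plane} {δ : ℝ} (hball : Metric.ball z δ ⊆ P.uncreased)
    {a b y w : Plane} (hab : (a, b) ∈ P.rules) (hy : y ∈ openSegment ℝ a b)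
    (hyb : y ∈ Metric.ball z δ) (hw : w ∈ Metric.ball z δ) {l : ℝ} (hl : w = y + l • (b - a)) :
    w ∈ openSegment ℝ a b := by
  rw [openSegment_eq_image'] at hy ⊢
  obtain ⟨θ, hθ, rfl⟩ := hy
  have hw' : w = a + (θ + l) • (b - a) := by rw [hl]; simp only [add_smul]; abel
  refine ⟨θ + l, ⟨?_, ?_⟩, hw'.symm⟩
  · by_contra hneg
    push Not at hneg
    refine P.rule_end a b hab (hball ((convex_ball z δ).segment_subset hw hyb ?_))
    rw [segment_eq_image']
    have hl' : 0 < -l := by linarith [hθ.1]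
    refine ⟨-(θ + l) / (-l), ⟨div_nonneg (by linarith) hl'.le,
      (div_le_one hl').2 (by linarith [hθ.1])⟩, ?_⟩
    have : (a + θ • (b - a)) - w = (-l) • (b - a) := by rw [hl]; simp
    simp only
    rw [this, smul_smul, div_mul_cancel₀ _ hl'.ne', hw', add_assoc, ← add_smul]
    simp
  · by_contra hneg
    push Not at hneg
    refine P.rule_end b a (P.rule_symm a b hab) (hball ((convex_ball z δ).segment_subset hyb hw ?_))
    rw [segment_eq_image']
    have hl' : 0 < l := by linarith [hθ.2]
    refine ⟨(1 - θ) / l, ⟨div_nonneg (by linarith [hθ.2]) hl'.le,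
      (div_le_one hl').2 (by linarith [hθ.1])⟩, ?_⟩
    have : w - (a + θ • (b - a)) = l • (b - a) := by rw [hl]; simp
    simp only
    rw [this, smul_smul, div_mul_cancel₀ _ hl'.ne', add_assoc, ← add_smul]
    simp

/-- Rule segments that meet span the same line. -/
lemma rule_dir_eq_of_mem {a b a' b' y : Plane} (hab : (a, b) ∈ P.rules) (hab' : (a', b') ∈ P.rules)
    (hy : y ∈ openSegment ℝ a b) (hy' : y ∈ openSegment ℝ a' b') :
    b' - a' = b - a ∨ b' - a' = -(b - a) := by
  rcases P.rule_disjoint a b a' b' hab hab' ⟨y, hy, hy'⟩ with ⟨rfl, rfl⟩ | ⟨rfl, rfl⟩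
  · left; rfl
  · right; rw [neg_sub]

/-- The rule segments near a point free of creases meet a common transversal line `z + ℝ n`; the
intersection point depends on the rule segment in a Lipschitz way because rule segments do not
cross. -/
lemma exists_transversal [Finite ι] (P : CreaseRulePattern ι) {z : Plane} (hz : z ∈ P.uncreased) :
    ∃ δ > 0, ∃ n : Plane, ∃ t : Plane → ℝ, t z = 0 ∧ Metric.ball z δ ⊆ P.uncreased ∧
      (∀ y ∈ Metric.ball z δ, ∀ y' ∈ Metric.ball z δ, |t y' - t y| ≤ 3 * ‖y' - y‖) ∧
      ∀ y ∈ Metric.ball z δ, ∃ a b, (a, b) ∈ P.rules ∧ y ∈ openSegment ℝ a b ∧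
        z + t y • n ∈ openSegment ℝ a b := by
  obtain ⟨ε, hε, hball⟩ := Metric.isOpen_iff.1 (isOpen_uncreased P) z hz
  obtain ⟨a₀, b₀, hab₀, hz₀⟩ := P.rule_cover z hz
  set d₀ := b₀ - a₀ with hd₀
  have hd₀0 : d₀ ≠ 0 := sub_ne_zero.2 (P.rule_ne _ _ hab₀).symm
  set r : Plane := ‖d₀‖⁻¹ • d₀ with hrdef
  have hr : ‖r‖ = 1 := by
    rw [hrdef, norm_smul, norm_inv, norm_norm, inv_mul_cancel₀ (norm_ne_zero_iff.2 hd₀0)]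
  have hd₀r : d₀ = ‖d₀‖ • r := by
    rw [hrdef, smul_smul, mul_inv_cancel₀ (norm_ne_zero_iff.2 hd₀0), one_smul]
  set n := quarterTurn r with hn
  set δ := ε / 4 with hδ
  have hδ0 : 0 < δ := by positivity
  -- coordinates across and along the rule segment of `z`
  let ξ : Plane → ℝ := fun y => inner ℝ (y - z) n
  let η : Plane → ℝ := fun y => inner ℝ (y - z) r
  have hdec : ∀ y, y = z + (ξ y • n + η y • r) := fun y => by
    have := eq_combo_of_norm_one hr (y - z)
    rw [← this, add_sub_cancel]
  have hξle : ∀ y, |ξ y| ≤ ‖y - z‖ := fun y => by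
    have := abs_real_inner_le_norm (y - z) n
    rwa [hn, norm_quarterTurn, hr, mul_one] at this
  have hηle : ∀ y, |η y| ≤ ‖y - z‖ := fun y => by
    have := abs_real_inner_le_norm (y - z) r
    rwa [hr, mul_one] at this
  have hnn : (inner ℝ n n : ℝ) = 1 := inner_self_of_norm_one (by rw [hn, norm_quarterTurn, hr])
  have hrr : (inner ℝ r r : ℝ) = 1 := inner_self_of_norm_one hr
  have hnr : (inner ℝ n r : ℝ) = 0 := inner_quarterTurn_self r
  have hrn : (inner ℝ r n : ℝ) = 0 := by rw [real_inner_comm]; exact hnr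
  have hmem : ∀ x s : ℝ, x ^ 2 + s ^ 2 < (4 * δ) ^ 2 → z + (x • n + s • r) ∈ Metric.ball z ε := by
    intro x s h
    rw [mem_ball_iff_norm, add_sub_cancel_left]
    rw [← norm_sq_combo hr x s] at h
    have h1 := lt_of_pow_lt_pow_left₀ 2 (by positivity) h
    calc _ < 4 * δ := h1
      _ = ε := by rw [hδ]; ring
  -- each rule segment is the graph of an affine function of slope at most `1 / 2`
  have key : ∀ y ∈ Metric.ball z δ, ∃ q : ℝ × ℝ, |q.2| ≤ 1 / 2 ∧ ξ y = q.1 + q.2 * η y ∧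
      ∃ a b, (a, b) ∈ P.rules ∧ (inner ℝ (b - a) r : ℝ) ≠ 0 ∧
        (inner ℝ (b - a) n : ℝ) = q.2 * inner ℝ (b - a) r ∧ y ∈ openSegment ℝ a b ∧
        ∀ s, |s| ≤ 2 * δ → z + ((q.1 + q.2 * s) • n + s • r) ∈ openSegment ℝ a b := by
    intro y hy
    have hyz : ‖y - z‖ < δ := mem_ball_iff_norm.1 hy
    have hyε : y ∈ Metric.ball z ε := mem_ball_iff_norm.2 (by linarith)
    obtain ⟨a, b, hab, hyab⟩ := P.rule_cover y (hball hyε)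
    set d := b - a with hd
    have hd0 : d ≠ 0 := sub_ne_zero.2 (P.rule_ne _ _ hab).symm
    have hddec : d = (inner ℝ d n : ℝ) • n + (inner ℝ d r : ℝ) • r := eq_combo_of_norm_one hr d
    have hslope : |(inner ℝ d n : ℝ)| ≤ 1 / 2 * |(inner ℝ d r : ℝ)| := by
      by_contra hcon
      push Not at hcon
      have hdn : (inner ℝ d n : ℝ) ≠ 0 := by
        intro h0
        rw [h0, abs_zero] at hcon
        linarith [abs_nonneg (inner ℝ d r : ℝ)]
      -- the rule segment of `y` would cross that of `z`
      set l := -ξ y / inner ℝ d n with hl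
      set w := y + l • d with hw
      have hwdec : w = z + ((0 : ℝ) • n + (η y + l * inner ℝ d r) • r) := by
        have : ξ y + l * inner ℝ d n = 0 := by rw [hl]; field_simp; ring
        calc w = (z + (ξ y • n + η y • r)) +
              l • ((inner ℝ d n : ℝ) • n + (inner ℝ d r : ℝ) • r) := by
              rw [← hdec y, ← hddec]
          _ = z + ((ξ y + l * inner ℝ d n) • n + (η y + l * inner ℝ d r) • r) := by module
          _ = _ := by rw [this]
      have h1 : |l * inner ℝ d r| ≤ 2 * δ := by
        rw [hl, abs_mul, abs_div, abs_neg, div_mul_eq_mul_div, div_le_iff₀ (abs_pos.2 hdn)]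
        have h2 := hξle y
        have h3 := abs_nonneg (ξ y)
        have h4 := abs_nonneg (inner ℝ d r : ℝ)
        nlinarith
      have h2 : |η y + l * inner ℝ d r| ≤ 3 * δ :=
        (abs_add_le _ _).trans (by linarith [hηle y])
      have hwε : w ∈ Metric.ball z ε := by
        rw [hwdec]
        apply hmem
        have := sq_le_sq' (by linarith [(abs_le.1 h2).1]) (abs_le.1 h2).2
        nlinarith
      have hwab := mem_rule_of_mem_ball hball hab hyab hyε hwε hw
      have hwab₀ : w ∈ openSegment ℝ a₀ b₀ := by
        refine mem_rule_of_mem_ball hball hab₀ hz₀ (Metric.mem_ball_self hε) hwε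
          (l := (η y + l * inner ℝ d r) * ‖d₀‖⁻¹) ?_
        rw [hwdec, ← hd₀, zero_smul, zero_add, mul_smul, hrdef]
      have hdd := rule_dir_eq_of_mem hab₀ hab hwab₀ hwab
      rw [← hd, ← hd₀] at hdd
      apply hdn
      rcases hdd with h | h <;> rw [h, hd₀r] <;> simp [inner_smul_left, inner_neg_left, hrn]
    have hdr : (inner ℝ d r : ℝ) ≠ 0 := by
      intro h0
      rw [h0, abs_zero, mul_zero] at hslope
      have h1 : (inner ℝ d n : ℝ) = 0 := abs_eq_zero.1 (le_antisymm hslope (abs_nonneg _))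
      rw [h0, h1] at hddec
      simp only [zero_smul, add_zero] at hddec
      exact hd0 hddec
    set m := (inner ℝ d n : ℝ) / inner ℝ d r with hm
    have hm1 : |m| ≤ 1 / 2 := by
      rw [hm, abs_div, div_le_iff₀ (abs_pos.2 hdr)]; exact hslope
    refine ⟨(ξ y - m * η y, m), hm1, by simp, a, b, hab, hdr, ?_, hyab, fun s hs => ?_⟩
    · rw [hm, div_mul_cancel₀ _ hdr]
    · refine mem_rule_of_mem_ball hball hab hyab hyε (hmem _ _ ?_)
        (l := (s - η y) / inner ℝ d r) ?_
      · have h1 : |ξ y - m * η y + m * s| ≤ 5 / 2 * δ := by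
          have h2 : ξ y - m * η y + m * s = ξ y + m * (s - η y) := by ring
          have h3 : |m * (s - η y)| ≤ 1 / 2 * (3 * δ) := by
            rw [abs_mul]
            have : |s - η y| ≤ 3 * δ := (abs_sub _ _).trans (by linarith [hηle y])
            exact mul_le_mul hm1 this (abs_nonneg _) (by norm_num)
          rw [h2]
          exact (abs_add_le _ _).trans (by linarith [hξle y])
        have h4 := sq_le_sq' (by linarith [(abs_le.1 h1).1]) (abs_le.1 h1).2
        have h5 := sq_le_sq' (by linarith [(abs_le.1 hs).1]) (abs_le.1 hs).2
        nlinarith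
      · have e1 : ξ y - m * η y + m * s = ξ y + (s - η y) / inner ℝ d r * inner ℝ d n := by
          rw [hm]; field_simp; ring
        have e2 : s = η y + (s - η y) / inner ℝ d r * inner ℝ d r := by field_simp; ring
        generalize hl : (s - η y) / (inner ℝ d r : ℝ) = l at e1 e2
        calc _ = z + ((ξ y + l * inner ℝ d n) • n + (η y + l * inner ℝ d r) • r) := by
              rw [← e1, ← e2]
          _ = (z + (ξ y • n + η y • r)) +
              l • ((inner ℝ d n : ℝ) • n + (inner ℝ d r : ℝ) • r) := by module
          _ = _ := by rw [← hdec y, ← hddec]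
  choose! q hq1 hq2 a b hab hdr hdn hyab hseg using key
  have hzδ : z ∈ Metric.ball z δ := Metric.mem_ball_self hδ0
  refine ⟨δ, hδ0, n, fun y => (q y).1, ?_, (Metric.ball_subset_ball (by linarith)).trans hball, ?_,
    fun y hy => ⟨a y, b y, hab y hy, hyab y hy, ?_⟩⟩
  · have := hq2 z hzδ
    simpa [ξ, η] using this.symm
  · intro y hy y' hy'
    -- graphs that meet near `z` belong to the same rule segment
    have hstep : ∀ y ∈ Metric.ball z δ, ∀ s, |s| ≤ 2 * δ →
        ∀ y' ∈ Metric.ball z δ, (q y).1 + (q y).2 * s = (q y').1 + (q y').2 * s →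
        (q y).1 = (q y').1 := by
      intro y hy s hs y' hy' h
      have h1 := hseg y hy s hs
      have h2 := hseg y' hy' s hs
      rw [← h] at h2
      have h3 := rule_dir_eq_of_mem (hab y hy) (hab y' hy') h1 h2
      have h4 : (q y').2 = (q y).2 := by
        have h5 := hdn y hy
        have h6 := hdn y' hy'
        rcases h3 with h3 | h3
        · rw [h3, h5] at h6
          exact (mul_right_cancel₀ (hdr y hy) h6).symm
        · rw [h3, inner_neg_left, inner_neg_left, h5, mul_neg, neg_inj] at h6
          exact (mul_right_cancel₀ (hdr y hy) h6).symm
      rw [h4] at h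
      linarith
    set T := (q y').1 - (q y).1 with hT
    set M := (q y').2 - (q y).2 with hM
    have hyz : ‖y - z‖ < δ := mem_ball_iff_norm.1 hy
    have hbound : |T + M * η y| ≤ 3 / 2 * ‖y' - y‖ := by
      have h1 : T + M * η y = (ξ y' - ξ y) - (q y').2 * (η y' - η y) := by
        rw [hq2 y hy, hq2 y' hy', hT, hM]; ring
      have h2 : |ξ y' - ξ y| ≤ ‖y' - y‖ := by
        have h3 : ξ y' - ξ y = inner ℝ (y' - y) n := by
          simp only [ξ]; rw [← inner_sub_left]; congr 1; abel
        rw [h3]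
        have := abs_real_inner_le_norm (y' - y) n
        rwa [hn, norm_quarterTurn, hr, mul_one] at this
      have h4 : |η y' - η y| ≤ ‖y' - y‖ := by
        have h3 : η y' - η y = inner ℝ (y' - y) r := by
          simp only [η]; rw [← inner_sub_left]; congr 1; abel
        rw [h3]
        have := abs_real_inner_le_norm (y' - y) r
        rwa [hr, mul_one] at this
      have h5 : |(q y').2 * (η y' - η y)| ≤ 1 / 2 * ‖y' - y‖ := by
        rw [abs_mul]
        exact mul_le_mul (hq1 y' hy') h4 (abs_nonneg _) (by norm_num)
      rw [h1]
      exact (abs_sub _ _).trans (by linarith)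
    show |T| ≤ 3 * ‖y' - y‖
    by_cases hT0 : T = 0
    · rw [hT0, abs_zero]; positivity
    -- otherwise the two graphs would meet
    have hMT : |M| * (2 * δ) < |T| := by
      by_contra hcon
      push Not at hcon
      have hM0 : M ≠ 0 := by
        intro h0
        rw [h0, abs_zero, zero_mul] at hcon
        exact hT0 (abs_eq_zero.1 (le_antisymm hcon (abs_nonneg _)))
      have hs : |-T / M| ≤ 2 * δ := by
        rw [abs_div, abs_neg, div_le_iff₀ (abs_pos.2 hM0)]; linarith
      have h1 : M * (-T / M) = -T := by field_simp
      have h2 := hstep y hy _ hs y' hy' (by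
        have : ((q y').2 - (q y).2) * (-T / M) = (q y).1 - (q y').1 := by
          rw [← hM, h1, hT]; ring
        linarith)
      exact hT0 (by rw [hT, h2, sub_self])
    have h1 : |M * η y| ≤ |T| / 2 := by
      rw [abs_mul]
      have := mul_le_mul_of_nonneg_left ((hηle y).trans hyz.le) (abs_nonneg M)
      linarith
    have h2 : |T| ≤ |T + M * η y| + |M * η y| := by
      have := abs_sub (T + M * η y) (M * η y)
      rwa [add_sub_cancel_right] at this
    linarith
  · have := hseg y hy 0 (by rw [abs_zero]; positivity)
    simpa using this

end

/-! ### Developments near points off the creases -/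

section

namespace IsFramed

variable {f : Plane → Space} {R : Set Plane} {E : Plane → Op} {E' : Plane → Plane →L[ℝ] Op}
  {c c' : ℝ → Plane} {J : Set ℝ}

lemma hasDerivAt_of_mapsTo {W : Type*} [NormedAddCommGroup W] [NormedSpace ℝ W] {g : Plane → W}
    {g' : Plane →L[ℝ] W} {v : Plane} {t : ℝ} (hg : HasFDerivWithinAt g g' R (c t))
    (hc : HasDerivAt c v t) (hJ : J ∈ 𝓝 t) (hcR : MapsTo c J R) :
    HasDerivAt (fun t => g (c t)) (g' v) t :=
  (hg.comp_hasDerivWithinAt t hc.hasDerivWithinAt hcR).hasDerivAt hJ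

variable (h : IsFramed f R E E') (hJ : IsOpen J) (hc : ∀ t ∈ J, HasDerivAt c (c' t) t)
  (hcR : MapsTo c J R)

include h hc hcR

lemma continuousOn_deriv (hc' : ContinuousOn c' J) :
    ContinuousOn (fun t => E' (c t) (c' t)) J := by
  have hcc : ContinuousOn c J := fun t ht => (hc t ht).continuousAt.continuousWithinAt
  exact (h.continuousOn.comp hcc hcR).clm_apply hc'

lemma continuousOn_deriv_trans (hc' : ContinuousOn c' J) :
    ContinuousOn (fun t => -(E' (c t) (c' t)) (emb (c t))) J := by
  have hcc : ContinuousOn c J := fun t ht => (hc t ht).continuousAt.continuousWithinAt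
  exact ((Op.act.continuous.comp_continuousOn
    (h.continuousOn_deriv hc hcR hc')).clm_apply (emb.continuous.comp_continuousOn hcc)).neg

include hJ

lemma hasDerivAt_frame {t : ℝ} (ht : t ∈ J) :
    HasDerivAt (fun t => E (c t)) (E' (c t) (c' t)) t :=
  hasDerivAt_of_mapsTo (h.deriv_frame _ (hcR ht)) (hc t ht) (hJ.mem_nhds ht) hcR

lemma hasDerivAt_surface {t : ℝ} (ht : t ∈ J) :
    HasDerivAt (fun t => f (c t)) (E (c t) (emb (c' t))) t :=
  hasDerivAt_of_mapsTo (h.deriv_surface _ (hcR ht)) (hc t ht) (hJ.mem_nhds ht) hcR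

lemma hasDerivAt_trans {t : ℝ} (ht : t ∈ J) :
    HasDerivAt (fun t => f (c t) - E (c t) (emb (c t))) (-(E' (c t) (c' t)) (emb (c t))) t :=
  (hasDerivAt_of_mapsTo (h.deriv_trans (hcR ht)) (hc t ht) (hJ.mem_nhds ht) hcR).congr_deriv
    (by simp)

end IsFramed

variable {ι : Type*} {P : CreaseRulePattern ι} {f : Plane → Space}

lemma continuousOn_unitInterval {X Y : Type*} [TopologicalSpace X] [TopologicalSpace Y]
    {g : ℝ → X → Y} {J : Set X} (h : ContinuousOn (fun q : ℝ × X => g q.1 q.2) (Icc 0 1 ×ˢ J))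
    {Z : Type*} [TopologicalSpace Z] {S : Set Z} {t : Z → X} (ht : ContinuousOn t S)
    (hS : MapsTo t S J) :
    ContinuousOn (fun q : unitInterval × Z => g q.1 (t q.2)) (univ ×ˢ S) := by
  have h1 : ContinuousOn (fun q : unitInterval × Z => ((q.1 : ℝ), t q.2)) (univ ×ˢ S) :=
    (continuous_subtype_val.comp continuous_fst).continuousOn.prodMk
      (ht.comp continuousOn_snd fun q hq => hq.2)
  exact h.comp h1 fun q hq => ⟨q.1.2, hS hq.2⟩

/-- Near a point free of creases, the surface can be bent. -/
lemma CreaseRulePattern.IsFolding.exists_development_uncreased [Finite ι] (hf : P.IsFolding f)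
    (m : ι → ℝ) {z : Plane} (hz : z ∈ P.uncreased) :
    ∃ U, IsOpen U ∧ z ∈ U ∧ U ⊆ P.paper ∧ ∃ E F, IsDevelopment P f m U E F := by
  obtain ⟨δ, hδ, n, t, htz, hball, hlip, hrule⟩ := exists_transversal P hz
  let c : ℝ → Plane := fun s => z + s • n
  have hc : ∀ s, HasDerivAt c n s := fun s => by
    show HasDerivAt (fun s : ℝ => z + s • n) n s
    simpa using ((hasDerivAt_id s).smul_const n).const_add z
  have hcc : Continuous c := by fun_prop
  obtain ⟨a, ha, hca⟩ : ∃ a > 0, MapsTo c (Ioo (0 - a) (0 + a)) P.uncreased := by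
    have h1 : c ⁻¹' P.uncreased ∈ 𝓝 (0 : ℝ) :=
      hcc.continuousAt.preimage_mem_nhds ((isOpen_uncreased P).mem_nhds (by simpa [c] using hz))
    obtain ⟨a, ha, h⟩ := Metric.mem_nhds_iff.1 h1
    rw [Real.ball_eq_Ioo] at h
    exact ⟨a, ha, h⟩
  set e : ℝ → Op := fun s => frame f (c s) with he
  set e' : ℝ → Op := fun s => fderiv ℝ (frame f) (c s) n with he'
  set p : ℝ → Space := fun s => f (c s) - frame f (c s) (emb (c s)) with hp
  set p' : ℝ → Space := fun s => -(fderiv ℝ (frame f) (c s) n) (emb (c s)) with hp'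
  have hde : ∀ s ∈ Ioo (0 - a) (0 + a), HasDerivAt e (e' s) s := fun s hs =>
    hf.isFramed.hasDerivAt_frame isOpen_Ioo (fun s _ => hc s) hca hs
  have hdp : ∀ s ∈ Ioo (0 - a) (0 + a), HasDerivAt p (p' s) s := fun s hs =>
    hf.isFramed.hasDerivAt_trans isOpen_Ioo (fun s _ => hc s) hca hs
  obtain ⟨δ₁, hδ₁, eu, pu, hB⟩ := exists_isBending ha hde hdp
    (hf.isFramed.continuousOn_deriv (fun s _ => hc s) hca continuousOn_const)
    (hf.isFramed.continuousOn_deriv_trans (fun s _ => hc s) hca continuousOn_const)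
    (fun s hs => hf.isRot_frame (hca hs))
  set J := Ioo (0 - δ₁) (0 + δ₁) with hJ
  have hJa : J ⊆ Ioo (0 - a) (0 + a) := fun s hs =>
    ⟨by linarith [hs.1, hδ₁.2], by linarith [hs.2, hδ₁.2]⟩
  set U := Metric.ball z (min δ (δ₁ / 3)) with hU
  have hUδ : U ⊆ Metric.ball z δ := Metric.ball_subset_ball (min_le_left _ _)
  have hUu : U ⊆ P.uncreased := hUδ.trans hball
  have htJ : MapsTo t U J := by
    intro y hy
    have h1 := hlip z (Metric.mem_ball_self hδ) y (hUδ hy)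
    have h2 : ‖y - z‖ < δ₁ / 3 := (mem_ball_iff_norm.1 hy).trans_le (min_le_right _ _)
    rw [htz, sub_zero] at h1
    have h3 := abs_lt.1 (h1.trans_lt (by linarith : 3 * ‖y - z‖ < δ₁))
    exact ⟨by linarith [h3.1], by linarith [h3.2]⟩
  have hO : ∀ y ∈ U, (fun y' => t y' - t y) =O[𝓝[U] y] (fun y' => y' - y) := by
    intro y hy
    refine Asymptotics.IsBigO.of_bound 3 ?_
    filter_upwards [self_mem_nhdsWithin] with y' hy'
    exact hlip y (hUδ hy) y' (hUδ hy')
  have htc : ContinuousOn t U := by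
    refine (LipschitzOnWith.of_dist_le_mul (K := 3) fun y hy y' hy' => ?_).continuousOn
    rw [dist_eq_norm, dist_eq_norm]
    exact hlip y' (hUδ hy') y (hUδ hy)
  have hframe : ∀ y ∈ U, frame f y = e (t y) ∧ f y - frame f y (emb y) = p (t y) := by
    intro y hy
    obtain ⟨a, b, hab, h1, h2⟩ := hrule y (hUδ hy)
    exact hf.frame_eq_of_rule hab h1 h2
  have hz' : z ∈ U := Metric.mem_ball_self (lt_min hδ (by linarith [hδ₁.1]))
  have hFr : ∀ u : unitInterval, _ := fun u => hB.isFramed (hf.isFramed.mono hUu) htJ hO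
    (fun s hs => hde s (hJa hs)) (fun s hs => hdp s (hJa hs)) (fun y hy => (hframe y hy).1)
    (fun y hy => (hframe y hy).2) u.2
  refine ⟨U, Metric.isOpen_ball, hz', fun y hy => (hUu hy).1, fun u y => eu u (t y),
    fun u y => pu u (t y) + eu u (t y) (emb y), ?_⟩
  refine ⟨fun u y hy => (hFr u).isRot y hy.1, fun y hy => ?_, ?_, fun u y hy => ?_,
    fun u y hy => ?_, fun u x hx => (hFr u).contDiffOn.mono inter_subset_left,
    fun u i s hs hsU => ?_,
    fun y hy => ?_, ?_⟩
  · have := continuousOn_unitInterval (Z := unitInterval) (S := univ) hB.continuousOn_rot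
      (t := fun _ => t y) continuousOn_const (fun _ _ => htJ hy.1)
    exact this.comp_continuous (f := fun u : unitInterval => (u, u)) (by fun_prop) (by simp)
  · refine (continuousOn_unitInterval hB.continuousOn_trans htc htJ).add ?_
    exact (Op.act.continuous.comp_continuousOn
      (continuousOn_unitInterval hB.continuousOn_rot htc htJ)).clm_apply
      (emb.continuous.comp continuous_snd).continuousOn
  · exact ((hFr u).deriv_frame y hy.1).hasFDerivAt (Metric.isOpen_ball.mem_nhds hy.1)
  · exact ((hFr u).deriv_surface y hy.1).hasFDerivAt (Metric.isOpen_ball.mem_nhds hy.1)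
  · exact absurd (mem_iUnion.2 ⟨i, mem_image_of_mem _ (Ioo_subset_Icc_self hs)⟩) (hUu hsU).2
  · have h1 := hB.one _ (htJ hy)
    simp only [Icc.coe_one]
    rw [h1.1, h1.2, ← (hframe y hy).1, ← (hframe y hy).2]
    abel
  · refine ⟨flatPlacement (hf.isRot_frame (hca (hJa (htJ hz')))) (p 0), fun y hy => ?_⟩
    have h0 := hB.zero _ (htJ hy)
    simp only [Icc.coe_zero]
    rw [h0.1, h0.2, flatPlacement_apply, htz]

end

/-! ### Creases and their Fermi coordinates -/

section

namespace CreaseRulePattern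

variable {ι : Type*} {P : CreaseRulePattern ι} {i : ι} {s : ℝ}

lemma contDiffAt_crease (hs : s ∈ Ioo 0 (P.len i)) : ContDiffAt ℝ 2 (P.crease i) s :=
  (P.crease_contDiff i).contDiffAt (isOpen_Ioo.mem_nhds hs)

lemma norm_tangent (hs : s ∈ Ioo 0 (P.len i)) : ‖P.tangent i s‖ = 1 := P.crease_unit_speed i s hs

lemma norm_leftNormal (hs : s ∈ Ioo 0 (P.len i)) : ‖P.leftNormal i s‖ = 1 := by
  rw [leftNormal, norm_quarterTurn, norm_tangent hs]

lemma hasStrictDerivAt_crease (hs : s ∈ Ioo 0 (P.len i)) :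
    HasStrictDerivAt (P.crease i) (P.tangent i s) s :=
  (contDiffAt_crease hs).hasStrictDerivAt (by norm_num)

lemma contDiffAt_tangent (hs : s ∈ Ioo 0 (P.len i)) : ContDiffAt ℝ 1 (P.tangent i) s := by
  have h := ((contDiffAt_crease hs).fderiv_right (m := 1) (by norm_num)).clm_apply
    (contDiffAt_const (c := (1 : ℝ)))
  exact h

/-- The Frenet equation of an unfolded crease. -/
lemma hasStrictDerivAt_tangent (hs : s ∈ Ioo 0 (P.len i)) :
    HasStrictDerivAt (P.tangent i) (P.curvature i s • P.leftNormal i s) s := by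
  have h := (contDiffAt_tangent hs).hasStrictDerivAt (by norm_num)
  have h1 : (fun r => ‖P.tangent i r‖ ^ 2) =ᶠ[𝓝 s] fun _ => (1 : ℝ) := by
    filter_upwards [isOpen_Ioo.mem_nhds hs] with r hr
    rw [norm_tangent hr, one_pow]
  have h2 := h.hasDerivAt.norm_sq.unique ((hasDerivAt_const s (1 : ℝ)).congr_of_eventuallyEq h1)
  have h3 : (inner ℝ (deriv (P.tangent i) s) (P.tangent i s) : ℝ) = 0 := by
    rw [real_inner_comm]; linarith
  have h4 := eq_combo_of_norm_one (norm_tangent hs) (deriv (P.tangent i) s)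
  rw [h3, zero_smul, add_zero] at h4
  rw [h4] at h
  exact h

lemma hasStrictDerivAt_leftNormal (hs : s ∈ Ioo 0 (P.len i)) :
    HasStrictDerivAt (P.leftNormal i) (-P.curvature i s • P.tangent i s) s := by
  have h := qt.hasStrictFDerivAt.comp_hasStrictDerivAt s (hasStrictDerivAt_tangent hs)
  have h1 : qt (P.curvature i s • P.leftNormal i s) = -P.curvature i s • P.tangent i s := by
    rw [map_smul, qt_apply, leftNormal]
    apply plane_ext <;> simp
  rw [h1] at h
  exact h

lemma inner_leftNormal_tangent : (inner ℝ (P.leftNormal i s) (P.tangent i s) : ℝ) = 0 :=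
  inner_quarterTurn_self _

/-- The point at signed distance `ε` to the left of a crease point. -/
def fermi (P : CreaseRulePattern ι) (i : ι) (q : ℝ × ℝ) : Plane :=
  P.crease i q.1 + q.2 • P.leftNormal i q.1

@[simp] lemma fermi_zero : P.fermi i (s, 0) = P.crease i s := by simp [fermi]

lemma continuousOn_fermi : ContinuousOn (P.fermi i) (Ioo 0 (P.len i) ×ˢ univ) := by
  intro q hq
  have h1 : ContinuousAt (P.crease i) q.1 := (hasStrictDerivAt_crease hq.1).hasDerivAt.continuousAt
  have h2 : ContinuousAt (P.leftNormal i) q.1 :=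
    (hasStrictDerivAt_leftNormal hq.1).hasDerivAt.continuousAt
  exact ((h1.comp continuousAt_fst).add
    (continuousAt_snd.smul (h2.comp continuousAt_fst))).continuousWithinAt

/-- The Darboux coordinates of the plane at a crease point. -/
def darbouxEquiv (hs : s ∈ Ioo 0 (P.len i)) : (ℝ × ℝ) ≃L[ℝ] Plane :=
  LinearEquiv.toContinuousLinearEquiv
  { toFun := fun q => q.1 • P.tangent i s + q.2 • P.leftNormal i s
    map_add' := fun q q' => by simp only [Prod.fst_add, Prod.snd_add]; module
    map_smul' := fun c q => by simp [smul_smul]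
    invFun := fun v => (inner ℝ v (P.tangent i s), inner ℝ v (P.leftNormal i s))
    left_inv := fun q => by
      have h1 := inner_self_of_norm_one (norm_tangent hs)
      have h2 := inner_self_of_norm_one (norm_leftNormal hs)
      have h3 := inner_leftNormal_tangent (P := P) (i := i) (s := s)
      have h4 := real_inner_comm (P.tangent i s) (P.leftNormal i s)
      simp only [inner_add_left, inner_smul_left, h1, h2, h3, ← h4]
      simp
    right_inv := fun v => by
      show (inner ℝ v (P.tangent i s) : ℝ) • P.tangent i s +
        (inner ℝ v (P.leftNormal i s) : ℝ) • P.leftNormal i s = v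
      rw [add_comm]; exact (eq_combo_of_norm_one (norm_tangent hs) v).symm }

lemma darbouxEquiv_apply (hs : s ∈ Ioo 0 (P.len i)) (q : ℝ × ℝ) :
    darbouxEquiv hs q = q.1 • P.tangent i s + q.2 • P.leftNormal i s := rfl

lemma darbouxEquiv_symm_apply (hs : s ∈ Ioo 0 (P.len i)) (v : Plane) :
    (darbouxEquiv hs).symm v = (inner ℝ v (P.tangent i s), inner ℝ v (P.leftNormal i s)) := rfl

lemma hasStrictFDerivAt_fermi (hs : s ∈ Ioo 0 (P.len i)) :
    HasStrictFDerivAt (P.fermi i) (darbouxEquiv hs : (ℝ × ℝ) →L[ℝ] Plane) (s, 0) := by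
  have h1 := (hasStrictDerivAt_crease hs).hasStrictFDerivAt.comp (s, (0 : ℝ))
    (hasStrictFDerivAt_fst (𝕜 := ℝ) (E := ℝ) (F := ℝ) (p := (s, (0 : ℝ))))
  have h2 := (hasStrictDerivAt_leftNormal hs).hasStrictFDerivAt.comp (s, (0 : ℝ))
    (hasStrictFDerivAt_fst (𝕜 := ℝ) (E := ℝ) (F := ℝ) (p := (s, (0 : ℝ))))
  have h3 := h1.add ((hasStrictFDerivAt_snd (𝕜 := ℝ) (E := ℝ) (F := ℝ)
    (p := (s, (0 : ℝ)))).smul h2)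
  refine h3.congr_fderiv (ContinuousLinearMap.ext fun q => ?_)
  simp [darbouxEquiv_apply]

end CreaseRulePattern

open CreaseRulePattern

variable {ι : Type*} {P : CreaseRulePattern ι} {i : ι} {s₀ : ℝ}

/-- Fermi coordinates `S`, `η` on a neighbourhood `U` of the point with parameter `s₀` of crease
`i`: `S` is the parameter of the nearby crease point next to which a point lies, and `η` its signed
distance from there. The crease is the zero set of `η`, and no other crease meets `U`. -/
structure IsFermiBox (P : CreaseRulePattern ι) (i : ι) (s₀ a : ℝ) (U : Set Plane)
    (S η : Plane → ℝ) : Prop where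
  pos : 0 < a
  isOpen : IsOpen U
  subset_paper : U ⊆ P.paper
  mem_Ioo : ∀ s ∈ Ioo (s₀ - a) (s₀ + a), s ∈ Ioo 0 (P.len i)
  mapsTo : ∀ y ∈ U, S y ∈ Ioo (s₀ - a) (s₀ + a) ∧ η y ∈ Ioo (-a) a
  fermi_eq : ∀ y ∈ U, P.fermi i (S y, η y) = y
  fermi_mem : ∀ s ∈ Ioo (s₀ - a) (s₀ + a), ∀ ε ∈ Ioo (-a) a,
    P.fermi i (s, ε) ∈ U ∧ S (P.fermi i (s, ε)) = s ∧ η (P.fermi i (s, ε)) = ε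
  continuousOn_param : ContinuousOn S U
  continuousOn_dist : ContinuousOn η U
  mem_uncreased : ∀ y ∈ U, η y ≠ 0 → y ∈ P.uncreased
  deriv_dist : ∀ s ∈ Ioo (s₀ - a) (s₀ + a),
    HasStrictFDerivAt η (innerSL ℝ (P.leftNormal i s)) (P.crease i s)

namespace IsFermiBox

variable {a : ℝ} {U : Set Plane} {S η : Plane → ℝ}

lemma shrink (h : IsFermiBox P i s₀ a U S η) {W : Set Plane} (hW : W ∈ 𝓝 (P.crease i s₀)) :
    ∃ a' U', U' ⊆ W ∧ U' ⊆ U ∧ IsFermiBox P i s₀ a' U' S η := by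
  have hs₀ : s₀ ∈ Ioo (s₀ - a) (s₀ + a) := ⟨by linarith [h.pos], by linarith [h.pos]⟩
  have hc : ContinuousAt (P.fermi i) (s₀, 0) :=
    (hasStrictFDerivAt_fermi (h.mem_Ioo _ hs₀)).hasFDerivAt.continuousAt
  have h1 : P.fermi i ⁻¹' W ∈ 𝓝 (s₀, (0 : ℝ)) := hc.preimage_mem_nhds (by simpa using hW)
  obtain ⟨b, hb, hbW⟩ := Metric.mem_nhds_iff.1 h1
  have hbW' : ∀ s ∈ Ioo (s₀ - b) (s₀ + b), ∀ ε ∈ Ioo (-b) b, P.fermi i (s, ε) ∈ W := by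
    intro s hs ε hε
    apply hbW
    rw [Metric.mem_ball, Prod.dist_eq, max_lt_iff, Real.dist_eq, Real.dist_eq, abs_lt, abs_lt]
    exact ⟨⟨by linarith [hs.1], by linarith [hs.2]⟩, by linarith [hε.1], by linarith [hε.2]⟩
  set a' := min a b with ha'
  have ha'a : a' ≤ a := min_le_left _ _
  have ha'b : a' ≤ b := min_le_right _ _
  have hS : Ioo (s₀ - a') (s₀ + a') ⊆ Ioo (s₀ - a) (s₀ + a) :=
    Ioo_subset_Ioo (by linarith) (by linarith)
  have hE : Ioo (-a') a' ⊆ Ioo (-a) a := Ioo_subset_Ioo (by linarith) (by linarith)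
  set U' := U ∩ S ⁻¹' Ioo (s₀ - a') (s₀ + a') ∩ η ⁻¹' Ioo (-a') a' with hU'
  have hUU : U' ⊆ U := fun y hy => hy.1.1
  have hopen : IsOpen U' := by
    have h2 : IsOpen (U ∩ S ⁻¹' Ioo (s₀ - a') (s₀ + a')) :=
      h.continuousOn_param.isOpen_inter_preimage h.isOpen isOpen_Ioo
    exact (h.continuousOn_dist.mono inter_subset_left).isOpen_inter_preimage h2 isOpen_Ioo
  refine ⟨a', U', fun y hy => ?_, hUU, lt_min h.pos hb, hopen, hUU.trans h.subset_paper,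
    fun s hs => h.mem_Ioo s (hS hs), fun y hy => ⟨hy.1.2, hy.2⟩, fun y hy => h.fermi_eq y (hUU hy),
    fun s hs ε hε => ?_, h.continuousOn_param.mono hUU, h.continuousOn_dist.mono hUU,
    fun y hy => h.mem_uncreased y (hUU hy), fun s hs => h.deriv_dist s (hS hs)⟩
  · rw [← h.fermi_eq y (hUU hy)]
    exact hbW' _ (Ioo_subset_Ioo (by linarith) (by linarith) hy.1.2) _
      (Ioo_subset_Ioo (by linarith) (by linarith) hy.2)
  · obtain ⟨h2, h3, h4⟩ := h.fermi_mem s (hS hs) ε (hE hε)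
    refine ⟨⟨⟨h2, ?_⟩, ?_⟩, h3, h4⟩
    · rw [mem_preimage, h3]; exact hs
    · rw [mem_preimage, h4]; exact hε

end IsFermiBox

/-- Fermi coordinates exist by the inverse function theorem; since creases are embedded and finite
in number, a small box meets no other part of a crease. -/
lemma exists_isFermiBox [Finite ι] (P : CreaseRulePattern ι) (hs₀ : s₀ ∈ Ioo 0 (P.len i)) :
    ∃ a U S η, IsFermiBox P i s₀ a U S η := by
  have hst := hasStrictFDerivAt_fermi hs₀
  set Φ := hst.toOpenPartialHomeomorph (P.fermi i) with hΦ
  have hΦc : ∀ q, Φ q = P.fermi i q := fun q => rfl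
  have hsrc : (s₀, (0 : ℝ)) ∈ Φ.source := hst.mem_toOpenPartialHomeomorph_source
  have hbox : ∀ W ∈ 𝓝 (s₀, (0 : ℝ)), ∃ b > 0, ∀ s ∈ Ioo (s₀ - b) (s₀ + b), ∀ ε ∈ Ioo (-b) b,
      (s, ε) ∈ W := by
    intro W hW
    obtain ⟨b, hb, hbW⟩ := Metric.mem_nhds_iff.1 hW
    refine ⟨b, hb, fun s hs ε hε => hbW ?_⟩
    rw [Metric.mem_ball, Prod.dist_eq, max_lt_iff, Real.dist_eq, Real.dist_eq, abs_lt, abs_lt]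
    exact ⟨⟨by linarith [hs.1], by linarith [hs.2]⟩, by linarith [hε.1], by linarith [hε.2]⟩
  obtain ⟨b, hb, hbsrc⟩ := hbox _ (Φ.open_source.mem_nhds hsrc)
  -- the remaining creases, and the remaining parts of this crease, stay away
  set C : Set Plane := (⋃ j, ⋃ _ : j ≠ i, P.crease j '' Icc 0 (P.len j)) ∪
    P.crease i '' (Icc 0 (P.len i) \ Ioo (s₀ - b) (s₀ + b)) with hC
  have hCc : IsClosed C := by
    refine IsClosed.union ?_ ?_
    · refine isClosed_iUnion_of_finite fun j => isClosed_iUnion_of_finite fun _ => ?_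
      exact (isCompact_Icc.image_of_continuousOn (P.crease_continuous j)).isClosed
    · exact ((isCompact_Icc.diff isOpen_Ioo).image_of_continuousOn
        ((P.crease_continuous i).mono sdiff_subset)).isClosed
  have hzC : P.crease i s₀ ∉ C := by
    rintro (hz | ⟨t, ht, hz⟩)
    · simp only [mem_iUnion] at hz
      obtain ⟨j, hj, t, ht, hz⟩ := hz
      exact hj (P.crease_embedded i j s₀ hs₀ t ht hz.symm).1.symm
    · have := (P.crease_embedded i i s₀ hs₀ t ht.1 hz.symm).2
      exact ht.2 (this ▸ ⟨by linarith, by linarith⟩)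
  have hW : Φ.source ∩ (P.fermi i ⁻¹' (P.paper ∩ Cᶜ) ∩ (Ioo 0 (P.len i) ×ˢ univ)) ∈
      𝓝 (s₀, (0 : ℝ)) := by
    refine inter_mem (Φ.open_source.mem_nhds hsrc) (inter_mem ?_ ?_)
    · refine hst.hasFDerivAt.continuousAt.preimage_mem_nhds ?_
      rw [fermi_zero]
      exact (P.paper_open.inter hCc.isOpen_compl).mem_nhds ⟨P.crease_mem i s₀ hs₀, hzC⟩
    · exact (isOpen_Ioo.prod isOpen_univ).mem_nhds ⟨hs₀, mem_univ _⟩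
  obtain ⟨a₁, ha₁, ha₁W⟩ := hbox _ hW
  set a := min a₁ b with ha
  have ha0 : 0 < a := lt_min ha₁ hb
  have haa₁ : a ≤ a₁ := min_le_left _ _
  have hab : a ≤ b := min_le_right _ _
  have hbx : ∀ s ∈ Ioo (s₀ - a) (s₀ + a), ∀ ε ∈ Ioo (-a) a, (s, ε) ∈ Φ.source ∩
      (P.fermi i ⁻¹' (P.paper ∩ Cᶜ) ∩ (Ioo 0 (P.len i) ×ˢ univ)) := fun s hs ε hε =>
    ha₁W s (Ioo_subset_Ioo (by linarith) (by linarith) hs) ε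
      (Ioo_subset_Ioo (by linarith) (by linarith) hε)
  set B := Ioo (s₀ - a) (s₀ + a) ×ˢ Ioo (-a) a with hB
  have hBs : B ⊆ Φ.source := fun q hq => (hbx q.1 hq.1 q.2 hq.2).1
  set U := Φ '' B with hU
  have hUt : U ⊆ Φ.target := by
    rintro _ ⟨q, hq, rfl⟩; exact Φ.map_source (hBs hq)
  have hinv : ContinuousOn Φ.symm U := Φ.continuousOn_symm.mono hUt
  have hback : ∀ q ∈ B, Φ.symm (P.fermi i q) = q := fun q hq => Φ.left_inv (hBs hq)
  refine ⟨a, U, fun y => (Φ.symm y).1, fun y => (Φ.symm y).2, ha0,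
    Φ.isOpen_image_of_subset_source (isOpen_Ioo.prod isOpen_Ioo) hBs, ?_, fun s hs => ?_, ?_, ?_,
    ?_, continuous_fst.comp_continuousOn hinv, continuous_snd.comp_continuousOn hinv, ?_, ?_⟩
  · rintro _ ⟨q, hq, rfl⟩
    exact (hbx q.1 hq.1 q.2 hq.2).2.1.1
  · exact (hbx s hs 0 ⟨by linarith, by linarith⟩).2.2.1
  · rintro _ ⟨q, hq, rfl⟩
    rw [hΦc, hback q hq]
    exact hq
  · rintro _ ⟨q, hq, rfl⟩
    simp only [hΦc, hback q hq]
  · intro s hs ε hε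
    have hq : (s, ε) ∈ B := ⟨hs, hε⟩
    refine ⟨⟨_, hq, rfl⟩, ?_, ?_⟩ <;> rw [hback _ hq]
  · rintro _ ⟨q, hq, rfl⟩ hne
    have h1 := hbx q.1 hq.1 q.2 hq.2
    refine ⟨h1.2.1.1, fun hcr => ?_⟩
    simp only [mem_iUnion] at hcr
    obtain ⟨j, t, ht, hjt⟩ := hcr
    have h2 : Φ q ∉ C := h1.2.1.2
    rw [hΦc] at hjt h2
    by_cases hji : j = i
    · subst hji
      by_cases htb : t ∈ Ioo (s₀ - b) (s₀ + b)
      · have h3 : (t, (0 : ℝ)) = q := by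
          refine Φ.injOn (hbsrc t htb 0 ⟨by linarith, by linarith⟩) (hBs hq) ?_
          rw [hΦc, hΦc, fermi_zero, hjt]
        apply hne
        rw [hΦc, hback q hq, ← h3]
      · exact h2 (Or.inr ⟨t, ⟨ht, htb⟩, hjt⟩)
    · exact h2 (Or.inl (mem_iUnion₂.2 ⟨j, hji, t, ht, hjt⟩))
  · intro s hs
    have hs0 := hbx s hs 0 ⟨by linarith, by linarith⟩
    have h0 : Φ.symm (P.crease i s) = (s, 0) := by
      rw [← fermi_zero]; exact Φ.left_inv hs0.1
    have h1 : HasStrictFDerivAt Φ.symm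
        ((darbouxEquiv hs0.2.2.1).symm : Plane →L[ℝ] (ℝ × ℝ)) (P.crease i s) := by
      refine Φ.hasStrictFDerivAt_symm ?_ ?_
      · rw [← fermi_zero]; exact Φ.map_source hs0.1
      · rw [h0]; exact hasStrictFDerivAt_fermi hs0.2.2.1
    have h2 := (hasStrictFDerivAt_snd (𝕜 := ℝ) (E := ℝ) (F := ℝ)).comp _ h1
    refine h2.congr_fderiv ?_
    ext1 v
    simp [darbouxEquiv_symm_apply, real_inner_comm]

end

/-! ### The two sides of a crease -/

section

open CreaseRulePattern

variable {ι : Type*} {P : CreaseRulePattern ι} {f : Plane → Space} {i : ι} {s₀ : ℝ}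

/-- The part of `U` strictly on the left (`σ = 1`) or on the right (`σ = -1`) of the crease. -/
def openSide (U : Set Plane) (η : Plane → ℝ) (σ : ℝ) : Set Plane := {y ∈ U | 0 < σ * η y}

/-- The part of `U` on one side of the crease, with the crease. -/
def closedSide (U : Set Plane) (η : Plane → ℝ) (σ : ℝ) : Set Plane := {y ∈ U | 0 ≤ σ * η y}

lemma openSide_subset_closedSide {U : Set Plane} {η : Plane → ℝ} {σ : ℝ} :
    openSide U η σ ⊆ closedSide U η σ := fun _ hy => ⟨hy.1, hy.2.le⟩

namespace IsFermiBox

variable {a : ℝ} {U : Set Plane} {S η : Plane → ℝ} {σ : ℝ}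

section
variable (h : IsFermiBox P i s₀ a U S η)
include h

lemma self_mem : s₀ ∈ Ioo (s₀ - a) (s₀ + a) := ⟨by linarith [h.pos], by linarith [h.pos]⟩

lemma base_mem : s₀ ∈ Ioo 0 (P.len i) := h.mem_Ioo _ h.self_mem

lemma crease_mem {s : ℝ} (hs : s ∈ Ioo (s₀ - a) (s₀ + a)) :
    P.crease i s ∈ U ∧ S (P.crease i s) = s ∧ η (P.crease i s) = 0 := by
  have := h.fermi_mem s hs 0 ⟨by linarith [h.pos], h.pos⟩
  rwa [fermi_zero] at this

lemma eq_crease {y : Plane} (hy : y ∈ U) (hη : η y = 0) : y = P.crease i (S y) := by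
  have := h.fermi_eq y hy
  rwa [hη, fermi_zero, eq_comm] at this

lemma isOpen_openSide : IsOpen (openSide U η σ) := by
  have : openSide U η σ = U ∩ (fun y => σ * η y) ⁻¹' Ioi 0 := rfl
  rw [this]
  exact (continuousOn_const.mul h.continuousOn_dist).isOpen_inter_preimage h.isOpen isOpen_Ioi

lemma openSide_subset : openSide U η σ ⊆ P.uncreased := fun y hy =>
  h.mem_uncreased y hy.1 fun h0 => by
    have := hy.2; rw [h0, mul_zero] at this; exact this.false

lemma isPreconnected_openSide : IsPreconnected (openSide U η σ) := by
  have h1 : openSide U η σ = P.fermi i '' (Ioo (s₀ - a) (s₀ + a) ×ˢ (Ioo (-a) a ∩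
      {ε | 0 < σ * ε})) := by
    ext y
    constructor
    · intro hy
      exact ⟨(S y, η y), ⟨(h.mapsTo y hy.1).1, (h.mapsTo y hy.1).2, hy.2⟩, h.fermi_eq y hy.1⟩
    · rintro ⟨⟨s, ε⟩, ⟨hs, hε, hσ⟩, rfl⟩
      have := h.fermi_mem s hs ε hε
      refine ⟨this.1, ?_⟩
      rw [this.2.2]; exact hσ
  rw [h1]
  refine IsPreconnected.image ?_ _
    (continuousOn_fermi.mono fun q hq => ⟨h.mem_Ioo _ hq.1, mem_univ _⟩)
  refine ((convex_Ioo _ _).prod ((convex_Ioo _ _).inter ?_)).isPreconnected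
  exact (convex_Ioi (0 : ℝ)).is_linear_preimage (IsLinearMap.isLinearMap_smul σ)

/-- Points beside a crease point lie on the corresponding side. -/
lemma fermi_mem_openSide {s : ℝ} (hs : s ∈ Ioo (s₀ - a) (s₀ + a)) (hσ : σ ^ 2 = 1) :
    ∀ᶠ ε in 𝓝[>] (0 : ℝ), P.fermi i (s, σ * ε) ∈ openSide U η σ := by
  filter_upwards [Ioo_mem_nhdsGT h.pos] with ε hε
  have hσε : σ * ε ∈ Ioo (-a) a := by
    rcases sq_eq_one_iff.1 hσ with rfl | rfl
    · exact ⟨by linarith [hε.1, hε.2], by linarith [hε.2]⟩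
    · exact ⟨by linarith [hε.1, hε.2], by linarith [hε.1, hε.2]⟩
  have := h.fermi_mem s hs _ hσε
  refine ⟨this.1, ?_⟩
  rw [this.2.2, ← mul_assoc, ← sq, hσ, one_mul]
  exact hε.1

lemma tendsto_fermi {s : ℝ} (hs : s ∈ Ioo (s₀ - a) (s₀ + a)) (hσ : σ ^ 2 = 1) :
    Tendsto (fun ε : ℝ => P.fermi i (s, σ * ε)) (𝓝[>] 0) (𝓝[openSide U η σ] (P.crease i s)) := by
  refine tendsto_nhdsWithin_iff.2 ⟨?_, h.fermi_mem_openSide hs hσ⟩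
  have h1 : Continuous fun ε : ℝ => P.fermi i (s, σ * ε) := by
    show Continuous fun ε : ℝ => P.crease i s + (σ * ε) • P.leftNormal i s
    fun_prop
  have h2 := h1.tendsto 0
  simp only [mul_zero, fermi_zero] at h2
  exact h2.mono_left nhdsWithin_le_nhds

lemma crease_mem_closure {s : ℝ} (hs : s ∈ Ioo (s₀ - a) (s₀ + a)) (hσ : σ ^ 2 = 1) :
    P.crease i s ∈ closure (openSide U η σ) :=
  mem_closure_iff_nhdsWithin_neBot.2 ((h.tendsto_fermi hs hσ).neBot)

lemma closedSide_subset_closure (hσ : σ ^ 2 = 1) : closedSide U η σ ⊆ closure (openSide U η σ) := by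
  intro y hy
  rcases hy.2.lt_or_eq with h1 | h1
  · exact subset_closure ⟨hy.1, h1⟩
  · have h2 : η y = 0 := by
      rcases mul_eq_zero.1 h1.symm with h3 | h3
      · rw [h3] at hσ; norm_num at hσ
      · exact h3
    rw [h.eq_crease hy.1 h2]
    exact h.crease_mem_closure (h.mapsTo y hy.1).1 hσ

lemma crease_mem_closedSide {s : ℝ} (hs : s ∈ Ioo (s₀ - a) (s₀ + a)) :
    P.crease i s ∈ closedSide U η σ := by
  obtain ⟨h1, -, h2⟩ := h.crease_mem hs
  exact ⟨h1, by rw [h2, mul_zero]⟩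

end
end IsFermiBox

/-- On one closed side of a crease, the surface `f` has the frame `E`, with derivative `E'`. -/
structure IsSideFrame (f : Plane → Space) (U : Set Plane) (η : Plane → ℝ) (σ : ℝ)
    (E : Plane → Op) (E' : Plane → Plane →L[ℝ] Op) : Prop where
  isFramed : IsFramed f (closedSide U η σ) E E'
  eq_frame : ∀ y ∈ openSide U η σ, E y = frame f y
  eq_fderiv : ∀ y ∈ openSide U η σ, E' y = fderiv ℝ (frame f) y
  isBendingForm : ∀ y ∈ closedSide U η σ, IsBendingForm (E y) (E' y)

lemma IsSideFrame.mono {U U' : Set Plane} {η : Plane → ℝ} {σ : ℝ} {E : Plane → Op}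
    {E' : Plane → Plane →L[ℝ] Op} (h : IsSideFrame f U η σ E E') (hU : U' ⊆ U) :
    IsSideFrame f U' η σ E E' :=
  ⟨h.isFramed.mono fun _ hy => ⟨hU hy.1, hy.2⟩, fun y hy => h.eq_frame y ⟨hU hy.1, hy.2⟩,
    fun y hy => h.eq_fderiv y ⟨hU hy.1, hy.2⟩, fun y hy => h.isBendingForm y ⟨hU hy.1, hy.2⟩⟩

/-- Near a crease point, the frame of a folded state extends to the crease from either side, because
the state is `C²` on each face up to the crease. -/
lemma IsFermiBox.exists_isSideFrame [Finite ι] {a : ℝ} {U : Set Plane} {S η : Plane → ℝ} {σ : ℝ}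
    (h : IsFermiBox P i s₀ a U S η) (hf : P.IsFolding f) (hσ : σ ^ 2 = 1) :
    ∃ a' U' E E', U' ⊆ U ∧ IsFermiBox P i s₀ a' U' S η ∧ IsSideFrame f U' η σ E E' := by
  set K := closedSide U η σ with hK
  set z := P.crease i s₀
  have hzK : z ∈ K := h.crease_mem_closedSide h.self_mem
  obtain ⟨y₀, hy₀⟩ : (openSide U η σ).Nonempty :=
    closure_nonempty_iff.1 ⟨z, h.crease_mem_closure h.self_mem hσ⟩
  have h1 : ContDiffOn ℝ 2 f K := by
    refine (hf.contDiffOn_face y₀ (h.openSide_subset hy₀)).mono fun y hy =>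
      ⟨h.subset_paper hy.1, ?_⟩
    exact closure_mono (h.isPreconnected_openSide.subset_connectedComponentIn hy₀
      h.openSide_subset) (h.closedSide_subset_closure hσ hy)
  have h2 := h1 z hzK
  rw [show (2 : WithTop ℕ∞) = 1 + 1 by norm_num,
    contDiffWithinAt_succ_iff_hasFDerivWithinAt' (by simp)] at h2
  obtain ⟨u, hu, -, -, f', hf', h3⟩ := h2
  rw [show (1 : WithTop ℕ∞) = 0 + 1 by norm_num,
    contDiffWithinAt_succ_iff_hasFDerivWithinAt' (by simp)] at h3
  obtain ⟨v, hv, -, -, f'', hf'', h4⟩ := h3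
  obtain ⟨w, hw, h5⟩ := (contDiffWithinAt_zero hzK).1 h4
  rw [insert_eq_of_mem hzK] at hu hv
  obtain ⟨W, hW, hWs⟩ := mem_nhdsWithin_iff_exists_mem_nhds_inter.1 (inter_mem (inter_mem hu hv) hw)
  obtain ⟨a', U', hU'W, hU'U, h'⟩ := h.shrink hW
  have hKK : closedSide U' η σ ⊆ K := fun y hy => ⟨hU'U hy.1, hy.2⟩
  have hKs : closedSide U' η σ ⊆ u ∩ v ∩ w := fun y hy => hWs ⟨hU'W hy.1, hKK hy⟩
  set E : Plane → Op := fun y => frameOf (f' y) with hE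
  set E' : Plane → Plane →L[ℝ] Op := fun y => (fderiv ℝ frameOf (f' y)).comp (f'' y) with hE'
  have hdE : ∀ y ∈ closedSide U' η σ, HasFDerivWithinAt E (E' y) (closedSide U' η σ) y := by
    intro y hy
    have h6 : HasFDerivAt frameOf (fderiv ℝ frameOf (f' y)) (f' y) :=
      ((contDiff_frameOf (n := 1)).differentiable (by norm_num) _).hasFDerivAt
    exact h6.comp_hasFDerivWithinAt y ((hf'' y (hKs hy).1.2).mono hKK)
  have hE'c : ContinuousOn E' (closedSide U' η σ) := by
    have h6 : ContinuousOn f' (closedSide U' η σ) := fun y hy =>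
      ((hf'' y (hKs hy).1.2).mono hKK).continuousWithinAt
    refine ContinuousOn.clm_comp ?_ (h5.mono fun y hy => ⟨hKK hy, (hKs hy).2⟩)
    exact ((contDiff_frameOf (n := 1)).continuous_fderiv (by norm_num)).comp_continuousOn h6
  have hEf : ∀ y ∈ openSide U' η σ, E y = frame f y := by
    intro y hy
    have h6 : closedSide U' η σ ∈ 𝓝 y :=
      mem_of_superset (h'.isOpen_openSide.mem_nhds hy) openSide_subset_closedSide
    have hyK := openSide_subset_closedSide hy
    have h7 := ((hf' y (hKs hyK).1.1).mono hKK).hasFDerivAt h6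
    simp only [hE, frame, h7.fderiv]
  have hE'f : ∀ y ∈ openSide U' η σ, E' y = fderiv ℝ (frame f) y := by
    intro y hy
    have h6 : closedSide U' η σ ∈ 𝓝 y :=
      mem_of_superset (h'.isOpen_openSide.mem_nhds hy) openSide_subset_closedSide
    have h7 := (hdE y (openSide_subset_closedSide hy)).hasFDerivAt h6
    have h8 : frame f =ᶠ[𝓝 y] E :=
      Filter.eventually_of_mem (h'.isOpen_openSide.mem_nhds hy) fun y hy => (hEf y hy).symm
    exact (h7.congr_of_eventuallyEq h8).fderiv.symm
  have hEc : ContinuousOn E (closedSide U' η σ) := fun y hy => (hdE y hy).continuousWithinAt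
  have hrot : ∀ y ∈ closedSide U' η σ, IsRot (E y) := by
    intro y hy
    have h6 := ((hEc y hy).mono openSide_subset_closedSide).mem_closure
      (h'.closedSide_subset_closure hσ hy) (t := {A | IsRot A}) fun x hx => by
        rw [hEf x hx]
        exact hf.isRot_frame (h'.openSide_subset hx)
    rwa [isClosed_isRot.closure_eq] at h6
  refine ⟨a', U', E, E', hU'U, h', ⟨hrot, fun y hy => ?_, hdE, hE'c⟩, hEf, hE'f, fun y hy => ?_⟩
  · refine ((hf' y (hKs hy).1.1).mono hKK).congr_fderiv ?_
    ext1 v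
    exact (frameOf_emb _ v).symm
  · have h6 := ((((hEc y hy).prodMk (hE'c y hy))).mono openSide_subset_closedSide).mem_closure
      (h'.closedSide_subset_closure hσ hy)
      (t := {q : Op × (Plane →L[ℝ] Op) | IsBendingForm q.1 q.2}) fun x hx => by
        show IsBendingForm (E x) (E' x)
        rw [hEf x hx, hE'f x hx]
        exact hf.isBendingForm (h'.openSide_subset hx)
    rwa [isClosed_isBendingForm.closure_eq] at h6

end

/-! ### The second fundamental form along a crease -/

section

open CreaseRulePattern

variable {ι : Type*} {P : CreaseRulePattern ι} {f : Plane → Space} {i : ι} {s₀ : ℝ}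

/-- The second fundamental form of a surface with frame `A`, whose derivative is `A'`. -/
def secondForm (A : Op) (A' : Plane →L[ℝ] Op) (v w : Plane) : ℝ := inner ℝ (A' v (emb w)) (A e3)

@[simp] lemma darboux_p1 (T : Plane) : darboux T (emb p1) = emb T := by simp [darboux]
@[simp] lemma darboux_p2 (T : Plane) : darboux T (emb p2) = emb (quarterTurn T) := by simp [darboux]
@[simp] lemma darboux_e3 (T : Plane) : darboux T e3 = e3 := by simp [darboux]
@[simp] lemma twist_p1 (ρ : ℝ) : twist ρ (emb p1) = emb p1 := by simp [twist]
@[simp] lemma bend_p1 (κ τ : ℝ) : bend κ τ (emb p1) = κ • e3 := by simp [bend]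
@[simp] lemma spin_p1 : spin (emb p1) = emb p2 := by simp [spin]

lemma inner_emb_p1 (w : Space) : (inner ℝ w (emb p1) : ℝ) = w 0 := by rw [inner3]; simp
lemma inner_emb_p2 (w : Space) : (inner ℝ w (emb p2) : ℝ) = w 1 := by rw [inner3]; simp
lemma inner_e3 (w : Space) : (inner ℝ w e3 : ℝ) = w 2 := by rw [inner3]; simp

/-- The body velocity of a Darboux frame, up to the curvature of the unfolded curve. -/
lemma IsBendingForm.eq_bend {A : Op} {A' : Plane →L[ℝ] Op} (h : IsBendingForm A A') (T v : Plane) :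
    star (darboux T) * (star A * A' v) * darboux T =
      bend (secondForm A A' v T) (secondForm A A' v (quarterTurn T)) := by
  set C := star (darboux T) * (star A * A' v) * darboux T with hC
  have h1 : ∀ x w, (inner ℝ (C x) w : ℝ) = inner ℝ (A' v (darboux T x)) (A (darboux T w)) := by
    intro x w
    rw [real_inner_comm, hC, mul_assoc, mul_assoc, Op.mul_apply, Op.inner_star, Op.mul_apply,
      Op.inner_star, Op.mul_apply, real_inner_comm]
  have h2 : ∀ x w, (inner ℝ (C x) w : ℝ) = -inner ℝ (C w) x := by
    intro x w
    have h3 : star C = -C := by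
      rw [hC, star_mul, star_mul, h.skew v, star_star]; simp [mul_assoc]
    have h4 := Op.inner_star C w x
    rw [h3] at h4
    rw [← h4, real_inner_comm]
    simp
  have h3 : ∀ w, (inner ℝ (C (emb p1)) w : ℝ) = inner ℝ (A' v (emb T)) (A (darboux T w)) := by
    intro w; rw [h1, darboux_p1]
  have h4 : ∀ w, (inner ℝ (C (emb p2)) w : ℝ) =
      inner ℝ (A' v (emb (quarterTurn T))) (A (darboux T w)) := by
    intro w; rw [h1, darboux_p2]
  have e10 := h3 (emb p1)
  have e11 := h3 (emb p2)
  have e12 := h3 e3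
  have e20 := h4 (emb p1)
  have e21 := h4 (emb p2)
  have e22 := h4 e3
  have e30 := h2 e3 (emb p1)
  have e31 := h2 e3 (emb p2)
  have e32 := h2 e3 e3
  rw [e12] at e30
  rw [e22] at e31
  rw [darboux_p1, h.normal, inner_emb_p1] at e10 e20
  rw [darboux_p2, h.normal, inner_emb_p2] at e11 e21
  rw [darboux_e3, inner_e3] at e12 e22
  rw [darboux_e3, inner_emb_p1] at e30
  rw [darboux_e3, inner_emb_p2] at e31
  rw [inner_e3] at e32
  apply op_ext <;> apply space_ext <;>
    simp [bend, secondForm, e10, e11, e12, e20, e21, e22, e30, e31]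
  linarith

lemma hasDerivAt_darboux {s : ℝ} (hs : s ∈ Ioo 0 (P.len i)) :
    HasDerivAt (fun r => darboux (P.tangent i r))
      (darboux (P.tangent i s) * (P.curvature i s • spin)) s := by
  -- `darboux` is affine in the tangent
  let D : Plane →L[ℝ] Op := Op.ofL.comp
    (((ContinuousLinearMap.smulRightL ℝ Space Space (EuclideanSpace.proj (0 : Fin 3))).comp emb) +
      ((ContinuousLinearMap.smulRightL ℝ Space Space (EuclideanSpace.proj (1 : Fin 3))).comp
        (emb.comp qt)))
  have h1 : ∀ T, darboux T = D T + cols 0 0 e3 := by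
    intro T
    apply Op.ext
    intro v
    have : D T = Op.of (ContinuousLinearMap.smulRight (EuclideanSpace.proj (0 : Fin 3)) (emb T) +
      ContinuousLinearMap.smulRight (EuclideanSpace.proj (1 : Fin 3)) (emb (quarterTurn T))) := rfl
    rw [this]
    simp [darboux]
  have h2 : ∀ T, D T = cols (emb T) (emb (quarterTurn T)) 0 := by
    intro T
    apply Op.ext
    intro v
    have : D T = Op.of (ContinuousLinearMap.smulRight (EuclideanSpace.proj (0 : Fin 3)) (emb T) +
      ContinuousLinearMap.smulRight (EuclideanSpace.proj (1 : Fin 3)) (emb (quarterTurn T))) := rfl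
    rw [this]
    simp
  have h3 := (D.hasFDerivAt.comp_hasDerivAt s (hasStrictDerivAt_tangent hs).hasDerivAt).add_const
    (cols 0 0 e3)
  have h4 : (fun r => darboux (P.tangent i r)) = fun r => D (P.tangent i r) + cols 0 0 e3 :=
    funext fun r => h1 _
  rw [h4]
  refine h3.congr_deriv ?_
  rw [map_smul, h2, mul_smul_comm]
  congr 1
  apply op_ext <;> apply space_ext <;> simp [darboux, spin, CreaseRulePattern.leftNormal]

/-- The Darboux frame of one side of a folded crease turns with the normal curvature and the
geodesic torsion of that side, and with the curvature of the unfolded crease. -/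
lemma hasDerivAt_mul_darboux {e : ℝ → Op} {A' : Plane →L[ℝ] Op} {s : ℝ} (hs : s ∈ Ioo 0 (P.len i))
    (he : HasDerivAt e (A' (P.tangent i s)) s) (hr : IsRot (e s)) (hA : IsBendingForm (e s) A') :
    HasDerivAt (fun r => e r * darboux (P.tangent i r)) (e s * darboux (P.tangent i s) *
      (bend (secondForm (e s) A' (P.tangent i s) (P.tangent i s))
        (secondForm (e s) A' (P.tangent i s) (P.leftNormal i s)) + P.curvature i s • spin)) s := by
  refine (he.mul (hasDerivAt_darboux hs)).congr_deriv ?_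
  have hM := (isRot_darboux (norm_tangent hs)).mul_star
  rw [CreaseRulePattern.leftNormal, ← hA.eq_bend, mul_add]
  congr 1
  · calc A' (P.tangent i s) * darboux (P.tangent i s)
        = (e s * star (e s)) * A' (P.tangent i s) * darboux (P.tangent i s) := by
          rw [hr.mul_star, one_mul]
      _ = e s * (darboux (P.tangent i s) * star (darboux (P.tangent i s))) *
          (star (e s) * A' (P.tangent i s)) * darboux (P.tangent i s) := by
          rw [hM]; simp only [mul_assoc, one_mul]
      _ = _ := by simp only [mul_assoc]

/-- The rotation by which the left frame arises from the right one, in terms of the surface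
normals. -/
lemma mul_darboux_eq_iff {EL ER : Op} (hL : IsRot EL) (hR : IsRot ER) {T : Plane} (hT : ‖T‖ = 1)
    (ρ : ℝ) : EL * darboux T = ER * darboux T * twist ρ ↔ EL (emb T) = ER (emb T) ∧
      EL e3 = Real.cos ρ • ER e3 + Real.sin ρ • cross (ER (emb T)) (ER e3) := by
  have hc : cross (ER (emb T)) (ER e3) = -ER (emb (quarterTurn T)) := by
    rw [hR.2, ← map_neg, ← map_neg]
    congr 1
    apply space_ext <;> simp
  have h3 : (ER * darboux T * twist ρ) e3 =
      Real.cos ρ • ER e3 + Real.sin ρ • cross (ER (emb T)) (ER e3) := by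
    have : twist ρ e3 = Real.cos ρ • e3 - Real.sin ρ • emb p2 := by simp [twist]
    rw [hc, Op.mul_apply, Op.mul_apply, this]
    simp only [map_sub, map_smul, darboux_e3, darboux_p2]
    module
  constructor
  · intro h
    refine ⟨?_, ?_⟩
    · have := congrArg (fun A : Op => A (emb p1)) h
      simpa using this
    · rw [← h3, ← h]; simp
  · rintro ⟨h1, h2⟩
    have hM := isRot_darboux hT
    refine (hL.mul hM).ext_of ((hR.mul hM).mul (isRot_twist ρ)) (d := p1) ?_ ?_ ?_
    · rw [← norm_ne_zero_iff]; simp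
    · simp [h1]
    · rw [h3, ← h2]; simp

/-! ### The fold angle -/

namespace IsSideFrame

variable {a : ℝ} {U : Set Plane} {S η : Plane → ℝ} {σ : ℝ} {E : Plane → Op}
  {E' : Plane → Plane →L[ℝ] Op} {s : ℝ}

lemma hasDerivAt_crease (h : IsSideFrame f U η σ E E') (hB : IsFermiBox P i s₀ a U S η)
    (hs : s ∈ Ioo (s₀ - a) (s₀ + a)) :
    HasDerivAt (fun r => E (P.crease i r)) (E' (P.crease i s) (P.tangent i s)) s :=
  h.isFramed.hasDerivAt_frame isOpen_Ioo
    (fun _ hr => (hasStrictDerivAt_crease (hB.mem_Ioo _ hr)).hasDerivAt)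
    (fun _ hr => hB.crease_mem_closedSide hr) hs

lemma hasDerivAt_surface (h : IsSideFrame f U η σ E E') (hB : IsFermiBox P i s₀ a U S η)
    (hs : s ∈ Ioo (s₀ - a) (s₀ + a)) :
    HasDerivAt (fun r => f (P.crease i r)) (E (P.crease i s) (emb (P.tangent i s))) s :=
  h.isFramed.hasDerivAt_surface isOpen_Ioo
    (fun _ hr => (hasStrictDerivAt_crease (hB.mem_Ioo _ hr)).hasDerivAt)
    (fun _ hr => hB.crease_mem_closedSide hr) hs

lemma isRot_crease (h : IsSideFrame f U η σ E E') (hB : IsFermiBox P i s₀ a U S η)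
    (hs : s ∈ Ioo (s₀ - a) (s₀ + a)) : IsRot (E (P.crease i s)) :=
  h.isFramed.isRot _ (hB.crease_mem_closedSide hs)

lemma hasDerivAt_darboux (h : IsSideFrame f U η σ E E') (hB : IsFermiBox P i s₀ a U S η)
    (hs : s ∈ Ioo (s₀ - a) (s₀ + a)) :
    HasDerivAt (fun r => E (P.crease i r) * darboux (P.tangent i r))
      (E (P.crease i s) * darboux (P.tangent i s) *
      (bend (secondForm (E (P.crease i s)) (E' (P.crease i s)) (P.tangent i s) (P.tangent i s))
        (secondForm (E (P.crease i s)) (E' (P.crease i s)) (P.tangent i s) (P.leftNormal i s)) +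
        P.curvature i s • spin)) s :=
  hasDerivAt_mul_darboux (hB.mem_Ioo _ hs) (h.hasDerivAt_crease hB hs) (h.isRot_crease hB hs)
    (h.isBendingForm _ (hB.crease_mem_closedSide hs))

lemma tendsto_frame (h : IsSideFrame f U η σ E E') (hB : IsFermiBox P i s₀ a U S η)
    (hσ : σ ^ 2 = 1) (hs : s ∈ Ioo (s₀ - a) (s₀ + a)) :
    Tendsto (fun ε : ℝ => frame f (P.fermi i (s, σ * ε))) (𝓝[>] 0) (𝓝 (E (P.crease i s))) := by
  have h1 := ((h.isFramed.continuousOn_frame _ (hB.crease_mem_closedSide hs)).mono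
    openSide_subset_closedSide).tendsto.comp (hB.tendsto_fermi hs hσ)
  refine h1.congr' ?_
  filter_upwards [hB.fermi_mem_openSide hs hσ] with ε hε
  exact h.eq_frame _ hε

/-- The curvature of the surface vanishes in the direction of a rule segment. -/
lemma apply_rule [Finite ι] (h : IsSideFrame f U η σ E E') (hB : IsFermiBox P i s₀ a U S η)
    (hf : P.IsFolding f)
    (hs : s ∈ Ioo (s₀ - a) (s₀ + a)) {b : Plane} (hb : (P.crease i s, b) ∈ P.rules)
    (hcl : ∃ᶠ l in 𝓝[>] (0 : ℝ), P.crease i s + l • (b - P.crease i s) ∈ openSide U η σ)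
    (v : Plane) : E' (P.crease i s) v (emb (b - P.crease i s)) = 0 := by
  set x := P.crease i s
  set W := openSide U η σ ∩ openSegment ℝ x b
  have hxW : x ∈ closure W := by
    have h1 : Tendsto (fun l : ℝ => x + l • (b - x)) (𝓝[>] 0) (𝓝 x) := by
      have : Continuous fun l : ℝ => x + l • (b - x) := by fun_prop
      simpa using (this.tendsto 0).mono_left nhdsWithin_le_nhds
    rw [mem_closure_iff_frequently]
    refine h1.frequently ?_
    refine (hcl.and_eventually (Ioo_mem_nhdsGT zero_lt_one)).mono fun l hl => ⟨hl.1, ?_⟩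
    rw [openSegment_eq_image']
    exact ⟨l, hl.2, rfl⟩
  have hcl' : IsClosed {A' : Plane →L[ℝ] Op | Op.act (A' v) (emb (b - x)) = 0} :=
    isClosed_eq (by fun_prop) continuous_const
  have h2 := ((h.isFramed.continuousOn _ (hB.crease_mem_closedSide hs)).mono
    (inter_subset_left.trans openSide_subset_closedSide)).mem_closure hxW
    (t := {A' : Plane →L[ℝ] Op | Op.act (A' v) (emb (b - x)) = 0}) fun y hy => by
      show Op.act (E' y v) (emb (b - x)) = 0
      rw [h.eq_fderiv y hy.1]
      exact (hf.fderiv_frame_rule hb hy.2 v).2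
  rwa [hcl'.closure_eq] at h2

end IsSideFrame

end

/-! ### The bending of the two faces along a crease -/

section

open CreaseRulePattern

variable {ι : Type*} {P : CreaseRulePattern ι} {f : Plane → Space} {i : ι} {s₀ : ℝ}

/-- Fermi coordinates near a crease point, together with the frames of a folded state on the two
sides of the crease. -/
structure IsCreaseChart (P : CreaseRulePattern ι) (f : Plane → Space) (i : ι) (s₀ a : ℝ)
    (U : Set Plane) (S η : Plane → ℝ) (EL ER : Plane → Op) (EL' ER' : Plane → Plane →L[ℝ] Op) :
    Prop where
  box : IsFermiBox P i s₀ a U S η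
  left : IsSideFrame f U η 1 EL EL'
  right : IsSideFrame f U η (-1) ER ER'

lemma exists_isCreaseChart [Finite ι] (hf : P.IsFolding f) (hs₀ : s₀ ∈ Ioo 0 (P.len i)) :
    ∃ a U S η EL ER EL' ER', IsCreaseChart P f i s₀ a U S η EL ER EL' ER' := by
  obtain ⟨a, U, S, η, hB⟩ := exists_isFermiBox P hs₀
  obtain ⟨a₁, U₁, EL, EL', hU₁, hB₁, hL⟩ := hB.exists_isSideFrame hf (σ := 1) (by norm_num)
  obtain ⟨a₂, U₂, ER, ER', hU₂, hB₂, hR⟩ := hB₁.exists_isSideFrame hf (σ := -1) (by norm_num)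
  exact ⟨a₂, U₂, S, η, EL, ER, EL', ER', hB₂, hL.mono hU₂, hR⟩

/-- Directions to the left and to the right of the tangent lead to that side of the crease. -/
lemma IsFermiBox.eventually_mem_openSide {a : ℝ} {U : Set Plane} {S η : Plane → ℝ} {σ : ℝ}
    (h : IsFermiBox P i s₀ a U S η) {s : ℝ} (hs : s ∈ Ioo (s₀ - a) (s₀ + a)) {d : Plane}
    (hd : 0 < σ * inner ℝ d (P.leftNormal i s)) :
    ∀ᶠ l in 𝓝[>] (0 : ℝ), P.crease i s + l • d ∈ openSide U η σ := by
  set x := P.crease i s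
  obtain ⟨hxU, -, hx0⟩ : x ∈ U ∧ S x = s ∧ η x = 0 := h.crease_mem hs
  have hl : HasDerivAt (fun l : ℝ => x + l • d) d 0 := by
    simpa using ((hasDerivAt_id (0 : ℝ)).smul_const d).const_add x
  have hη : HasFDerivAt η (innerSL ℝ (P.leftNormal i s)) (x + (0 : ℝ) • d) := by
    simpa using (h.deriv_dist s hs).hasFDerivAt
  have h1 := (hη.comp_hasDerivAt (0 : ℝ) hl).tendsto_slope_zero_right
  have h2 : Tendsto (fun l : ℝ => x + l • d) (𝓝[>] 0) (𝓝 x) := by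
    simpa using hl.continuousAt.tendsto.mono_left nhdsWithin_le_nhds
  have h3 := (h1.const_mul σ).eventually (lt_mem_nhds (a := 0) (by
    simpa [real_inner_comm] using hd))
  filter_upwards [h3, h2.eventually (h.isOpen.mem_nhds hxU), self_mem_nhdsWithin] with l h4 h5 hl0
  refine ⟨h5, ?_⟩
  simp only [Function.comp_apply, zero_add, zero_smul, add_zero, hx0, sub_zero, smul_eq_mul] at h4
  have h6 : 0 < l := hl0
  have h7 : σ * η (x + l • d) = l * (σ * (l⁻¹ * η (x + l • d))) := by field_simp
  rw [h7]
  exact mul_pos h6 h4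

namespace IsCreaseChart

variable {a : ℝ} {U : Set Plane} {S η : Plane → ℝ} {EL ER : Plane → Op}
  {EL' ER' : Plane → Plane →L[ℝ] Op} {s : ℝ}

/-- The frames on the two sides differ by a rotation about the tangent of the folded crease. -/
lemma mul_darboux_eq (h : IsCreaseChart P f i s₀ a U S η EL ER EL' ER')
    (hs : s ∈ Ioo (s₀ - a) (s₀ + a)) {ρ : ℝ} (hρ : P.HasFoldAngle f i s ρ) :
    EL (P.crease i s) * darboux (P.tangent i s) =
      ER (P.crease i s) * darboux (P.tangent i s) * twist ρ := by
  obtain ⟨PL, PR, h1, h2, h3⟩ := hρ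
  have hsl := h.box.mem_Ioo _ hs
  have hL := h.left.tendsto_frame h.box (by norm_num) hs
  have hR := h.right.tendsto_frame h.box (by norm_num) hs
  have hact : Continuous fun A : Op => Op.act A e3 := by fun_prop
  have e1 : PL = EL (P.crease i s) e3 := by
    refine tendsto_nhds_unique h1 (((hact.tendsto _).comp hL).congr fun ε => ?_)
    simp [surfaceNormal_eq, frame, fermi]
  have e2 : PR = ER (P.crease i s) e3 := by
    refine tendsto_nhds_unique h2 (((hact.tendsto _).comp hR).congr fun ε => ?_)
    simp [surfaceNormal_eq, frame, fermi, sub_eq_add_neg]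
  have d1 := h.left.hasDerivAt_surface h.box hs
  have d2 := h.right.hasDerivAt_surface h.box hs
  rw [mul_darboux_eq_iff (h.left.isRot_crease h.box hs) (h.right.isRot_crease h.box hs)
    (norm_tangent hsl)]
  refine ⟨d1.unique d2, ?_⟩
  rw [← e1, ← e2, h3, d2.deriv]

/-- Bending of the two faces along the crease: the normal curvatures are opposite and determined by
the fold angle, and the torsions of the two strips agree. -/
lemma secondForm_eq [Finite ι] (h : IsCreaseChart P f i s₀ a U S η EL ER EL' ER')
    (hf : P.IsProperlyFolded f) (hU : P.UniquelyRuled) (hR : P.ReflectingRulings)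
    (hs : s ∈ Ioo (s₀ - a) (s₀ + a)) {ρ : ℝ} (hρ : ρ ∈ Ioo (-Real.pi) Real.pi) (hρ0 : ρ ≠ 0)
    (hfold : P.HasFoldAngle f i s ρ) :
    let x := P.crease i s
    let T := P.tangent i s
    let V := P.leftNormal i s
    secondForm (EL x) (EL' x) T T = -P.curvature i s * Real.tan (ρ / 2) ∧
    secondForm (ER x) (ER' x) T T = -secondForm (EL x) (EL' x) T T ∧
    secondForm (ER x) (ER' x) T V = secondForm (EL x) (EL' x) T V ∧
    secondForm (EL x) (EL' x) T T ≠ 0 := by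
  intro x T V
  have hsl := h.box.mem_Ioo _ hs
  set κL := secondForm (EL x) (EL' x) T T with hκL
  set κR := secondForm (ER x) (ER' x) T T with hκR
  set τL := secondForm (EL x) (EL' x) T V with hτL
  set τR := secondForm (ER x) (ER' x) T V with hτR
  set k := P.curvature i s with hk
  have hk0 : k ≠ 0 := P.crease_curved i s hsl
  have htw := h.mul_darboux_eq hs hfold
  have hrL := h.left.isRot_crease h.box hs
  have hrR := h.right.isRot_crease h.box hs
  have hM := isRot_darboux (norm_tangent hsl)
  -- second derivatives of the folded crease, computed from both sides
  have hmatch : twist ρ (κL • e3 + k • emb p2) = κR • e3 + k • emb p2 := by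
    have hact : ∀ D : Op, ∀ v, Op.act.flip v D = D v := fun D v => rfl
    have dL := (Op.act.flip (emb p1)).hasFDerivAt.comp_hasDerivAt s
      (h.left.hasDerivAt_darboux h.box hs)
    have dR := (Op.act.flip (emb p1)).hasFDerivAt.comp_hasDerivAt s
      (h.right.hasDerivAt_darboux h.box hs)
    have heq : ((Op.act.flip (emb p1)) ∘ fun r => EL (P.crease i r) * darboux (P.tangent i r))
        =ᶠ[𝓝 s] ((Op.act.flip (emb p1)) ∘ fun r =>
          ER (P.crease i r) * darboux (P.tangent i r)) := by
      filter_upwards [isOpen_Ioo.mem_nhds hs] with r hr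
      simp only [Function.comp_apply, hact, Op.mul_apply, darboux_p1]
      exact (h.left.hasDerivAt_surface h.box hr).unique (h.right.hasDerivAt_surface h.box hr)
    have h1 := dL.unique (dR.congr_of_eventuallyEq heq)
    have hb : ∀ κ τ : ℝ, (bend κ τ + k • spin) (emb p1) = κ • e3 + k • emb p2 := by
      intro κ τ
      simp
    rw [htw] at h1
    simp only [hact, Op.mul_apply] at h1
    have hb' : ∀ κ τ : ℝ, Op.act (bend κ τ + P.curvature i s • spin) (emb p1) =
        κ • e3 + k • emb p2 := hb
    rw [hb', hb'] at h1
    have h2 := congrArg (fun w => star (darboux (P.tangent i s)) (star (ER (P.crease i s)) w)) h1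
    simp only [hrR.star_apply_self, hM.star_apply_self] at h2
    exact h2
  obtain ⟨hκ1, hκ2⟩ := curvature_eq_of_twist hρ hρ0 hmatch
  have htan : Real.tan (ρ / 2) ≠ 0 := by
    intro h0
    rcases lt_or_gt_of_ne hρ0 with h1 | h1
    · have := Real.tan_neg_of_neg_of_pi_div_two_lt (x := ρ / 2) (by linarith) (by linarith [hρ.1])
      linarith
    · have := Real.tan_pos_of_pos_of_lt_pi_div_two (x := ρ / 2) (by linarith) (by linarith [hρ.2])
      linarith
  have hκL0 : κL ≠ 0 := by rw [hκ1]; exact mul_ne_zero (neg_ne_zero.2 hk0) htan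
  have hκR0 : κR ≠ 0 := by rw [hκ2]; exact neg_ne_zero.2 hκL0
  -- a direction `d` in which the surface does not curve determines the torsion
  have hlin : ∀ (A : Op) (A' : Plane →L[ℝ] Op) (d : Plane), A' T (emb d) = 0 →
      (inner ℝ d T : ℝ) * secondForm A A' T T + (inner ℝ d V : ℝ) * secondForm A A' T V = 0 := by
    intro A A' d hd
    have h1 : (inner ℝ (A' T (emb d)) (A e3) : ℝ) = 0 := by rw [hd, inner_zero_left]
    rw [eq_combo_of_norm_one (norm_tangent hsl) d] at h1
    simp only [map_add, map_smul, inner_add_left, inner_smul_left] at h1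
    simp only [secondForm]
    have h2 : V = quarterTurn (P.tangent i s) := rfl
    rw [h2]
    simpa [add_comm] using h1
  -- no rule segment is tangent to the crease
  have htangent : ∀ b, (x, b) ∈ P.rules → (inner ℝ (b - x) V : ℝ) ≠ 0 := by
    intro b hb h0
    have hd0 : (inner ℝ (b - x) T : ℝ) ≠ 0 := by
      intro h1
      have h2 := eq_combo_of_norm_one (norm_tangent hsl) (b - x)
      have h3 : (inner ℝ (b - x) (quarterTurn (P.tangent i s)) : ℝ) = 0 := h0
      have h4 : (inner ℝ (b - x) (P.tangent i s) : ℝ) = 0 := h1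
      rw [h3, h4] at h2
      simp only [zero_smul, add_zero] at h2
      exact P.rule_ne x b hb (sub_eq_zero.1 h2).symm
    have hside : ∀ᶠ l in 𝓝[>] (0 : ℝ), x + l • (b - x) ∈ openSide U η 1 ∨
        x + l • (b - x) ∈ openSide U η (-1) := by
      have h2 : Tendsto (fun l : ℝ => x + l • (b - x)) (𝓝[>] 0) (𝓝 x) := by
        have : Continuous fun l : ℝ => x + l • (b - x) := by fun_prop
        simpa using (this.tendsto 0).mono_left nhdsWithin_le_nhds
      filter_upwards [h2.eventually (h.box.isOpen.mem_nhds (h.box.crease_mem hs).1),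
        Ioo_mem_nhdsGT zero_lt_one] with l h3 hl
      have h4 : x + l • (b - x) ∈ P.uncreased := P.rule_subset x b hb (by
        rw [openSegment_eq_image']; exact ⟨l, hl, rfl⟩)
      have h5 : η (x + l • (b - x)) ≠ 0 := by
        intro h6
        apply h4.2
        rw [h.box.eq_crease h3 h6]
        exact mem_iUnion.2 ⟨i, mem_image_of_mem _ (Ioo_subset_Icc_self
          (h.box.mem_Ioo _ (h.box.mapsTo _ h3).1))⟩
      rcases lt_or_gt_of_ne h5 with h6 | h6
      · right; exact ⟨h3, by linarith⟩
      · left; exact ⟨h3, by linarith⟩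
    rcases frequently_or_distrib.1 hside.frequently with h1 | h1
    · have h2 := hlin (EL x) (EL' x) _ (h.left.apply_rule h.box hf.1 hs hb h1 T)
      rw [h0, zero_mul, add_zero] at h2
      exact mul_ne_zero hd0 hκL0 h2
    · have h2 := hlin (ER x) (ER' x) _ (h.right.apply_rule h.box hf.1 hs hb h1 T)
      rw [h0, zero_mul, add_zero] at h2
      exact mul_ne_zero hd0 hκR0 h2
  refine ⟨hκ1, hκ2, ?_, hκL0⟩
  obtain ⟨b, ⟨hb, hleft⟩, -⟩ := (hU i s hsl).1
  have hβ : 0 < (inner ℝ (b - x) V : ℝ) := hleft.resolve_right fun h0 => htangent b hb h0.1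
  obtain ⟨b', hb', r, hr, hrefl⟩ := hR i s hsl b hb
  have hrefl' : b' - x = r • (((2 : ℝ) * inner ℝ (b - x) T) • T - (b - x)) := by
    refine hrefl.trans ?_
    rw [Submodule.reflection_singleton_apply, norm_tangent hsl, real_inner_comm]
    simp only [x, T, RCLike.ofReal_real_eq_id, id_eq, one_pow, div_one]
    module
  have hTT : (inner ℝ T T : ℝ) = 1 := inner_self_of_norm_one (norm_tangent hsl)
  have hTV : (inner ℝ T V : ℝ) = 0 := by rw [real_inner_comm]; exact inner_leftNormal_tangent
  have e1 : (inner ℝ (b' - x) T : ℝ) = r * inner ℝ (b - x) T := by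
    rw [hrefl', inner_smul_left, inner_sub_left, inner_smul_left, hTT]
    simp; left; ring
  have e2 : (inner ℝ (b' - x) V : ℝ) = -(r * inner ℝ (b - x) V) := by
    rw [hrefl', inner_smul_left, inner_sub_left, inner_smul_left, hTV]
    simp
  have h1 := hlin (EL x) (EL' x) _ (h.left.apply_rule h.box hf.1 hs hb
    (h.box.eventually_mem_openSide hs (by simpa using hβ)).frequently T)
  have h2 := hlin (ER x) (ER' x) _ (h.right.apply_rule h.box hf.1 hs hb'
    (h.box.eventually_mem_openSide hs (by rw [e2]; nlinarith)).frequently T)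
  rw [e1, e2, ← hκR, ← hτR, hκ2] at h2
  rw [← hκL, ← hτL] at h1
  have h3 : r * inner ℝ (b - x) V * (τR - τL) = 0 := by linear_combination -h2 - r * h1
  exact sub_eq_zero.1 ((mul_eq_zero.1 h3).resolve_left (mul_pos hr hβ).ne')

end IsCreaseChart

lemma two_arctan_tan {ρ : ℝ} (hρ : ρ ∈ Ioo (-Real.pi) Real.pi) :
    2 * Real.arctan (Real.tan (ρ / 2)) = ρ := by
  rw [Real.arctan_tan (by linarith [hρ.1]) (by linarith [hρ.2])]; ring

lemma twist_injOn : InjOn twist (Ioo (-Real.pi) Real.pi) := by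
  intro ρ hρ ρ' hρ' h
  have h1 := congrArg (fun A : Op => A (emb p2)) h
  have h2 : Real.cos ρ = Real.cos ρ' := by
    have := congrArg (fun w : Space => w 1) h1
    simpa [twist] using this
  have h3 : Real.sin ρ = Real.sin ρ' := by
    have := congrArg (fun w : Space => w 2) h1
    simpa [twist] using this
  have h4 : Real.cos (ρ - ρ') = 1 := by
    rw [Real.cos_sub, h2, h3, ← sq, ← sq, Real.cos_sq_add_sin_sq]
  have := (Real.cos_eq_one_iff_of_lt_of_lt (by linarith [hρ.1, hρ'.2])
    (by linarith [hρ.2, hρ'.1])).1 h4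
  linarith

/-- The fold angle does not vary along a crease. -/
lemma CreaseRulePattern.IsProperlyFolded.exists_foldAngle [Finite ι] (hf : P.IsProperlyFolded f)
    (hU : P.UniquelyRuled) (hR : P.ReflectingRulings) :
    ∃ ρ : ι → ℝ, ∀ i, ρ i ∈ Ioo (-Real.pi) Real.pi ∧ ρ i ≠ 0 ∧
      ∀ s ∈ Ioo 0 (P.len i), P.HasFoldAngle f i s (ρ i) := by
  choose! ρ hρ hρ0 hfold using hf.2
  -- the twist is the quotient of the Darboux frames, whose body velocities it intertwines
  have hd : ∀ i, ∀ s₀ ∈ Ioo 0 (P.len i), HasDerivAt (fun s => twist (ρ i s)) 0 s₀ := by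
    intro i s₀ hs₀
    obtain ⟨a, U, S, η, EL, ER, EL', ER', h⟩ := exists_isCreaseChart hf.1 hs₀
    have hs := h.box.self_mem
    have hρs := hρ i s₀ hs₀
    obtain ⟨h1, h2, h3, -⟩ := h.secondForm_eq hf hU hR hs hρs (hρ0 i s₀ hs₀) (hfold i s₀ hs₀)
    have dL := h.left.hasDerivAt_darboux h.box hs
    have dR := h.right.hasDerivAt_darboux h.box hs
    have hrot : ∀ s ∈ Ioo (s₀ - a) (s₀ + a),
        IsRot (ER (P.crease i s) * darboux (P.tangent i s)) := fun s hs =>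
      (h.right.isRot_crease h.box hs).mul (isRot_darboux (norm_tangent (h.box.mem_Ioo _ hs)))
    have heq : (fun s => twist (ρ i s)) =ᶠ[𝓝 s₀] fun s =>
        star (ER (P.crease i s) * darboux (P.tangent i s)) *
          (EL (P.crease i s) * darboux (P.tangent i s)) := by
      filter_upwards [isOpen_Ioo.mem_nhds hs] with s hs
      rw [h.mul_darboux_eq hs (hfold i s (h.box.mem_Ioo _ hs)), ← mul_assoc, (hrot s hs).1, one_mul]
    refine ((dR.star.mul dL).congr_deriv ?_).congr_of_eventuallyEq heq
    have hskew := skew_of_isRot dR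
      (Filter.eventually_of_mem (isOpen_Ioo.mem_nhds hs) fun s hs => hrot s hs)
    rw [h.mul_darboux_eq hs (hfold i s₀ hs₀)]
    rw [h2, h3] at hskew ⊢
    generalize hD : ER (P.crease i s₀) * darboux (P.tangent i s₀) = D at hskew ⊢
    have hDr : IsRot D := by rw [← hD]; exact hrot s₀ hs
    rw [← mul_assoc, hDr.1, one_mul] at hskew
    rw [star_mul, hskew]
    have htc := twist_cond (Real.tan (ρ i s₀ / 2)) (P.curvature i s₀)
    rw [two_arctan_tan hρs, ← h1] at htc
    have := twist_mul_bend (τ := secondForm (EL (P.crease i s₀)) (EL' (P.crease i s₀))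
      (P.tangent i s₀) (P.leftNormal i s₀)) htc.1 htc.2
    have e1 : ∀ X Y : Op, -X * star D * (D * Y) = -(X * Y) := by
      intro X Y
      rw [mul_assoc, ← mul_assoc (star D), hDr.1, one_mul, neg_mul]
    have e2 : ∀ Y Z : Op, star D * (D * Y * Z) = Y * Z := by
      intro Y Z
      rw [mul_assoc, ← mul_assoc, hDr.1, one_mul]
    rw [e1, e2, this, neg_add_cancel]
  refine ⟨fun i => ρ i (P.len i / 2), fun i => ?_⟩
  have hm : P.len i / 2 ∈ Ioo 0 (P.len i) := ⟨by linarith [P.len_pos i], by linarith [P.len_pos i]⟩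
  refine ⟨hρ i _ hm, hρ0 i _ hm, fun s hs => ?_⟩
  have h1 := eq_of_hasDerivAt_zero (convex_Ioo _ _) (hd i) hs hm
  show P.HasFoldAngle f i s (ρ i (P.len i / 2))
  rw [← twist_injOn (hρ i s hs) (hρ i _ hm) h1]
  exact hfold i s hs

end

/-! ### Rule segments lead to the crease -/

section

open CreaseRulePattern

variable {ι : Type*} {P : CreaseRulePattern ι} {f : Plane → Space} {i : ι} {s₀ : ℝ}

lemma secondForm_combo (A : Op) (A' : Plane →L[ℝ] Op) (v w w' : Plane) (x x' : ℝ) :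
    secondForm A A' v (x • w + x' • w') = x * secondForm A A' v w + x' * secondForm A A' v w' := by
  simp [secondForm, inner_add_left, inner_smul_left]

lemma continuousOn_secondForm {R : Set Plane} {E : Plane → Op} {E' : Plane → Plane →L[ℝ] Op}
    (hE : ContinuousOn E R) (hE' : ContinuousOn E' R) (v w : Plane) :
    ContinuousOn (fun y => secondForm (E y) (E' y) v w) R := by
  unfold secondForm
  refine ContinuousOn.inner ?_ ?_
  · exact (Op.act.continuous.comp_continuousOn (hE'.clm_apply continuousOn_const)).clm_apply
      continuousOn_const
  · exact (Op.act.continuous.comp_continuousOn hE).clm_apply continuousOn_const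

namespace IsSideFrame

variable {a : ℝ} {U : Set Plane} {S η : Plane → ℝ} {σ : ℝ} {E : Plane → Op}
  {E' : Plane → Plane →L[ℝ] Op}

/-- Near a crease point at which the surface is curved along the crease, rule segments are
uniformly transversal to the crease. -/
lemma exists_transversality [Finite ι] (h : IsSideFrame f U η σ E E')
    (hB : IsFermiBox P i s₀ a U S η) (hf : P.IsFolding f)
    (hκ : secondForm (E (P.crease i s₀)) (E' (P.crease i s₀)) (P.tangent i s₀)
      (P.tangent i s₀) ≠ 0) :
    ∃ c ∈ Ioc (0 : ℝ) 1, ∀ᶠ y in 𝓝 (P.crease i s₀), y ∈ openSide U η σ →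
      ∀ p q, (p, q) ∈ P.rules → y ∈ openSegment ℝ p q →
        c * ‖q - p‖ ≤ |(inner ℝ (q - p) (P.leftNormal i s₀) : ℝ)| := by
  set z := P.crease i s₀
  set T := P.tangent i s₀
  set V := P.leftNormal i s₀
  set κ := secondForm (E z) (E' z) T T
  have hzK : z ∈ closedSide U η σ := hB.crease_mem_closedSide hB.self_mem
  have hcont := fun w =>
    continuousOn_secondForm h.isFramed.continuousOn_frame h.isFramed.continuousOn T w z hzK
  have h1 : ∀ᶠ y in 𝓝[closedSide U η σ] z, |κ| / 2 < |secondForm (E y) (E' y) T T| :=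
    ((hcont T).abs).eventually (lt_mem_nhds (half_lt_self (abs_pos.2 hκ)))
  set M := |secondForm (E z) (E' z) T V| + 1 with hM
  have h2 : ∀ᶠ y in 𝓝[closedSide U η σ] z, |secondForm (E y) (E' y) T V| < M :=
    ((hcont V).abs).eventually (gt_mem_nhds (lt_add_one _))
  have hM0 : 0 < M := by positivity
  have hκ0 : 0 < |κ| := abs_pos.2 hκ
  set c := (1 + 2 * M / |κ|)⁻¹ with hc
  have hc1 : 1 ≤ 1 + 2 * M / |κ| := by
    have : 0 ≤ 2 * M / |κ| := by positivity
    linarith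
  refine ⟨c, ⟨by positivity, inv_le_one_of_one_le₀ hc1⟩, ?_⟩
  filter_upwards [eventually_nhdsWithin_iff.1 (h1.and h2)] with y hy hyo p q hpq hypq
  obtain ⟨hy1, hy2⟩ := hy (openSide_subset_closedSide hyo)
  set d := q - p
  have hT1 : ‖T‖ = 1 := norm_tangent hB.base_mem
  have hdec : d = (inner ℝ d V : ℝ) • V + (inner ℝ d T : ℝ) • T := eq_combo_of_norm_one hT1 d
  have h3 : secondForm (E y) (E' y) T d = 0 := by
    rw [secondForm, h.eq_fderiv y hyo, (hf.fderiv_frame_rule hpq hypq T).2, inner_zero_left]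
  rw [hdec, secondForm_combo] at h3
  have h4 : |(inner ℝ d T : ℝ)| * (|κ| / 2) ≤ |(inner ℝ d V : ℝ)| * M := by
    calc |(inner ℝ d T : ℝ)| * (|κ| / 2) ≤ |(inner ℝ d T : ℝ)| * |secondForm (E y) (E' y) T T| := by
          gcongr
      _ = |(inner ℝ d V : ℝ)| * |secondForm (E y) (E' y) T V| := by
          rw [← abs_mul, ← abs_mul, ← abs_neg]; congr 1; linarith
      _ ≤ _ := by gcongr
  have h5 : ‖d‖ ≤ |(inner ℝ d V : ℝ)| + |(inner ℝ d T : ℝ)| := by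
    have hV1 : ‖V‖ = 1 := norm_leftNormal hB.base_mem
    calc ‖d‖ = ‖(inner ℝ d V : ℝ) • V + (inner ℝ d T : ℝ) • T‖ := by rw [← hdec]
      _ ≤ _ := (norm_add_le _ _).trans (by rw [norm_smul, norm_smul, hT1, hV1]; simp)
  have h6 : |(inner ℝ d T : ℝ)| ≤ |(inner ℝ d V : ℝ)| * (2 * M / |κ|) := by
    rw [mul_div_assoc', le_div_iff₀ hκ0]; linarith
  rw [hc, inv_mul_le_iff₀ (by positivity)]
  linarith

/-- A rule segment beside the crease has an endpoint on the crease, and the frame of the surface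
at a point of the rule segment is that at this endpoint. -/
lemma exists_foot [Finite ι] (h : IsSideFrame f U η σ E E')
    (hB : IsFermiBox P i s₀ a U S η) (hσ : σ ^ 2 = 1) (hf : P.IsFolding f)
    (hκ : secondForm (E (P.crease i s₀)) (E' (P.crease i s₀)) (P.tangent i s₀) (P.tangent i s₀) ≠ 0)
    {W : Set Plane} (hW : W ∈ 𝓝 (P.crease i s₀)) :
    ∀ᶠ y in 𝓝 (P.crease i s₀), y ∈ closedSide U η σ → ∃ s ∈ Ioo (s₀ - a) (s₀ + a),
      P.crease i s ∈ W ∧ E y = E (P.crease i s) ∧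
      f y - E y (emb y) = f (P.crease i s) - E (P.crease i s) (emb (P.crease i s)) ∧
      (η y = 0 → s = S y) := by
  set z := P.crease i s₀ with hz
  set V := P.leftNormal i s₀ with hV
  obtain ⟨hzU, hzS, hz0⟩ : z ∈ U ∧ S z = s₀ ∧ η z = 0 := hB.crease_mem hB.self_mem
  obtain ⟨c, ⟨hc0, hc1⟩, htr⟩ := h.exists_transversality hB hf hκ
  have hσ1 : |σ| = 1 := by rw [← sq_eq_sq₀ (abs_nonneg _) zero_le_one, sq_abs, hσ]; norm_num
  -- `η` is nearly linear on a ball around the crease point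
  have hlin : ∀ᶠ q : Plane × Plane in 𝓝 (z, z),
      ‖η q.1 - η q.2 - innerSL ℝ V (q.1 - q.2)‖ ≤ c / 2 * ‖q.1 - q.2‖ :=
    ((hasStrictFDerivAt_iff_isLittleO.1 (hB.deriv_dist s₀ hB.self_mem)).def (by positivity))
  obtain ⟨r₁, hr₁, hlin⟩ := Metric.eventually_nhds_iff_ball.1 hlin
  obtain ⟨r₂, hr₂, hball⟩ := Metric.mem_nhds_iff.1 (inter_mem (hB.isOpen.mem_nhds hzU) hW)
  obtain ⟨r₃, hr₃, htr⟩ := Metric.eventually_nhds_iff_ball.1 htr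
  set r := min r₁ r₂ with hr
  have hr0 : 0 < r := lt_min hr₁ hr₂
  have hrU : Metric.ball z r ⊆ U ∩ W := (Metric.ball_subset_ball (min_le_right _ _)).trans hball
  have hlin' : ∀ x ∈ Metric.ball z r, ∀ x' ∈ Metric.ball z r,
      |η x - η x' - inner ℝ V (x - x')| ≤ c / 2 * ‖x - x'‖ := by
    intro x hx x' hx'
    refine hlin (x, x') ?_
    rw [Metric.mem_ball, Prod.dist_eq, max_lt_iff]
    exact ⟨hx.trans_le (min_le_left _ _), hx'.trans_le (min_le_left _ _)⟩
  have hr' : 0 < min r₃ (c * r / 8) := lt_min hr₃ (by positivity)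
  refine Metric.eventually_nhds_iff_ball.2 ⟨_, hr', fun y hy hyK => ?_⟩
  have hyz : ‖y - z‖ < c * r / 8 := (mem_ball_iff_norm.1 hy).trans_le (min_le_right _ _)
  have hcr : c * r ≤ r := mul_le_of_le_one_left hr0.le hc1
  have hyr : y ∈ Metric.ball z r := mem_ball_iff_norm.2 (by linarith)
  by_cases hη : η y = 0
  · have h1 := hB.eq_crease hyK.1 hη
    refine ⟨S y, (hB.mapsTo y hyK.1).1, ?_, ?_, ?_, fun _ => rfl⟩ <;> rw [← h1]
    exact (hrU hyr).2
  have hyo : y ∈ openSide U η σ := by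
    refine ⟨hyK.1, lt_of_le_of_ne hyK.2 fun h0 => ?_⟩
    rcases mul_eq_zero.1 h0.symm with h1 | h1
    · rw [h1] at hσ; norm_num at hσ
    · exact hη h1
  have hV1 : ‖V‖ = 1 := norm_leftNormal hB.base_mem
  have hηy : σ * η y ≤ 2 * ‖y - z‖ := by
    have h1 := hlin' y hyr z (Metric.mem_ball_self hr0)
    rw [hz0, sub_zero] at h1
    have h2 := abs_real_inner_le_norm V (y - z)
    rw [hV1, one_mul] at h2
    have h3 : |η y| ≤ |η y - inner ℝ V (y - z)| + |(inner ℝ V (y - z) : ℝ)| := by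
      have := abs_add_le (η y - inner ℝ V (y - z)) (inner ℝ V (y - z))
      rwa [sub_add_cancel] at this
    have h4 := le_abs_self (σ * η y)
    rw [abs_mul, hσ1, one_mul] at h4
    have h5 : c / 2 * ‖y - z‖ ≤ 1 * ‖y - z‖ := by gcongr; linarith
    linarith
  -- the rule segment through `y`, oriented towards the crease
  obtain ⟨p, q, hpq, hypq, hneg⟩ : ∃ p q, (p, q) ∈ P.rules ∧ y ∈ openSegment ℝ p q ∧
      σ * inner ℝ V (q - p) ≤ -(c * ‖q - p‖) := by
    obtain ⟨p, q, hpq, hypq⟩ := P.rule_cover y (hB.openSide_subset hyo)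
    have h1 := htr y (Metric.ball_subset_ball (min_le_left _ _) hy) hyo p q hpq hypq
    rw [← one_mul |_|, ← hσ1, ← abs_mul, real_inner_comm] at h1
    rcases le_or_gt 0 (σ * inner ℝ V (q - p)) with h2 | h2
    · refine ⟨q, p, P.rule_symm p q hpq, by rwa [openSegment_symm], ?_⟩
      rw [abs_of_nonneg h2] at h1
      rw [← neg_sub q p, inner_neg_right, norm_neg]
      linarith
    · refine ⟨p, q, hpq, hypq, ?_⟩
      rw [abs_of_neg h2] at h1
      linarith
  set d := q - p with hd
  have hd0 : 0 < ‖d‖ := norm_pos_iff.2 (sub_ne_zero.2 (P.rule_ne p q hpq).symm)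
  obtain ⟨θ, hθ, hyθ⟩ : ∃ θ ∈ Ioo (0 : ℝ) 1, p + θ • d = y := by
    rw [openSegment_eq_image'] at hypq; exact hypq
  set k : ℝ → Plane := fun l => y + l • d with hk
  have hkc : Continuous k := by fun_prop
  have hkseg : ∀ l, 0 ≤ l → l < 1 - θ → k l ∈ openSegment ℝ p q := by
    intro l hl0 hl1
    rw [openSegment_eq_image']
    refine ⟨θ + l, ⟨by linarith [hθ.1], by linarith⟩, ?_⟩
    simp only [hk, ← hyθ, add_smul, hd, add_assoc]
  have hkq : k (1 - θ) = q := by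
    simp only [hk, ← hyθ, hd]; module
  -- after the time `L`, the line of the rule segment has crossed the crease: `σ * η` decreases at
  -- least at the rate `c / 2 * ‖d‖`
  set L := 2 * (σ * η y) / (c * ‖d‖) with hL
  have hL0 : 0 < L := div_pos (by linarith [hyo.2]) (by positivity)
  have hLd : L * ‖d‖ = 2 * (σ * η y) / c := by rw [hL]; field_simp
  have hin : ∀ l ∈ Icc 0 L, k l ∈ Metric.ball z r := by
    intro l hl
    rw [mem_ball_iff_norm]
    have h1 : k l - z = (y - z) + l • d := by simp only [hk]; abel
    have h2 : l * ‖d‖ ≤ 2 * (2 * ‖y - z‖) / c :=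
      (mul_le_mul_of_nonneg_right hl.2 hd0.le).trans (by rw [hLd]; gcongr)
    have h3 : 2 * (2 * ‖y - z‖) / c ≤ r / 2 := by
      rw [div_le_iff₀ hc0]; linarith
    calc ‖k l - z‖ ≤ ‖y - z‖ + ‖l • d‖ := by rw [h1]; exact norm_add_le _ _
      _ = ‖y - z‖ + l * ‖d‖ := by rw [norm_smul, Real.norm_eq_abs, abs_of_nonneg hl.1]
      _ < r := by linarith
  have hηL : σ * η (k L) ≤ 0 := by
    have h1 := hlin' (k L) (hin L ⟨hL0.le, le_rfl⟩) y hyr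
    have h2 : k L - y = L • d := by simp [hk]
    rw [h2, inner_smul_right, norm_smul, Real.norm_eq_abs, abs_of_pos hL0] at h1
    have h3 : |σ * (η (k L) - η y - L * inner ℝ V d)| ≤ c / 2 * (L * ‖d‖) := by
      rwa [abs_mul, hσ1, one_mul]
    have h4 := (abs_le.1 h3).2
    have h5 : L * (σ * inner ℝ V d) ≤ L * -(c * ‖d‖) := mul_le_mul_of_nonneg_left hneg hL0.le
    have h6 : c * (L * ‖d‖) = 2 * (σ * η y) := by rw [hLd]; field_simp
    linarith
  -- the crease cannot be crossed before the rule segment ends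
  have hcross : ∀ l ∈ Icc 0 L, σ * η (k l) ≤ 0 → 1 - θ ≤ l := by
    intro l hl hle
    have h1 : ContinuousOn (fun l => σ * η (k l)) (Icc 0 l) :=
      continuousOn_const.mul (hB.continuousOn_dist.comp hkc.continuousOn fun l' hl' =>
        (hrU (hin l' ⟨hl'.1, hl'.2.trans hl.2⟩)).1)
    have h2 : (0 : ℝ) ∈ Icc (σ * η (k l)) (σ * η (k 0)) := by
      refine ⟨hle, ?_⟩
      simp only [hk, zero_smul, add_zero]
      exact hyo.2.le
    obtain ⟨l', hl', h3⟩ := intermediate_value_Icc' hl.1 h1 h2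
    by_contra hcon
    push Not at hcon
    have h4 : k l' ∈ P.uncreased :=
      P.rule_subset p q hpq (hkseg l' hl'.1 (hl'.2.trans_lt hcon))
    have h5 : η (k l') = 0 := by
      rcases mul_eq_zero.1 h3 with h6 | h6
      · rw [h6] at hσ; norm_num at hσ
      · exact h6
    have h6 := (hrU (hin l' ⟨hl'.1, hl'.2.trans hl.2⟩)).1
    apply h4.2
    rw [hB.eq_crease h6 h5]
    exact mem_iUnion.2 ⟨i, mem_image_of_mem _ (Ioo_subset_Icc_self
      (hB.mem_Ioo _ (hB.mapsTo _ h6).1))⟩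
  have hθL : 1 - θ ≤ L := hcross L ⟨hL0.le, le_rfl⟩ hηL
  have hqU : q ∈ U ∩ W := by
    rw [← hkq]; exact hrU (hin _ ⟨by linarith [hθ.2], hθL⟩)
  have hq0 : η q = 0 := by
    by_contra h0
    exact P.rule_end q p (P.rule_symm p q hpq) (hB.mem_uncreased q hqU.1 h0)
  have hqK : q ∈ closedSide U η σ := ⟨hqU.1, by rw [hq0, mul_zero]⟩
  have hqcl : q ∈ closure (openSide U η σ ∩ openSegment ℝ p q) := by
    have h1 : Tendsto k (𝓝[<] (1 - θ)) (𝓝 q) := by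
      rw [← hkq]; exact (hkc.tendsto _).mono_left nhdsWithin_le_nhds
    refine mem_closure_of_tendsto h1 ?_
    filter_upwards [Ioo_mem_nhdsLT (show (0 : ℝ) < 1 - θ by linarith [hθ.2])] with l hl
    have hlL : l ∈ Icc 0 L := ⟨hl.1.le, hl.2.le.trans hθL⟩
    refine ⟨⟨(hrU (hin l hlL)).1, ?_⟩, hkseg l hl.1.le hl.2⟩
    by_contra hcon
    push Not at hcon
    linarith [hcross l hlL hcon, hl.2]
  have hconst : ∀ x ∈ openSide U η σ ∩ openSegment ℝ p q,
      E x = E y ∧ f x - E x (emb x) = f y - E y (emb y) := by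
    intro x hx
    rw [h.eq_frame x hx.1, h.eq_frame y hyo]
    exact hf.frame_eq_of_rule hpq hx.2 hypq
  have hsub : openSide U η σ ∩ openSegment ℝ p q ⊆ closedSide U η σ :=
    inter_subset_left.trans openSide_subset_closedSide
  have e1 : E q = E y := by
    have := ((h.isFramed.continuousOn_frame q hqK).mono hsub).mem_closure hqcl
      (t := {E y}) fun x hx => (hconst x hx).1
    rwa [closure_singleton] at this
  have e2 : f q - E q (emb q) = f y - E y (emb y) := by
    have := ((h.isFramed.deriv_trans hqK).continuousWithinAt.mono hsub).mem_closure hqcl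
      (t := {f y - E y (emb y)}) fun x hx => (hconst x hx).2
    rwa [closure_singleton] at this
  have hqS := hB.eq_crease hqU.1 hq0
  refine ⟨S q, (hB.mapsTo q hqU.1).1, ?_, ?_, ?_, fun h0 => absurd h0 hη⟩
  · rw [← hqS]; exact hqU.2
  · rw [← hqS, e1]
  · rw [← hqS, e2]

/-- The parameter of the crease point to which the rule segment through a point leads. Its
dependence on the point is Lipschitz since it can be read off from the surface normal. -/
lemma exists_footMap [Finite ι] (h : IsSideFrame f U η σ E E')
    (hB : IsFermiBox P i s₀ a U S η) (hσ : σ ^ 2 = 1) (hf : P.IsFolding f)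
    (hκ : secondForm (E (P.crease i s₀)) (E' (P.crease i s₀)) (P.tangent i s₀) (P.tangent i s₀) ≠ 0)
    {δ : ℝ} (hδ : 0 < δ) :
    ∃ W ∈ 𝓝 (P.crease i s₀), ∃ t : Plane → ℝ, ∀ y ∈ closedSide U η σ ∩ W,
      t y ∈ Ioo (s₀ - a) (s₀ + a) ∩ Ioo (s₀ - δ) (s₀ + δ) ∧ E y = E (P.crease i (t y)) ∧
      f y - E y (emb y) =
        f (P.crease i (t y)) - E (P.crease i (t y)) (emb (P.crease i (t y))) ∧
      (η y = 0 → t y = S y) ∧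
      (fun y' => t y' - t y) =O[𝓝[closedSide U η σ ∩ W] y] (fun y' => y' - y) := by
  set z := P.crease i s₀ with hz
  obtain ⟨hzU, hzS, hz0⟩ : z ∈ U ∧ S z = s₀ ∧ η z = 0 := hB.crease_mem hB.self_mem
  set T := P.tangent i s₀
  set w := E z (emb T) with hw
  have hact : ∀ D : Op, ∀ v, Op.act.flip v D = D v := fun D v => rfl
  -- the component of the surface normal in the direction of the folded crease
  let τ : ℝ → ℝ := fun s => inner ℝ w (E (P.crease i s) e3)
  let τ' : ℝ → ℝ := fun s => inner ℝ w (E' (P.crease i s) (P.tangent i s) e3)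
  have hτd : ∀ s ∈ Ioo (s₀ - a) (s₀ + a), HasDerivAt τ (τ' s) s := by
    intro s hs
    have h1 := (Op.act.flip e3).hasFDerivAt.comp_hasDerivAt s (h.hasDerivAt_crease hB hs)
    have h2 := (innerSL ℝ w).hasFDerivAt.comp_hasDerivAt s h1
    exact h2
  have hτc : ContinuousAt τ' s₀ := by
    have hT : ContinuousOn (P.tangent i) (Ioo (s₀ - a) (s₀ + a)) := fun s hs =>
      (hasStrictDerivAt_tangent (hB.mem_Ioo _ hs)).hasDerivAt.continuousAt.continuousWithinAt
    have h1 := h.isFramed.continuousOn_deriv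
      (fun _ hr => (hasStrictDerivAt_crease (hB.mem_Ioo _ hr)).hasDerivAt)
      (fun _ hr => hB.crease_mem_closedSide hr) hT
    have h2 := h1.continuousAt (isOpen_Ioo.mem_nhds hB.self_mem)
    have h3 : ContinuousAt (fun s => Op.act (E' (P.crease i s) (P.tangent i s)) e3) s₀ :=
      ((Op.act.flip e3).continuous.continuousAt).comp h2
    exact ((innerSL ℝ w).continuous.continuousAt).comp h3
  have hτ0 : τ' s₀ ≠ 0 := by
    have hrot := h.isRot_crease hB hB.self_mem
    have hform := h.isBendingForm z (hB.crease_mem_closedSide hB.self_mem)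
    have h1 : τ' s₀ = -secondForm (E z) (E' z) T T := by
      have h2 : τ' s₀ = inner ℝ (emb T) ((star (E z) * E' z T) e3) := by
        rw [Op.mul_apply, Op.inner_star]
      have h3 := Op.inner_star (star (E z) * E' z T) (emb T) e3
      rw [h2, ← neg_neg (star (E z) * E' z T), ← hform.skew]
      have h4 : ∀ D : Op, (-D) e3 = -(D e3) := fun D => by simp
      rw [h4, inner_neg_right, Op.inner_star, Op.mul_apply, real_inner_comm, Op.inner_star,
        real_inner_comm, secondForm]
    rw [h1]
    exact neg_ne_zero.2 hκ
  have hst : HasStrictDerivAt τ (τ' s₀) s₀ :=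
    hasStrictDerivAt_of_hasDerivAt_of_continuousAt
      (Filter.eventually_of_mem (isOpen_Ioo.mem_nhds hB.self_mem) hτd) hτc
  have hm0 : 0 < |τ' s₀| := abs_pos.2 hτ0
  have hanti := (hasStrictFDerivAt_iff_isLittleO.1 hst.hasStrictFDerivAt).def (half_pos hm0)
  obtain ⟨r, hr, hanti⟩ := Metric.eventually_nhds_iff_ball.1 hanti
  have hanti' : ∀ s ∈ Ioo (s₀ - r) (s₀ + r), ∀ s' ∈ Ioo (s₀ - r) (s₀ + r),
      |s' - s| ≤ 2 / |τ' s₀| * |τ s' - τ s| := by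
    intro s hs s' hs'
    have h1 := hanti (s', s) (by
      rw [Metric.mem_ball, Prod.dist_eq, max_lt_iff, Real.dist_eq, Real.dist_eq, abs_lt, abs_lt]
      exact ⟨⟨by linarith [hs'.1], by linarith [hs'.2]⟩, by linarith [hs.1], by linarith [hs.2]⟩)
    simp only [ContinuousLinearMap.toSpanSingleton_apply, smul_eq_mul, Real.norm_eq_abs] at h1
    have h2 := abs_sub (τ s' - τ s) (τ s' - τ s - (s' - s) * τ' s₀)
    rw [sub_sub_cancel, abs_mul] at h2
    rw [div_mul_eq_mul_div, le_div_iff₀ hm0]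
    linarith
  have hSW : S ⁻¹' (Ioo (s₀ - min δ r) (s₀ + min δ r)) ∈ 𝓝 z := by
    refine (hB.continuousOn_param.continuousAt (hB.isOpen.mem_nhds hzU)).preimage_mem_nhds ?_
    rw [hzS]
    have : 0 < min δ r := lt_min hδ hr
    exact Ioo_mem_nhds (by linarith) (by linarith)
  have hfoot := h.exists_foot hB hσ hf hκ hSW
  obtain ⟨W, hW, hfoot⟩ := hfoot.exists_mem
  have hfoot' : ∀ y ∈ closedSide U η σ ∩ W, ∃ s ∈ Ioo (s₀ - a) (s₀ + a),
      P.crease i s ∈ S ⁻¹' (Ioo (s₀ - min δ r) (s₀ + min δ r)) ∧ E y = E (P.crease i s) ∧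
      f y - E y (emb y) = f (P.crease i s) - E (P.crease i s) (emb (P.crease i s)) ∧
      (η y = 0 → s = S y) := fun y hy => hfoot y hy.2 hy.1
  choose! t ht htS htE htp ht0 using hfoot'
  have htJ : ∀ y ∈ closedSide U η σ ∩ W, t y ∈ Ioo (s₀ - min δ r) (s₀ + min δ r) := by
    intro y hy
    have h1 := htS y hy
    rwa [mem_preimage, (hB.crease_mem (ht y hy)).2.1] at h1
  have hδr : min δ r ≤ δ := min_le_left _ _
  have hrr : min δ r ≤ r := min_le_right _ _
  have htr : ∀ y ∈ closedSide U η σ ∩ W, t y ∈ Ioo (s₀ - r) (s₀ + r) := fun y hy =>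
    Ioo_subset_Ioo (by linarith) (by linarith) (htJ y hy)
  refine ⟨W, hW, t, fun y hy => ⟨⟨ht y hy, Ioo_subset_Ioo (by linarith) (by linarith) (htJ y hy)⟩,
    htE y hy, htp y hy, ht0 y hy, ?_⟩⟩
  have hd : HasFDerivWithinAt (fun y => (inner ℝ w (E y e3) : ℝ))
      ((innerSL ℝ w).comp ((Op.act.flip e3).comp (E' y))) (closedSide U η σ ∩ W) y :=
    (innerSL ℝ w).hasFDerivAt.comp_hasFDerivWithinAt y
      ((Op.act.flip e3).hasFDerivAt.comp_hasFDerivWithinAt y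
        ((h.isFramed.deriv_frame y hy.1).mono inter_subset_left))
  refine Asymptotics.IsBigO.trans (Asymptotics.IsBigO.of_bound (2 / |τ' s₀|) ?_) hd.isBigO_sub
  filter_upwards [self_mem_nhdsWithin] with y' hy'
  rw [Real.norm_eq_abs, Real.norm_eq_abs]
  have h1 := hanti' _ (htr y hy) _ (htr y' hy')
  simp only [τ] at h1
  rwa [← htE y hy, ← htE y' hy'] at h1

end IsSideFrame

end

/-! ### Carrying a bending across a crease -/

section

open CreaseRulePattern

variable {ι : Type*} {P : CreaseRulePattern ι} {f : Plane → Space} {i : ι} {s₀ : ℝ}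

lemma twist_zero : twist 0 = 1 := by
  apply op_ext <;> apply space_ext <;> simp [twist]

lemma IsFermiBox.dist_ne_zero {a : ℝ} {U : Set Plane} {S η : Plane → ℝ}
    (h : IsFermiBox P i s₀ a U S η) {y : Plane} (hy : y ∈ U) (hyu : y ∈ P.uncreased) : η y ≠ 0 := by
  intro h0
  apply hyu.2
  rw [h.eq_crease hy h0]
  exact mem_iUnion.2 ⟨i, mem_image_of_mem _ (Ioo_subset_Icc_self
    (h.mem_Ioo _ (h.mapsTo _ hy).1))⟩

/-- The only crease in a Fermi box is the one on which it is based. -/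
lemma IsFermiBox.crease_eq {a : ℝ} {U : Set Plane} {S η : Plane → ℝ}
    (h : IsFermiBox P i s₀ a U S η) {j : ι} {s : ℝ} (hs : s ∈ Ioo 0 (P.len j))
    (hU : P.crease j s ∈ U) : j = i ∧ s ∈ Ioo (s₀ - a) (s₀ + a) := by
  have h0 : η (P.crease j s) = 0 := by
    by_contra h0
    exact (h.mem_uncreased _ hU h0).2
      (mem_iUnion.2 ⟨j, mem_image_of_mem _ (Ioo_subset_Icc_self hs)⟩)
  have h1 := (h.mapsTo _ hU).1
  obtain ⟨h2, h3⟩ := P.crease_embedded j i s hs _ (Ioo_subset_Icc_self (h.mem_Ioo _ h1))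
    (h.eq_crease hU h0)
  rw [← h3] at h1
  exact ⟨h2, h1⟩

namespace IsCreaseChart

variable {a : ℝ} {U : Set Plane} {S η : Plane → ℝ} {EL ER : Plane → Op}
  {EL' ER' : Plane → Plane →L[ℝ] Op}

/-- The two sides of a folded crease belong to different faces. -/
lemma closure_component_subset [Finite ι] (h : IsCreaseChart P f i s₀ a U S η EL ER EL' ER')
    (hf : P.IsFolding f) {ρ : ℝ} (hρ : ρ ∈ Ioo (-Real.pi) Real.pi) (hρ0 : ρ ≠ 0)
    (hfold : P.HasFoldAngle f i s₀ ρ) {x : Plane} (hx : x ∈ P.uncreased) :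
    U ∩ closure (connectedComponentIn P.uncreased x) ⊆ closedSide U η 1 ∨
      U ∩ closure (connectedComponentIn P.uncreased x) ⊆ closedSide U η (-1) := by
  set C := connectedComponentIn P.uncreased x with hC
  have hB := h.box
  have hside : ∀ σ, (C ∩ openSide U η σ).Nonempty → openSide U η σ ⊆ C := by
    rintro σ ⟨y, hyC, hyo⟩
    rw [hC, connectedComponentIn_eq hyC]
    exact hB.isPreconnected_openSide.subset_connectedComponentIn hyo hB.openSide_subset
  have hdisj : ∀ σ, ¬ (C ∩ openSide U η σ).Nonempty → U ∩ closure C ⊆ closedSide U η (-σ) := by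
    intro σ hne y hy
    refine ⟨hy.1, ?_⟩
    by_contra hcon
    have hyo : y ∈ openSide U η σ := ⟨hy.1, by linarith⟩
    apply hne
    rw [inter_comm]
    exact mem_closure_iff.1 hy.2 _ hB.isOpen_openSide hyo
  by_cases h1 : (C ∩ openSide U η 1).Nonempty
  swap
  · right; exact hdisj 1 h1
  by_cases h2 : (C ∩ openSide U η (-1)).Nonempty
  swap
  · left; simpa using hdisj (-1) h2
  exfalso
  -- otherwise the surface would be smooth across the crease
  set z := P.crease i s₀
  have hz := hB.crease_mem hB.self_mem
  have hUC : U ⊆ P.paper ∩ closure C := by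
    intro y hy
    refine ⟨hB.subset_paper hy, ?_⟩
    rcases le_total 0 (η y) with h3 | h3
    · exact closure_mono (hside 1 h1) (hB.closedSide_subset_closure (by norm_num) ⟨hy, by linarith⟩)
    · exact closure_mono (hside (-1) h2)
        (hB.closedSide_subset_closure (by norm_num) ⟨hy, by linarith⟩)
  have hsm : ContDiffAt ℝ 2 f z :=
    ((hf.contDiffOn_face x hx).mono hUC).contDiffAt (hB.isOpen.mem_nhds hz.1)
  have hfr : ContinuousAt (frame f) z :=
    ((contDiff_frameOf (n := 1)).contDiffAt.comp z (hsm.fderiv_right (by norm_num))).continuousAt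
  have hlim : ∀ σ : ℝ, σ ^ 2 = 1 →
      Tendsto (fun ε : ℝ => frame f (P.fermi i (s₀, σ * ε))) (𝓝[>] 0) (𝓝 (frame f z)) :=
    fun σ hσ => hfr.tendsto.comp
      ((hB.tendsto_fermi hB.self_mem hσ).mono_right nhdsWithin_le_nhds)
  have e1 := tendsto_nhds_unique (h.left.tendsto_frame hB (by norm_num) hB.self_mem)
    (hlim 1 (by norm_num))
  have e2 := tendsto_nhds_unique (h.right.tendsto_frame hB (by norm_num) hB.self_mem)
    (hlim (-1) (by norm_num))
  have htw := h.mul_darboux_eq hB.self_mem hfold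
  rw [e1, ← e2] at htw
  have hD := (h.right.isRot_crease hB hB.self_mem).mul (isRot_darboux (norm_tangent hB.base_mem))
  have h3 := congrArg (fun A => star (ER (P.crease i s₀) * darboux (P.tangent i s₀)) * A) htw
  rw [hD.1, ← mul_assoc, hD.1, one_mul, ← twist_zero] at h3
  exact hρ0 (twist_injOn ⟨by linarith [Real.pi_pos], Real.pi_pos⟩ hρ h3).symm

end IsCreaseChart

lemma smul_bend (u κ τ : ℝ) : u • bend κ τ = bend (u * κ) (u * τ) := by
  apply op_ext <;> apply space_ext <;> simp [bend]

lemma star_spin : star spin = -spin := by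
  apply Op.ext
  intro v
  refine ext_inner_left ℝ fun w => ?_
  rw [Op.inner_star, inner3, inner3]
  simp [spin]
  ring

/-- Bending of one side of a crease, with all normal curvatures and torsions scaled by `u`, goes
along with bending of the other side, with the same scaling: the frames differ by the rotation
about the tangent by the angle `ρ` with `tan (ρ / 2) = u * m`. -/
lemma IsBending.across {e e' eR eR' : ℝ → Op} {p p' : ℝ → Space} {J : Set ℝ} {A : Op} {b : Space}
    {eu : ℝ → ℝ → Op} {pu : ℝ → ℝ → Space} (h : IsBending e e' p p' J A b eu pu)
    (hJ : ∀ s ∈ J, s ∈ Ioo 0 (P.len i)) {m : ℝ} {κ τ : ℝ → ℝ}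
    (hp : ∀ s ∈ J, p s = f (P.crease i s) - e s (emb (P.crease i s)))
    (hp' : ∀ s ∈ J, p' s = -e' s (emb (P.crease i s)))
    (he : ∀ s ∈ J, star (darboux (P.tangent i s)) * (star (e s) * e' s) * darboux (P.tangent i s) =
      bend (κ s) (τ s))
    (heR : ∀ s ∈ J, star (darboux (P.tangent i s)) * (star (eR s) * eR' s) *
      darboux (P.tangent i s) = bend (-κ s) (τ s))
    (hκ : ∀ s ∈ J, κ s = -P.curvature i s * m)
    (htw : ∀ s ∈ J, e s * darboux (P.tangent i s) =
      eR s * darboux (P.tangent i s) * twist (2 * Real.arctan m)) :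
    ∃ (euR : ℝ → ℝ → Op) (puR : ℝ → ℝ → Space),
      IsBending eR eR' (fun s => f (P.crease i s) - eR s (emb (P.crease i s)))
        (fun s => -eR' s (emb (P.crease i s))) J A b euR puR ∧
      (∀ u, ∀ s ∈ J, eu u s * darboux (P.tangent i s) =
        euR u s * darboux (P.tangent i s) * twist (2 * Real.arctan (u * m))) ∧
      ∀ u s, puR u s + euR u s (emb (P.crease i s)) = pu u s + eu u s (emb (P.crease i s)) := by
  set M : ℝ → Op := fun s => darboux (P.tangent i s) with hM
  set tw : ℝ → Op := fun u => twist (2 * Real.arctan (u * m)) with htwu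
  have hMr : ∀ s ∈ J, IsRot (M s) := fun s hs => isRot_darboux (norm_tangent (hJ s hs))
  have htwr : ∀ u, IsRot (tw u) := fun u => isRot_twist _
  have hMc : ContinuousOn M J := fun s hs =>
    (CurvedCrease.hasDerivAt_darboux (hJ s hs)).continuousAt.continuousWithinAt
  have hxd : ∀ s ∈ J, HasDerivAt (fun s => emb (P.crease i s)) (emb (P.tangent i s)) s :=
    fun s hs => emb.hasFDerivAt.comp_hasDerivAt s (hasStrictDerivAt_crease (hJ s hs)).hasDerivAt
  have hxc : ContinuousOn (fun s => emb (P.crease i s)) J := fun s hs =>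
    (hxd s hs).continuousAt.continuousWithinAt
  let euR : ℝ → ℝ → Op := fun u s => eu u s * M s * star (tw u) * star (M s)
  let puR : ℝ → ℝ → Space := fun u s =>
    pu u s + eu u s (emb (P.crease i s)) - euR u s (emb (P.crease i s))
  have hrel : ∀ u, ∀ s ∈ J, euR u s * M s = eu u s * M s * star (tw u) := by
    intro u s hs
    simp only [euR]
    rw [mul_assoc _ (star (M s)), (hMr s hs).1, mul_one]
  -- derivative of the frames of the other side
  have hd : ∀ u ∈ Icc (0 : ℝ) 1, ∀ s ∈ J,
      HasDerivAt (euR u) (u • (euR u s * star (eR s) * eR' s)) s := by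
    intro u hu s hs
    have dM := CurvedCrease.hasDerivAt_darboux (hJ s hs)
    have h1 := ((((h.deriv_rot u hu s hs).mul dM).mul_const (star (tw u))).mul dM.star)
    refine h1.congr_deriv ?_
    have hMs := hMr s hs
    have h2 : eu u s * star (e s) * e' s * M s = eu u s * M s * bend (κ s) (τ s) := by
      rw [← he s hs]
      calc eu u s * star (e s) * e' s * M s
          = eu u s * (1 : Op) * (star (e s) * e' s) * M s := by simp only [mul_assoc, one_mul]
        _ = _ := by rw [← hMs.mul_star]; simp only [mul_assoc, hM]
    have h3 : euR u s * star (eR s) * eR' s =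
        eu u s * M s * star (tw u) * bend (-κ s) (τ s) * star (M s) := by
      rw [← heR s hs, ← hrel u s hs]
      calc euR u s * star (eR s) * eR' s
          = euR u s * (1 : Op) * (star (eR s) * eR' s) * (1 : Op) := by
            simp only [mul_assoc, mul_one]
        _ = _ := by rw [← hMs.mul_star]; simp only [mul_assoc, hM]
    have h4 : (bend (u * κ s) (u * τ s) + P.curvature i s • spin) * star (tw u) =
        star (tw u) * (bend (-(u * κ s)) (u * τ s) + P.curvature i s • spin) := by
      have htc := twist_cond (u * m) (P.curvature i s)
      have hk : -P.curvature i s * (u * m) = u * κ s := by rw [hκ s hs]; ring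
      rw [hk] at htc
      have h5 := twist_mul_bend (τ := u * τ s) htc.1 htc.2
      have h6 := congrArg (fun A => star (tw u) * A * star (tw u)) h5
      simp only [htwu] at h6 ⊢
      rw [← mul_assoc, (isRot_twist _).1, one_mul] at h6
      rw [h6, ← mul_assoc, mul_assoc, (isRot_twist _).mul_star, mul_one]
    have h7 : u • (eu u s * star (e s) * e' s) * M s + eu u s * (M s * (P.curvature i s • spin)) =
        eu u s * M s * (bend (u * κ s) (u * τ s) + P.curvature i s • spin) := by
      rw [smul_mul_assoc, h2, ← smul_bend]
      simp only [mul_smul_comm, mul_add, mul_assoc]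
    rw [h3]
    simp only [Pi.mul_apply]
    rw [h7, mul_assoc (eu u s * M s), h4, star_mul, star_smul, star_spin]
    have h8 : bend (-(u * κ s)) (u * τ s) = u • bend (-κ s) (τ s) := by rw [smul_bend]; ring_nf
    rw [h8]
    simp only [mul_add, add_mul, mul_assoc, smul_mul_assoc, mul_smul_comm, mul_neg, neg_mul,
      smul_neg, star_trivial, hM]
    abel
  have hcr : ContinuousOn (fun q : ℝ × ℝ => euR q.1 q.2) (Icc 0 1 ×ˢ J) := by
    have hM2 : ContinuousOn (fun q : ℝ × ℝ => M q.2) (Icc 0 1 ×ˢ J) :=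
      hMc.comp continuousOn_snd fun q hq => hq.2
    have htc : Continuous fun q : ℝ × ℝ => tw q.1 := by
      have h1 : Continuous twist := by
        have : twist = fun ρ => Real.cos ρ • cols 0 (emb p2) e3 + Real.sin ρ • cols 0 e3 (-emb p2) +
            cols (emb p1) 0 0 := by
          funext ρ
          apply op_ext <;> apply space_ext <;> simp [twist]
        rw [this]; fun_prop
      exact h1.comp (continuous_const.mul
        (Real.continuous_arctan.comp (continuous_fst.mul continuous_const)))
    exact ((h.continuousOn_rot.mul hM2).mul (continuous_star.comp htc).continuousOn).mul
      (continuous_star.comp_continuousOn hM2)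
  have hxc2 : ContinuousOn (fun q : ℝ × ℝ => emb (P.crease i q.2)) (Icc 0 1 ×ˢ J) :=
    hxc.comp continuousOn_snd fun q hq => hq.2
  have hzero : ∀ s ∈ J, euR 0 s = A := by
    intro s hs
    simp only [euR, htwu]
    rw [zero_mul, Real.arctan_zero, mul_zero, twist_zero, star_one, mul_one, mul_assoc,
      (hMr s hs).mul_star, mul_one, (h.zero s hs).1]
  have hone : ∀ s ∈ J, euR 1 s = eR s := by
    intro s hs
    simp only [euR, htwu]
    rw [(h.one s hs).1, one_mul, htw s hs, mul_assoc _ (twist _), (isRot_twist _).mul_star, mul_one,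
      mul_assoc, (hMr s hs).mul_star, mul_one]
  refine ⟨euR, puR, ⟨hcr, ?_, ?_, hd, ?_, ?_, ?_⟩, ?_, ?_⟩
  · refine (h.continuousOn_trans.add ?_).sub ?_
    · exact (Op.act.continuous.comp_continuousOn h.continuousOn_rot).clm_apply hxc2
    · exact (Op.act.continuous.comp_continuousOn hcr).clm_apply hxc2
  · exact fun u hu s hs =>
      (((h.isRot u hu s hs).mul (hMr s hs)).mul (htwr u).star).mul (hMr s hs).star
  · intro u hu s hs
    have d1 : HasDerivAt (fun s => Op.act (eu u s) (emb (P.crease i s)))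
        (Op.act (u • (eu u s * star (e s) * e' s)) (emb (P.crease i s)) +
          eu u s (emb (P.tangent i s))) s :=
      (Op.act.hasFDerivAt.comp_hasDerivAt s (h.deriv_rot u hu s hs)).clm_apply (hxd s hs)
    have d2 : HasDerivAt (fun s => Op.act (euR u s) (emb (P.crease i s)))
        (Op.act (u • (euR u s * star (eR s) * eR' s)) (emb (P.crease i s)) +
          euR u s (emb (P.tangent i s))) s :=
      (Op.act.hasFDerivAt.comp_hasDerivAt s (hd u hu s hs)).clm_apply (hxd s hs)
    refine (((h.deriv_trans u hu s hs).add d1).sub d2).congr_deriv ?_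
    have h1 : euR u s (emb (P.tangent i s)) = eu u s (emb (P.tangent i s)) := by
      have h2 : M s (emb p1) = emb (P.tangent i s) := darboux_p1 _
      have h3 : star (tw u) (emb p1) = emb p1 := by
        have := (htwr u).star_apply_self (emb p1)
        simp only [htwu] at this ⊢
        rwa [twist_p1] at this
      rw [← h2, ← Op.mul_apply, hrel u s hs, Op.mul_apply, Op.mul_apply, h3]
    rw [h1, hp' s hs]
    simp
  · exact fun s hs => ⟨hone s hs, by
      simp only [puR]; rw [hone s hs, (h.one s hs).1, (h.one s hs).2, hp s hs]; abel⟩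
  · exact fun s hs => ⟨hzero s hs, by
      simp only [puR]; rw [hzero s hs, (h.zero s hs).1, (h.zero s hs).2]; abel⟩
  · intro u s hs
    have := hrel u s hs
    simp only [hM, htwu] at this
    rw [this, mul_assoc _ (star _), (isRot_twist _).1, mul_one]
  · intro u s
    simp [puR]

end

/-! ### Developments near crease points -/

section

open CreaseRulePattern

variable {ι : Type*} {P : CreaseRulePattern ι} {f : Plane → Space} {i : ι} {s₀ : ℝ}

/-- The bent surface on one side of a crease. -/
lemma IsSideFrame.isFramed_bending [Finite ι] {a : ℝ} {U : Set Plane} {S η : Plane → ℝ} {σ : ℝ}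
    {E : Plane → Op} {E' : Plane → Plane →L[ℝ] Op}
    (h : IsSideFrame f U η σ E E') (hB : IsFermiBox P i s₀ a U S η) (hσ : σ ^ 2 = 1)
    (hf : P.IsFolding f)
    (hκ : secondForm (E (P.crease i s₀)) (E' (P.crease i s₀)) (P.tangent i s₀) (P.tangent i s₀) ≠ 0)
    {δ : ℝ} (hδ : δ ∈ Ioo 0 a) {A : Op} {b : Space} {eu : ℝ → ℝ → Op} {pu : ℝ → ℝ → Space}
    (hb : IsBending (fun s => E (P.crease i s)) (fun s => E' (P.crease i s) (P.tangent i s))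
      (fun s => f (P.crease i s) - E (P.crease i s) (emb (P.crease i s)))
      (fun s => -(E' (P.crease i s) (P.tangent i s)) (emb (P.crease i s)))
      (Ioo (s₀ - δ) (s₀ + δ)) A b eu pu) :
    ∃ W ∈ 𝓝 (P.crease i s₀), ∃ t : Plane → ℝ,
      MapsTo t (closedSide U η σ ∩ W) (Ioo (s₀ - δ) (s₀ + δ)) ∧
      (∀ y ∈ closedSide U η σ ∩ W, E y = E (P.crease i (t y)) ∧ f y - E y (emb y) =
        f (P.crease i (t y)) - E (P.crease i (t y)) (emb (P.crease i (t y)))) ∧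
      (∀ y ∈ closedSide U η σ ∩ W, η y = 0 → t y = S y) ∧
      ContinuousOn t (closedSide U η σ ∩ W) ∧
      ∀ u ∈ Icc (0 : ℝ) 1, IsFramed (fun y => pu u (t y) + eu u (t y) (emb y))
        (closedSide U η σ ∩ W) (fun y => eu u (t y))
        (fun y => u • (mulL (eu u (t y) * star (E y))).comp (E' y)) := by
  obtain ⟨W, hW, t, ht⟩ := h.exists_footMap hB hσ hf hκ hδ.1
  have hJ : ∀ s ∈ Ioo (s₀ - δ) (s₀ + δ), s ∈ Ioo (s₀ - a) (s₀ + a) := fun s hs =>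
    ⟨by linarith [hs.1, hδ.2], by linarith [hs.2, hδ.2]⟩
  have hc : ∀ r ∈ Ioo (s₀ - a) (s₀ + a), HasDerivAt (P.crease i) (P.tangent i r) r :=
    fun _ hr => (hasStrictDerivAt_crease (hB.mem_Ioo _ hr)).hasDerivAt
  refine ⟨W, hW, t, fun y hy => (ht y hy).1.2, fun y hy => ⟨(ht y hy).2.1, (ht y hy).2.2.1⟩,
    fun y hy => (ht y hy).2.2.2.1, fun y hy => ?_, fun u hu => ?_⟩
  · have h1 : Tendsto (fun y' => t y' - t y) (𝓝[closedSide U η σ ∩ W] y) (𝓝 0) := by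
      refine (ht y hy).2.2.2.2.trans_tendsto ?_
      have : Tendsto (fun y' : Plane => y' - y) (𝓝 y) (𝓝 (y - y)) :=
        (continuous_id.sub continuous_const).tendsto y
      rw [sub_self] at this
      exact this.mono_left nhdsWithin_le_nhds
    have h2 := h1.add_const (t y)
    simpa [ContinuousWithinAt] using h2
  · exact hb.isFramed (h.isFramed.mono inter_subset_left) (fun y hy => (ht y hy).1.2)
      (fun y hy => (ht y hy).2.2.2.2) (fun s hs => h.hasDerivAt_crease hB (hJ s hs))
      (fun s hs => h.isFramed.hasDerivAt_trans isOpen_Ioo hc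
        (fun _ hr => hB.crease_mem_closedSide hr) (hJ s hs))
      (fun y hy => (ht y hy).2.1) (fun y hy => (ht y hy).2.2.1) hu

/-- A function given by two formulas, on the two sides of a crease, is continuous. -/
lemma continuousOn_of_sides {Z W : Type*} [TopologicalSpace Z] [TopologicalSpace W] {U : Set Plane}
    {η : Plane → ℝ} (hη : ContinuousOn η U) (hU : IsOpen U) {F : Z × Plane → W}
    (hL : ContinuousOn F (univ ×ˢ closedSide U η 1))
    (hR : ContinuousOn F (univ ×ˢ closedSide U η (-1))) : ContinuousOn F (univ ×ˢ U) := by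
  rintro ⟨u, y⟩ ⟨-, hy⟩
  have hUU : U = closedSide U η 1 ∪ closedSide U η (-1) := by
    ext y
    constructor
    · intro hy
      rcases le_total 0 (η y) with h | h
      · left; exact ⟨hy, by linarith⟩
      · right; exact ⟨hy, by linarith⟩
    · rintro (h | h) <;> exact h.1
  have hopen : ∀ σ : ℝ, 0 < σ * η y → (univ ×ˢ closedSide U η σ : Set (Z × Plane)) ∈ 𝓝 (u, y) := by
    intro σ hσ
    have h1 : IsOpen (U ∩ (fun y => σ * η y) ⁻¹' Ioi 0) :=
      (continuousOn_const.mul hη).isOpen_inter_preimage hU isOpen_Ioi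
    exact mem_of_superset ((isOpen_univ.prod h1).mem_nhds ⟨mem_univ _, hy, hσ⟩)
      fun q hq => ⟨mem_univ _, hq.2.1, le_of_lt hq.2.2⟩
  rcases lt_trichotomy 0 (η y) with h | h | h
  · exact ((hL (u, y) ⟨mem_univ _, hy, by linarith⟩).continuousAt
      (hopen 1 (by linarith))).continuousWithinAt
  · rw [hUU, prod_union]
    exact (hL (u, y) ⟨mem_univ _, hy, by rw [← h, mul_zero]⟩).union
      (hR (u, y) ⟨mem_univ _, hy, by rw [← h, mul_zero]⟩)
  · exact ((hR (u, y) ⟨mem_univ _, hy, by linarith⟩).continuousAt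
      (hopen (-1) (by linarith))).continuousWithinAt

/-- Near a crease point, the surface can be bent. -/
lemma CreaseRulePattern.IsProperlyFolded.exists_development_crease [Finite ι]
    (hf : P.IsProperlyFolded f) (hU : P.UniquelyRuled) (hR : P.ReflectingRulings) {ρ : ι → ℝ}
    (hρ : ∀ i, ρ i ∈ Ioo (-Real.pi) Real.pi ∧ ρ i ≠ 0 ∧
      ∀ s ∈ Ioo 0 (P.len i), P.HasFoldAngle f i s (ρ i)) (hs₀ : s₀ ∈ Ioo 0 (P.len i)) :
    ∃ U, IsOpen U ∧ P.crease i s₀ ∈ U ∧ U ⊆ P.paper ∧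
      ∃ E F, IsDevelopment P f (fun i => Real.tan (ρ i / 2)) U E F := by
  obtain ⟨a, U, S, η, EL, ER, EL', ER', h⟩ := exists_isCreaseChart hf.1 hs₀
  have hB := h.box
  set m := Real.tan (ρ i / 2) with hm
  have hρm : 2 * Real.arctan m = ρ i := two_arctan_tan (hρ i).1
  have hform := fun s (hs : s ∈ Ioo (s₀ - a) (s₀ + a)) => h.secondForm_eq hf hU hR hs (hρ i).1
    (hρ i).2.1 ((hρ i).2.2 s (hB.mem_Ioo s hs))
  have hc : ∀ r ∈ Ioo (s₀ - a) (s₀ + a), HasDerivAt (P.crease i) (P.tangent i r) r :=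
    fun _ hr => (hasStrictDerivAt_crease (hB.mem_Ioo _ hr)).hasDerivAt
  have hT : ContinuousOn (P.tangent i) (Ioo (s₀ - a) (s₀ + a)) := fun s hs =>
    (hasStrictDerivAt_tangent (hB.mem_Ioo _ hs)).hasDerivAt.continuousAt.continuousWithinAt
  have hmaps : MapsTo (P.crease i) (Ioo (s₀ - a) (s₀ + a)) (closedSide U η 1) :=
    fun _ hr => hB.crease_mem_closedSide hr
  obtain ⟨δ, hδ, eL, pL, hbL⟩ := exists_isBending hB.pos
    (fun s hs => h.left.hasDerivAt_crease hB hs)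
    (fun s hs => h.left.isFramed.hasDerivAt_trans isOpen_Ioo hc hmaps hs)
    (h.left.isFramed.continuousOn_deriv hc hmaps hT)
    (h.left.isFramed.continuousOn_deriv_trans hc hmaps hT)
    (fun s hs => h.left.isRot_crease hB hs)
  set J := Ioo (s₀ - δ) (s₀ + δ) with hJdef
  have hJ : ∀ s ∈ J, s ∈ Ioo (s₀ - a) (s₀ + a) := fun s hs =>
    ⟨by linarith [hs.1, hδ.2], by linarith [hs.2, hδ.2]⟩
  obtain ⟨eR, pR, hbR, htw, hpR⟩ := hbL.across (f := f) (i := i) (m := m)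
    (eR := fun s => ER (P.crease i s)) (eR' := fun s => ER' (P.crease i s) (P.tangent i s))
    (fun s hs => hB.mem_Ioo s (hJ s hs)) (fun s _ => rfl) (fun s _ => rfl)
    (fun s hs => (h.left.isBendingForm _ (hB.crease_mem_closedSide (hJ s hs))).eq_bend _ _)
    (fun s hs => by
      rw [(h.right.isBendingForm _ (hB.crease_mem_closedSide (hJ s hs))).eq_bend]
      have h1 := (hform s (hJ s hs)).2.1
      have h2 := (hform s (hJ s hs)).2.2.1
      simp only [leftNormal] at h1 h2
      rw [h1, h2])
    (fun s hs => (hform s (hJ s hs)).1)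
    (fun s hs => by
      rw [hρm]
      exact h.mul_darboux_eq (hJ s hs) ((hρ i).2.2 s (hB.mem_Ioo s (hJ s hs))))
  have hκ := hform s₀ hB.self_mem
  obtain ⟨WL, hWL, tL, htLJ, htLE, htL0, htLc, hFL⟩ := h.left.isFramed_bending hB (by norm_num) hf.1
    hκ.2.2.2 hδ hbL
  obtain ⟨WR, hWR, tR, htRJ, htRE, htR0, htRc, hFR⟩ := h.right.isFramed_bending hB (by norm_num)
    hf.1 (by rw [hκ.2.1]; exact neg_ne_zero.2 hκ.2.2.2) hδ hbR
  set V := U ∩ (interior WL ∩ interior WR) with hV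
  have hVo : IsOpen V := hB.isOpen.inter (isOpen_interior.inter isOpen_interior)
  have hVU : V ⊆ U := inter_subset_left
  set KL := closedSide V η 1 with hKL
  set KR := closedSide V η (-1) with hKR
  have hKL' : KL ⊆ closedSide U η 1 ∩ WL := fun y hy =>
    ⟨⟨hy.1.1, hy.2⟩, interior_subset hy.1.2.1⟩
  have hKR' : KR ⊆ closedSide U η (-1) ∩ WR := fun y hy =>
    ⟨⟨hy.1.1, hy.2⟩, interior_subset hy.1.2.2⟩
  let E : unitInterval → Plane → Op := fun u y => if 0 < η y then eL u (tL y) else eR u (tR y)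
  let F : unitInterval → Plane → Space := fun u y =>
    if 0 < η y then pL u (tL y) + eL u (tL y) (emb y) else pR u (tR y) + eR u (tR y) (emb y)
  -- the two formulas agree on the crease
  have hFL1 : ∀ u : unitInterval, ∀ y ∈ KL, F u y = pL u (tL y) + eL u (tL y) (emb y) := by
    intro u y hy
    simp only [F]
    split_ifs with h0
    · rfl
    · have h1 : η y = 0 := le_antisymm (not_lt.1 h0) (by linarith [hy.2])
      rw [htL0 y (hKL' hy) h1, htR0 y (hKR' ⟨hy.1, by rw [h1, mul_zero]⟩) h1]
      have h2 := hpR u (S y)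
      rwa [← hB.eq_crease hy.1.1 h1] at h2
  have hFR1 : ∀ u : unitInterval, ∀ y ∈ KR, F u y = pR u (tR y) + eR u (tR y) (emb y) := by
    intro u y hy
    simp only [F]
    rw [if_neg (by linarith [hy.2])]
  have hEL1 : ∀ u : unitInterval, ∀ y ∈ openSide V η 1, E u y = eL u (tL y) := by
    intro u y hy
    simp only [E]
    rw [if_pos (by linarith [hy.2])]
  have hER1 : ∀ u : unitInterval, ∀ y ∈ openSide V η (-1), E u y = eR u (tR y) := by
    intro u y hy
    simp only [E]
    rw [if_neg (by linarith [hy.2])]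
  have hLo : IsOpen (openSide V η 1) := by
    have : openSide V η 1 = openSide U η 1 ∩ V := by
      ext y; exact ⟨fun hy => ⟨⟨hVU hy.1, hy.2⟩, hy.1⟩, fun hy => ⟨hy.2, hy.1.2⟩⟩
    rw [this]; exact hB.isOpen_openSide.inter hVo
  have hRo : IsOpen (openSide V η (-1)) := by
    have : openSide V η (-1) = openSide U η (-1) ∩ V := by
      ext y; exact ⟨fun hy => ⟨⟨hVU hy.1, hy.2⟩, hy.1⟩, fun hy => ⟨hy.2, hy.1.2⟩⟩
    rw [this]; exact hB.isOpen_openSide.inter hVo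
  have hsides : ∀ y ∈ V ∩ P.uncreased, y ∈ openSide V η 1 ∨ y ∈ openSide V η (-1) := by
    intro y hy
    rcases lt_or_gt_of_ne (hB.dist_ne_zero (hVU hy.1) hy.2) with h0 | h0
    · right; exact ⟨hy.1, by linarith⟩
    · left; exact ⟨hy.1, by linarith⟩
  have hzV : P.crease i s₀ ∈ V := ⟨(hB.crease_mem hB.self_mem).1, mem_interior_iff_mem_nhds.2 hWL,
    mem_interior_iff_mem_nhds.2 hWR⟩
  have hcont : ∀ {e : ℝ → ℝ → Op} {t : Plane → ℝ} {y : Plane}, t y ∈ J →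
      ContinuousOn (fun q : ℝ × ℝ => e q.1 q.2) (Icc 0 1 ×ˢ J) →
      Continuous fun u : unitInterval => e u (t y) := by
    intro e t y hty he
    have := continuousOn_unitInterval (Z := unitInterval) (S := univ) he
      (t := fun _ => t y) continuousOn_const (fun _ _ => hty)
    exact this.comp_continuous (f := fun u : unitInterval => (u, u)) (by fun_prop) (by simp)
  have hFc : ∀ {e : ℝ → ℝ → Op} {p : ℝ → ℝ → Space} {t : Plane → ℝ} {K : Set Plane},
      ContinuousOn (fun q : ℝ × ℝ => e q.1 q.2) (Icc 0 1 ×ˢ J) →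
      ContinuousOn (fun q : ℝ × ℝ => p q.1 q.2) (Icc 0 1 ×ˢ J) → ContinuousOn t K → MapsTo t K J →
      ContinuousOn (fun q : unitInterval × Plane => p q.1 (t q.2) + e q.1 (t q.2) (emb q.2))
        (univ ×ˢ K) := by
    intro e p t K he hp ht htK
    refine (continuousOn_unitInterval hp ht htK).add ?_
    exact (Op.act.continuous.comp_continuousOn (continuousOn_unitInterval he ht htK)).clm_apply
      (emb.continuous.comp continuous_snd).continuousOn
  refine ⟨V, hVo, hzV, hVU.trans hB.subset_paper, E, F, ?_, ?_, ?_, ?_, ?_, ?_, ?_, ?_, ?_⟩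
  · intro u y hy
    rcases hsides y hy with hs | hs
    · rw [hEL1 u y hs]; exact (hFL u u.2).isRot y (hKL' ⟨hs.1, hs.2.le⟩)
    · rw [hER1 u y hs]; exact (hFR u u.2).isRot y (hKR' ⟨hs.1, hs.2.le⟩)
  · intro y hy
    rcases hsides y hy with hs | hs
    · simp only [fun u => hEL1 u y hs]
      exact hcont (htLJ (hKL' ⟨hs.1, hs.2.le⟩)) hbL.continuousOn_rot
    · simp only [fun u => hER1 u y hs]
      exact hcont (htRJ (hKR' ⟨hs.1, hs.2.le⟩)) hbR.continuousOn_rot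
  · refine continuousOn_of_sides (hB.continuousOn_dist.mono hVU) hVo ?_ ?_
    · exact (hFc hbL.continuousOn_rot hbL.continuousOn_trans (htLc.mono hKL')
        (htLJ.mono_left hKL')).congr fun q hq => hFL1 q.1 q.2 hq.2
    · exact (hFc hbR.continuousOn_rot hbR.continuousOn_trans (htRc.mono hKR')
        (htRJ.mono_left hKR')).congr fun q hq => hFR1 q.1 q.2 hq.2
  · intro u y hy
    rcases hsides y hy with hs | hs
    · have h1 := (((hFL u u.2).deriv_frame y (hKL' ⟨hs.1, hs.2.le⟩)).mono hKL').hasFDerivAt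
        (mem_of_superset (hLo.mem_nhds hs) openSide_subset_closedSide)
      rw [hEL1 u y hs, ← h.left.eq_frame y ⟨hs.1.1, hs.2⟩, ← h.left.eq_fderiv y ⟨hs.1.1, hs.2⟩]
      exact h1.congr_of_eventuallyEq (Filter.eventually_of_mem (hLo.mem_nhds hs) (hEL1 u))
    · have h1 := (((hFR u u.2).deriv_frame y (hKR' ⟨hs.1, hs.2.le⟩)).mono hKR').hasFDerivAt
        (mem_of_superset (hRo.mem_nhds hs) openSide_subset_closedSide)
      rw [hER1 u y hs, ← h.right.eq_frame y ⟨hs.1.1, hs.2⟩, ← h.right.eq_fderiv y ⟨hs.1.1, hs.2⟩]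
      exact h1.congr_of_eventuallyEq (Filter.eventually_of_mem (hRo.mem_nhds hs) (hER1 u))
  · intro u y hy
    rcases hsides y hy with hs | hs
    · have h1 := (((hFL u u.2).deriv_surface y (hKL' ⟨hs.1, hs.2.le⟩)).mono hKL').hasFDerivAt
        (mem_of_superset (hLo.mem_nhds hs) openSide_subset_closedSide)
      rw [hEL1 u y hs]
      exact h1.congr_of_eventuallyEq (Filter.eventually_of_mem (hLo.mem_nhds hs)
        fun x hx => hFL1 u x (openSide_subset_closedSide hx))
    · have h1 := (((hFR u u.2).deriv_surface y (hKR' ⟨hs.1, hs.2.le⟩)).mono hKR').hasFDerivAt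
        (mem_of_superset (hRo.mem_nhds hs) openSide_subset_closedSide)
      rw [hER1 u y hs]
      exact h1.congr_of_eventuallyEq (Filter.eventually_of_mem (hRo.mem_nhds hs)
        fun x hx => hFR1 u x (openSide_subset_closedSide hx))
  · intro u x hx
    rcases h.closure_component_subset hf.1 (hρ i).1 (hρ i).2.1 ((hρ i).2.2 s₀ hs₀) hx with h1 | h1
    · have h2 : V ∩ closure (connectedComponentIn P.uncreased x) ⊆ KL := fun y hy =>
        ⟨hy.1, (h1 ⟨hVU hy.1, hy.2⟩).2⟩
      exact ((hFL u u.2).contDiffOn.mono (h2.trans hKL')).congr fun y hy => hFL1 u y (h2 hy)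
    · have h2 : V ∩ closure (connectedComponentIn P.uncreased x) ⊆ KR := fun y hy =>
        ⟨hy.1, (h1 ⟨hVU hy.1, hy.2⟩).2⟩
      exact ((hFR u u.2).contDiffOn.mono (h2.trans hKR')).congr fun y hy => hFR1 u y (h2 hy)
  · intro u j s hs hsV
    obtain ⟨rfl, hsa⟩ := hB.crease_eq hs (hVU hsV)
    obtain ⟨-, hS, hη⟩ := hB.crease_mem hsa
    have hxL : P.crease j s ∈ KL := ⟨hsV, by rw [hη, mul_zero]⟩
    have hxR : P.crease j s ∈ KR := ⟨hsV, by rw [hη, mul_zero]⟩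
    have htLs : tL (P.crease j s) = s := by rw [htL0 _ (hKL' hxL) hη, hS]
    have htRs : tR (P.crease j s) = s := by rw [htR0 _ (hKR' hxR) hη, hS]
    have hsJ : s ∈ J := by rw [← htLs]; exact htLJ (hKL' hxL)
    refine ⟨eL u s, eR u s, ?_, ?_, htw u s hsJ, ?_⟩
    · have h1 := ((hFL u u.2).continuousOn_frame _ (hKL' hxL)).mono hKL'
      rw [ContinuousWithinAt, htLs] at h1
      have h2 : openSide V η 1 ∈ 𝓝[openSide U η 1] (P.crease j s) := by
        filter_upwards [self_mem_nhdsWithin, mem_nhdsWithin_of_mem_nhds (hVo.mem_nhds hsV)]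
          with y h3 h4
        exact ⟨h4, h3.2⟩
      have h3 := hB.tendsto_fermi hsa (σ := 1) (by norm_num)
      have h4 : ∀ᶠ ε in 𝓝[>] (0 : ℝ), P.fermi j (s, 1 * ε) ∈ openSide V η 1 := h3.eventually h2
      have h5 : Tendsto (fun ε : ℝ => P.fermi j (s, 1 * ε)) (𝓝[>] 0) (𝓝[KL] (P.crease j s)) :=
        tendsto_nhdsWithin_iff.2 ⟨h3.mono_right nhdsWithin_le_nhds,
          h4.mono fun ε hε => openSide_subset_closedSide hε⟩
      refine (h1.comp h5).congr' ?_
      filter_upwards [h4] with ε hε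
      rw [Function.comp_apply, ← hEL1 u _ hε]
      simp [fermi]
    · have h1 := ((hFR u u.2).continuousOn_frame _ (hKR' hxR)).mono hKR'
      rw [ContinuousWithinAt, htRs] at h1
      have h2 : openSide V η (-1) ∈ 𝓝[openSide U η (-1)] (P.crease j s) := by
        filter_upwards [self_mem_nhdsWithin, mem_nhdsWithin_of_mem_nhds (hVo.mem_nhds hsV)]
          with y h3 h4
        exact ⟨h4, h3.2⟩
      have h3 := hB.tendsto_fermi hsa (σ := -1) (by norm_num)
      have h4 : ∀ᶠ ε in 𝓝[>] (0 : ℝ), P.fermi j (s, -1 * ε) ∈ openSide V η (-1) := h3.eventually h2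
      have h5 : Tendsto (fun ε : ℝ => P.fermi j (s, -1 * ε)) (𝓝[>] 0) (𝓝[KR] (P.crease j s)) :=
        tendsto_nhdsWithin_iff.2 ⟨h3.mono_right nhdsWithin_le_nhds,
          h4.mono fun ε hε => openSide_subset_closedSide hε⟩
      refine (h1.comp h5).congr' ?_
      filter_upwards [h4] with ε hε
      rw [Function.comp_apply, ← hER1 u _ hε]
      simp [fermi, sub_eq_add_neg]
    · have hN : ∀ᶠ r in 𝓝 s, P.crease j r ∈ V ∧ r ∈ Ioo (s₀ - a) (s₀ + a) :=
        ((hc s hsa).continuousAt.eventually (hVo.mem_nhds hsV)).and (isOpen_Ioo.mem_nhds hsa)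
      have hK : ∀ᶠ r in 𝓝 s, P.crease j r ∈ KR := by
        filter_upwards [hN] with r hr
        exact ⟨hr.1, by rw [(hB.crease_mem hr.2).2.2, mul_zero]⟩
      obtain ⟨N, hNs, hNK⟩ := hK.exists_mem
      have h1 := IsFramed.hasDerivAt_of_mapsTo (((hFR u u.2).deriv_surface _ (hKR' hxR)).mono hKR')
        (hc s hsa) hNs hNK
      have h2 : eR u (tR (P.crease j s)) = eR u s := by rw [htRs]
      simp only at h1
      rw [h2] at h1
      exact h1.congr_of_eventuallyEq (hK.mono fun r hr => hFR1 u _ hr)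
  · intro y hy
    rcases le_total 0 (η y) with h0 | h0
    · have hyK : y ∈ KL := ⟨hy, by linarith⟩
      obtain ⟨h1, h2⟩ := hbL.one _ (htLJ (hKL' hyK))
      obtain ⟨h3, h4⟩ := htLE y (hKL' hyK)
      rw [hFL1 1 y hyK, Icc.coe_one, h1, h2, ← h4, ← h3]
      abel
    · have hyK : y ∈ KR := ⟨hy, by linarith⟩
      obtain ⟨h1, h2⟩ := hbR.one _ (htRJ (hKR' hyK))
      obtain ⟨h3, h4⟩ := htRE y (hKR' hyK)
      rw [hFR1 1 y hyK, Icc.coe_one, h1, h2, ← h4, ← h3]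
      abel
  · refine ⟨flatPlacement (h.left.isRot_crease hB hB.self_mem)
      (f (P.crease i s₀) - EL (P.crease i s₀) (emb (P.crease i s₀))), fun y hy => ?_⟩
    rw [flatPlacement_apply]
    rcases le_total 0 (η y) with h0 | h0
    · have hyK : y ∈ KL := ⟨hy, by linarith⟩
      obtain ⟨h1, h2⟩ := hbL.zero _ (htLJ (hKL' hyK))
      rw [hFL1 0 y hyK, Icc.coe_zero, h1, h2]
    · have hyK : y ∈ KR := ⟨hy, by linarith⟩
      obtain ⟨h1, h2⟩ := hbR.zero _ (htRJ (hKR' hyK))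
      rw [hFR1 0 y hyK, Icc.coe_zero, h1, h2]

end

/-! ### Locally constant cocycles on simply connected spaces -/

section

open CreaseRulePattern

/-- On a simply connected space, locally constant transition functions come from a global section:
they define a covering space, which is trivial. -/
theorem exists_section_of_cocycle {B G : Type*} [TopologicalSpace B] [SimplyConnectedSpace B]
    [LocallyPathConnectedSpace B] [Monoid G] (U : B → Set B) (hU : ∀ i, IsOpen (U i))
    (hmem : ∀ i, i ∈ U i) (g : B → B → B → G) (hself : ∀ i, ∀ x ∈ U i, g i i x = 1)
    (hcomp : ∀ i j k, ∀ x ∈ U i ∩ U j ∩ U k, g i j x * g j k x = g i k x)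
    (hloc : ∀ i j, ∀ x ∈ U i ∩ U j, ∀ᶠ y in 𝓝 x, g i j y = g i j x) :
    ∃ h : B → G, ∀ y, ∀ᶠ x in 𝓝 y, h x * g x y x = h y := by
  let _ : TopologicalSpace G := ⊥
  have : DiscreteTopology G := ⟨rfl⟩
  let Z : FiberBundleCore B B G :=
  { baseSet := U
    isOpen_baseSet := hU
    indexAt := id
    mem_baseSet_at := hmem
    coordChange := fun i j x v => v * g i j x
    coordChange_self := fun i x hx v => by rw [hself i x hx, mul_one]
    continuousOn_coordChange := fun i j => by
      rintro ⟨x, v⟩ ⟨hx, -⟩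
      refine ContinuousAt.continuousWithinAt ?_
      rw [ContinuousAt, nhds_discrete G]
      refine tendsto_pure.2 ?_
      have h1 : ∀ᶠ p : B × G in 𝓝 (x, v), g i j p.1 = g i j x := (hloc i j x hx).prod_inl_nhds v
      have h0 : ∀ᶠ w in 𝓝 v, w = v := by
        rw [nhds_discrete G]; exact eventually_pure.2 rfl
      have h2 : ∀ᶠ p : B × G in 𝓝 (x, v), p.2 = v := h0.prod_inr_nhds x
      filter_upwards [h1, h2] with p h3 h4
      rw [h3, h4]
    coordChange_comp := fun i j k x hx v => by rw [mul_assoc, hcomp i j k x hx] }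
  have hcov : IsCoveringMap Z.proj :=
    IsFiberBundle.isCoveringMap fun x => ⟨Z.localTriv x, hmem x⟩
  obtain ⟨b₀⟩ : Nonempty B := inferInstance
  obtain ⟨s, ⟨-, hs⟩, -⟩ := hcov.existsUnique_continuousMap_lifts (ContinuousMap.id B) b₀
    (⟨b₀, (1 : G)⟩ : Z.TotalSpace) rfl
  have hs1 : ∀ x, (s x).1 = x := fun x => congrFun hs x
  let h : B → G := fun x => (s x).2
  refine ⟨h, fun y => ?_⟩
  have h1 : ContinuousAt (fun x => Z.localTriv y (s x)) y := by
    refine ContinuousAt.comp (g := Z.localTriv y) ?_ s.continuous.continuousAt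
    refine (Z.localTriv y).continuousOn.continuousAt ((Z.localTriv y).open_source.mem_nhds ?_)
    rw [(Z.localTriv y).mem_source]
    show (s y).1 ∈ U y
    rw [hs1]
    exact hmem y
  have h2 : ∀ x, (Z.localTriv y (s x)).2 = h x * g (s x).1 y (s x).1 := fun x => rfl
  have h3 := (continuous_snd.continuousAt.comp h1).tendsto
  rw [nhds_discrete G] at h3
  have h4 := tendsto_pure.1 h3
  filter_upwards [h4] with x hx
  simp only [Function.comp_apply, h2, hs1] at hx
  rw [hx, hself y y (hmem y), mul_one]

/-! ### Rigid motions depending on time -/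

lemma continuous_act {Z : Type*} [TopologicalSpace Z] {A : Z → Op}
    {v : Z → Space} (hA : Continuous A) (hv : Continuous v) : Continuous fun z => A z (v z) :=
  (Op.act.continuous.comp hA).clm_apply hv

/-- A rigid motion of space that depends continuously on time and is the identity at time `1`. -/
@[ext]
structure Motion where
  rot : unitInterval → Op
  trans : unitInterval → Space
  isRot : ∀ u, IsRot (rot u)
  continuous_rot : Continuous rot
  continuous_trans : Continuous trans
  rot_one : rot 1 = 1
  trans_one : trans 1 = 0

namespace Motion

/-- Motions are composed at each time. -/
instance : Monoid Motion where
  mul g h := ⟨fun u => g.rot u * h.rot u, fun u => g.rot u (h.trans u) + g.trans u,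
    fun u => (g.isRot u).mul (h.isRot u), g.continuous_rot.mul h.continuous_rot,
    (continuous_act g.continuous_rot h.continuous_trans).add g.continuous_trans,
    by rw [g.rot_one, h.rot_one, mul_one], by simp [g.trans_one, h.trans_one]⟩
  one := ⟨fun _ => 1, fun _ => 0, fun _ => IsRot.one, continuous_const, continuous_const, rfl, rfl⟩
  mul_assoc g h k := Motion.ext (funext fun u => mul_assoc _ _ _) (funext fun u => by
    show (g.rot u * h.rot u) (k.trans u) + (g.rot u (h.trans u) + g.trans u) =
      g.rot u (h.rot u (k.trans u) + h.trans u) + g.trans u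
    simp [add_assoc])
  one_mul g := Motion.ext (funext fun u => one_mul _) (funext fun u => by
    show (1 : Op) (g.trans u) + 0 = g.trans u
    simp)
  mul_one g := Motion.ext (funext fun u => mul_one _) (funext fun u => by
    show g.rot u 0 + g.trans u = g.trans u
    simp)

lemma mul_rot (g h : Motion) (u : unitInterval) : (g * h).rot u = g.rot u * h.rot u := rfl

lemma mul_trans (g h : Motion) (u : unitInterval) :
    (g * h).trans u = g.rot u (h.trans u) + g.trans u := rfl

lemma one_rot (u : unitInterval) : (1 : Motion).rot u = 1 := rfl

lemma one_trans (u : unitInterval) : (1 : Motion).trans u = 0 := rfl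

/-- A rigid motion at a fixed time. -/
def isometry (g : Motion) (u : unitInterval) : Space →ᵃⁱ[ℝ] Space where
  toFun v := g.rot u v + g.trans u
  linear := (Op.act (g.rot u) : Space →L[ℝ] Space)
  map_vadd' v w := by simp [add_assoc]
  norm_map v := (g.isRot u).norm_map v

end Motion

variable {ι : Type*} {P : CreaseRulePattern ι} {f : Plane → Space} {m : ι → ℝ}

/-- The frames and surfaces `E`, `F` arise from `E'`, `F'` at the point `x` by the motion `g`. -/
def Motion.Carries (P : CreaseRulePattern ι) (g : Motion) (E' E : unitInterval → Plane → Op)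
    (F' F : unitInterval → Plane → Space) (x : Plane) : Prop :=
  (∀ u, F u x = g.rot u (F' u x) + g.trans u) ∧
    (x ∈ P.uncreased → ∀ u, E u x = g.rot u * E' u x)

lemma Motion.Carries.mul {g h : Motion} {E E' E'' : unitInterval → Plane → Op}
    {F F' F'' : unitInterval → Plane → Space} {x : Plane} (hg : g.Carries P E' E F' F x)
    (hh : h.Carries P E'' E' F'' F' x) : (g * h).Carries P E'' E F'' F x := by
  refine ⟨fun u => ?_, fun hx u => ?_⟩
  · rw [hg.1, hh.1, Motion.mul_rot, Motion.mul_trans, map_add, Op.mul_apply, add_assoc]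
  · rw [hg.2 hx, hh.2 hx, Motion.mul_rot, mul_assoc]

lemma Motion.Carries.one {E : unitInterval → Plane → Op}
    {F : unitInterval → Plane → Space} {x : Plane} : (1 : Motion).Carries P E E F F x := by
  refine ⟨fun u => ?_, fun hx u => ?_⟩
  · rw [Motion.one_rot, Motion.one_trans, Op.one_apply, add_zero]
  · rw [Motion.one_rot, one_mul]

lemma Motion.Carries.unique {g h : Motion} {E E' : unitInterval → Plane → Op}
    {F F' : unitInterval → Plane → Space} {x : Plane} (hx : x ∈ P.uncreased)
    (hE : ∀ u, IsRot (E' u x)) (hg : g.Carries P E' E F' F x)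
    (hh : h.Carries P E' E F' F x) : g = h := by
  have h1 : g.rot = h.rot := by
    funext u
    have h2 := (hg.2 hx u).symm.trans (hh.2 hx u)
    calc g.rot u = g.rot u * E' u x * star (E' u x) := by
          rw [mul_assoc, (hE u).mul_star, mul_one]
      _ = h.rot u := by rw [h2, mul_assoc, (hE u).mul_star, mul_one]
  refine Motion.ext h1 (funext fun u => ?_)
  have h2 := (hg.1 u).symm.trans (hh.1 u)
  rw [h1] at h2
  exact add_left_cancel h2

lemma CreaseRulePattern.VertexFree.mem_cases (hV : P.VertexFree) {z : Plane} (hz : z ∈ P.paper) :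
    z ∈ P.uncreased ∨ ∃ i, ∃ s ∈ Ioo 0 (P.len i), P.crease i s = z := by
  by_cases h : z ∈ ⋃ i, P.crease i '' Icc 0 (P.len i)
  · right
    obtain ⟨i, s, hs, rfl⟩ := mem_iUnion.1 h
    refine ⟨i, s, ⟨lt_of_le_of_ne hs.1 ?_, lt_of_le_of_ne hs.2 ?_⟩, rfl⟩
    · rintro rfl; exact (hV i).1 hz
    · rintro rfl; exact (hV i).2 hz
  · left; exact ⟨hz, h⟩

lemma CreaseRulePattern.VertexFree.mem_closure_uncreased [Finite ι] (hV : P.VertexFree) {z : Plane}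
    (hz : z ∈ P.paper) : z ∈ closure P.uncreased := by
  rcases hV.mem_cases hz with h | ⟨i, s, hs, rfl⟩
  · exact subset_closure h
  · obtain ⟨a, U, S, η, hB⟩ := exists_isFermiBox P hs
    exact closure_mono (hB.openSide_subset (σ := 1))
      (hB.crease_mem_closure hB.self_mem (by norm_num))

namespace IsDevelopment

variable {U U' : Set Plane} {E E' : unitInterval → Plane → Op} {F F' : unitInterval → Plane → Space}

lemma mono (h : IsDevelopment P f m U E F) (hU : U' ⊆ U) : IsDevelopment P f m U' E F where
  isRot u y hy := h.isRot u y ⟨hU hy.1, hy.2⟩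
  continuous_frame y hy := h.continuous_frame y ⟨hU hy.1, hy.2⟩
  continuousOn := h.continuousOn.mono (prod_mono_right hU)
  deriv_frame u y hy := h.deriv_frame u y ⟨hU hy.1, hy.2⟩
  deriv_surface u y hy := h.deriv_surface u y ⟨hU hy.1, hy.2⟩
  contDiffOn u x hx := (h.contDiffOn u x hx).mono (inter_subset_inter_left _ hU)
  crease u i s hs hsU := h.crease u i s hs (hU hsU)
  one y hy := h.one y (hU hy)
  zero := h.zero.imp fun _ he => he.mono hU

lemma frame_one [Finite ι] (h : IsDevelopment P f m U E F) (hU : IsOpen U) {y : Plane}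
    (hy : y ∈ U ∩ P.uncreased) : E 1 y = frame f y := by
  have h1 : F 1 =ᶠ[𝓝 y] f := Filter.eventually_of_mem (hU.mem_nhds hy.1) h.one
  have h2 := (h.deriv_surface 1 y hy).congr_of_eventuallyEq h1.symm
  rw [frame, h2.fderiv, ← (h.isRot 1 y hy).eq_frameOf]

lemma continuous_surface (h : IsDevelopment P f m U E F) {y : Plane} (hy : y ∈ U) :
    Continuous fun u => F u y :=
  h.continuousOn.comp_continuous (f := fun u : unitInterval => (u, y)) (by fun_prop)
    fun _ => ⟨mem_univ _, hy⟩

lemma continuousOn_surface (h : IsDevelopment P f m U E F) (u : unitInterval) :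
    ContinuousOn (F u) U :=
  h.continuousOn.comp (f := fun y : Plane => (u, y)) (by fun_prop) fun _ hy => ⟨mem_univ _, hy⟩

/-- On a connected set without creases, developments differ by a motion: the frames of both turn
with the same angular velocity in body coordinates. -/
lemma exists_carries_of_isPreconnected [Finite ι] (hf : P.IsFolding f)
    (h : IsDevelopment P f m U E F) (h' : IsDevelopment P f m U E' F') (hUo : IsOpen U)
    (hUu : U ⊆ P.uncreased) (hUc : IsPreconnected U) (hne : U.Nonempty) :
    ∃ g : Motion, ∀ x ∈ U, g.Carries P E' E F' F x := by
  obtain ⟨y, hy⟩ := hne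
  have hA : ∀ u, ∀ x ∈ U, HasFDerivAt (fun x => E u x * star (E' u x))
      (0 : Plane →L[ℝ] Op) x := by
    intro u x hx
    have hx' : x ∈ U ∩ P.uncreased := ⟨hx, hUu hx⟩
    refine (mulL.hasFDerivAt_of_bilinear (h.deriv_frame u x hx')
      (h'.deriv_frame u x hx').star).congr_fderiv ?_
    apply ContinuousLinearMap.ext
    intro v
    have hsk := (hf.isBendingForm hx'.2).skew v
    have h1 : ∀ A : Op, star ((u : ℝ) • (A * star (frame f x) * fderiv ℝ (frame f) x v)) =
        -((u : ℝ) • (star (frame f x) * fderiv ℝ (frame f) x v * star A)) := by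
      intro A
      rw [mul_assoc, star_smul, star_mul, hsk, star_trivial, neg_mul, smul_neg]
    have h2 : E u x * star ((u : ℝ) • (E' u x * star (frame f x) * fderiv ℝ (frame f) x v)) +
        (u : ℝ) • (E u x * star (frame f x) * fderiv ℝ (frame f) x v) * star (E' u x) = 0 := by
      rw [h1]
      simp only [mul_assoc, smul_mul_assoc, mul_smul_comm, mul_neg]
      exact neg_add_cancel _
    simpa using h2
  have hAc : ∀ u, ∀ x ∈ U, E u x * star (E' u x) = E u y * star (E' u y) := fun u x hx =>
    hUo.is_const_of_fderiv_eq_zero hUc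
      (fun x hx => (hA u x hx).differentiableAt.differentiableWithinAt)
      (fun x hx => (hA u x hx).fderiv) hx hy
  have hE : ∀ u, ∀ x ∈ U, E u x = E u y * star (E' u y) * E' u x := by
    intro u x hx
    rw [← hAc u x hx, mul_assoc, (h'.isRot u x ⟨hx, hUu hx⟩).1, mul_one]
  have hb : ∀ u, ∀ x ∈ U, HasFDerivAt
      (fun x => F u x - (E u y * star (E' u y)) (F' u x)) (0 : Plane →L[ℝ] Space) x := by
    intro u x hx
    have hx' : x ∈ U ∩ P.uncreased := ⟨hx, hUu hx⟩
    refine ((h.deriv_surface u x hx').sub ((Op.act (E u y * star (E' u y))).hasFDerivAt.comp x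
      (h'.deriv_surface u x hx'))).congr_fderiv ?_
    apply ContinuousLinearMap.ext
    intro v
    have : ∀ w, E u x w = (E u y * star (E' u y)) (E' u x w) := by
      intro w; rw [← Op.mul_apply, ← hE u x hx]
    simp only [sub_apply, ContinuousLinearMap.comp_apply, zero_apply]
    rw [this, sub_self]
  have hbc : ∀ u, ∀ x ∈ U, F u x - (E u y * star (E' u y)) (F' u x) =
      F u y - (E u y * star (E' u y)) (F' u y) := fun u x hx =>
    hUo.is_const_of_fderiv_eq_zero hUc
      (fun x hx => (hb u x hx).differentiableAt.differentiableWithinAt)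
      (fun x hx => (hb u x hx).fderiv) hx hy
  have hyu : y ∈ U ∩ P.uncreased := ⟨hy, hUu hy⟩
  have hrot1 : E 1 y * star (E' 1 y) = 1 := by
    rw [h.frame_one hUo hyu, h'.frame_one hUo hyu, (hf.isRot_frame hyu.2).mul_star]
  have hcr : Continuous fun u => E u y * star (E' u y) :=
    (h.continuous_frame y hyu).mul (continuous_star.comp (h'.continuous_frame y hyu))
  refine ⟨⟨fun u => E u y * star (E' u y), fun u => F u y - (E u y * star (E' u y)) (F' u y),
    fun u => (h.isRot u y hyu).mul (h'.isRot u y hyu).star, hcr,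
    (h.continuous_surface hy).sub (continuous_act hcr (h'.continuous_surface hy)), hrot1, ?_⟩,
    fun x hx => ⟨fun u => ?_, fun _ u => hE u x hx⟩⟩
  · rw [hrot1, Op.one_apply, h.one y hy, h'.one y hy, sub_self]
  · show F u x = (E u y * star (E' u y)) (F' u x) + (F u y - (E u y * star (E' u y)) (F' u y))
    rw [← hbc u x hx, add_sub_cancel]

end IsDevelopment

end

/-! ### Gluing developments -/

section

open CreaseRulePattern

variable {ι : Type*} {P : CreaseRulePattern ι} {f : Plane → Space} {m : ι → ℝ}

namespace IsDevelopment

variable {U U' : Set Plane} {E E' : unitInterval → Plane → Op} {F F' : unitInterval → Plane → Space}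

/-- Locally, developments differ by a motion; at a crease because the fold angle is prescribed. -/
lemma exists_carries [Finite ι] (hV : P.VertexFree) (hf : P.IsFolding f)
    (h : IsDevelopment P f m U E F) (h' : IsDevelopment P f m U E' F') (hUo : IsOpen U)
    (hUp : U ⊆ P.paper) {y : Plane} (hy : y ∈ U) :
    ∃ g : Motion, ∀ᶠ x in 𝓝 y, g.Carries P E' E F' F x := by
  rcases hV.mem_cases (hUp hy) with hyu | ⟨i, s₀, hs₀, rfl⟩
  · obtain ⟨r, hr, hball⟩ := Metric.isOpen_iff.1 (hUo.inter (isOpen_uncreased P)) y ⟨hy, hyu⟩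
    obtain ⟨g, hg⟩ := (h.mono (hball.trans inter_subset_left)).exists_carries_of_isPreconnected hf
      (h'.mono (hball.trans inter_subset_left)) Metric.isOpen_ball (hball.trans inter_subset_right)
      (convex_ball y r).isPreconnected ⟨y, Metric.mem_ball_self hr⟩
    exact ⟨g, Filter.eventually_of_mem (Metric.ball_mem_nhds y hr) hg⟩
  obtain ⟨a₁, U₁, S, η, hB₁⟩ := exists_isFermiBox P hs₀
  obtain ⟨a, V, hVU, -, hB⟩ := hB₁.shrink (hUo.mem_nhds hy)
  have hside : ∀ σ : ℝ, σ ^ 2 = 1 →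
      ∃ g : Motion, ∀ x ∈ openSide V η σ, g.Carries P E' E F' F x := by
    intro σ hσ
    have hsub : openSide V η σ ⊆ U := fun x hx => hVU hx.1
    exact (h.mono hsub).exists_carries_of_isPreconnected hf (h'.mono hsub) hB.isOpen_openSide
      hB.openSide_subset hB.isPreconnected_openSide
      (closure_nonempty_iff.1 ⟨_, hB.crease_mem_closure hB.self_mem hσ⟩)
  obtain ⟨gL, hgL⟩ := hside 1 (by norm_num)
  obtain ⟨gR, hgR⟩ := hside (-1) (by norm_num)
  -- the surfaces remain related on the crease
  have hlim : ∀ σ : ℝ, σ ^ 2 = 1 → ∀ g : Motion,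
      (∀ x ∈ openSide V η σ, g.Carries P E' E F' F x) → ∀ s ∈ Ioo (s₀ - a) (s₀ + a), ∀ u,
      F u (P.crease i s) = g.rot u (F' u (P.crease i s)) + g.trans u := by
    intro σ hσ g hg s hs u
    have hsU := hVU (hB.crease_mem hs).1
    have h1 := (hB.tendsto_fermi hs hσ).mono_right nhdsWithin_le_nhds
    have h2 := ((h.continuousOn_surface u).continuousAt (hUo.mem_nhds hsU)).tendsto.comp h1
    have h3 := ((h'.continuousOn_surface u).continuousAt (hUo.mem_nhds hsU)).tendsto.comp h1
    have h4 : Continuous fun v => g.rot u v + g.trans u :=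
      (Op.act (g.rot u)).continuous.add continuous_const
    refine tendsto_nhds_unique h2 (((h4.tendsto _).comp h3).congr' ?_)
    filter_upwards [hB.fermi_mem_openSide hs hσ] with ε hε
    exact ((hg _ hε).1 u).symm
  have hrot : ∀ u, gL.rot u = gR.rot u := by
    intro u
    obtain ⟨EL, ER, hL, hR, htw, -⟩ := h.crease u i s₀ hs₀ hy
    obtain ⟨EL', ER', hL', hR', htw', -⟩ := h'.crease u i s₀ hs₀ hy
    have hmL : ∀ᶠ ε in 𝓝[>] (0 : ℝ), P.crease i s₀ + ε • P.leftNormal i s₀ ∈ openSide V η 1 := by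
      filter_upwards [hB.fermi_mem_openSide hB.self_mem (σ := 1) (by norm_num)] with ε hε
      simpa [fermi] using hε
    have hmR : ∀ᶠ ε in 𝓝[>] (0 : ℝ), P.crease i s₀ - ε • P.leftNormal i s₀ ∈ openSide V η (-1) := by
      filter_upwards [hB.fermi_mem_openSide hB.self_mem (σ := -1) (by norm_num)] with ε hε
      simpa [fermi, sub_eq_add_neg] using hε
    have e1 : EL = gL.rot u * EL' := by
      refine tendsto_nhds_unique hL ((hL'.const_mul (gL.rot u)).congr' ?_)
      filter_upwards [hmL] with ε hε
      exact ((hgL _ hε).2 (hB.openSide_subset hε) u).symm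
    have e2 : ER = gR.rot u * ER' := by
      refine tendsto_nhds_unique hR ((hR'.const_mul (gR.rot u)).congr' ?_)
      filter_upwards [hmR] with ε hε
      exact ((hgR _ hε).2 (hB.openSide_subset hε) u).symm
    have hr : IsRot (EL' * darboux (P.tangent i s₀)) := by
      refine IsRot.mul (isClosed_isRot.mem_of_tendsto hL' ?_) (isRot_darboux (norm_tangent hs₀))
      filter_upwards [hmL] with ε hε
      exact h'.isRot u _ ⟨hVU hε.1, hB.openSide_subset hε⟩
    rw [e1, e2, mul_assoc, mul_assoc, mul_assoc, ← mul_assoc ER', ← htw'] at htw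
    calc gL.rot u = gL.rot u * (EL' * darboux (P.tangent i s₀)) *
          star (EL' * darboux (P.tangent i s₀)) := by rw [mul_assoc, hr.mul_star, mul_one]
      _ = gR.rot u := by rw [htw, mul_assoc, hr.mul_star, mul_one]
  have hg : gL = gR := by
    refine Motion.ext (funext hrot) (funext fun u => ?_)
    have h1 := hlim 1 (by norm_num) gL hgL s₀ hB.self_mem u
    rw [hlim (-1) (by norm_num) gR hgR s₀ hB.self_mem u, hrot u] at h1
    exact (add_left_cancel h1).symm
  refine ⟨gL, Filter.eventually_of_mem (hB.isOpen.mem_nhds (hB.crease_mem hB.self_mem).1)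
    fun x hx => ?_⟩
  rcases lt_trichotomy 0 (η x) with h0 | h0 | h0
  · exact hgL x ⟨hx, by linarith⟩
  · refine ⟨fun u => ?_, fun hxu => absurd h0.symm (hB.dist_ne_zero hx hxu)⟩
    rw [hB.eq_crease hx h0.symm]
    exact hlim 1 (by norm_num) gL hgL _ (hB.mapsTo x hx).1 u
  · rw [hg]; exact hgR x ⟨hx, by linarith⟩

/-- A development that is moved in space is again a development. -/
lemma motion (h : IsDevelopment P f m U E F) (g : Motion) :
    IsDevelopment P f m U (fun u y => g.rot u * E u y)
      (fun u y => g.rot u (F u y) + g.trans u) where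
  isRot u y hy := (g.isRot u).mul (h.isRot u y hy)
  continuous_frame y hy := g.continuous_rot.mul (h.continuous_frame y hy)
  continuousOn := by
    refine ContinuousOn.add ?_ (g.continuous_trans.comp continuous_fst).continuousOn
    exact (Op.act.continuous.comp (g.continuous_rot.comp continuous_fst)).continuousOn.clm_apply
      h.continuousOn
  deriv_frame u y hy := by
    refine ((mulL (g.rot u)).hasFDerivAt.comp y (h.deriv_frame u y hy)).congr_fderiv ?_
    apply ContinuousLinearMap.ext
    intro v
    simp [mul_assoc]
  deriv_surface u y hy := by
    refine (((Op.act (g.rot u)).hasFDerivAt.comp y (h.deriv_surface u y hy)).add_const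
      (g.trans u)).congr_fderiv ?_
    apply ContinuousLinearMap.ext
    intro v
    simp
  contDiffOn u x hx :=
    ((Op.act (g.rot u)).contDiff.comp_contDiffOn (h.contDiffOn u x hx)).add contDiffOn_const
  crease u i s hs hsU := by
    obtain ⟨EL, ER, hL, hR, htw, hd⟩ := h.crease u i s hs hsU
    refine ⟨g.rot u * EL, g.rot u * ER, hL.const_mul _, hR.const_mul _, ?_, ?_⟩
    · simp only [mul_assoc] at htw ⊢
      rw [htw]
    · exact ((Op.act (g.rot u)).hasFDerivAt.comp_hasDerivAt s hd).add_const (g.trans u)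
  one y hy := by rw [g.rot_one, g.trans_one, Op.one_apply, add_zero, h.one y hy]
  zero := by
    obtain ⟨e, he⟩ := h.zero
    refine ⟨(g.isometry 0).comp e, fun y hy => ?_⟩
    show g.rot 0 (F 0 y) + g.trans 0 = g.rot 0 (e y) + g.trans 0
    rw [he hy]

end IsDevelopment

lemma affineIsometry_eq_of_eventuallyEq {e e' : Plane →ᵃⁱ[ℝ] Space} {x : Plane}
    (h : e =ᶠ[𝓝 x] e') : e = e' := by
  ext1 p
  have hl : Tendsto (fun t : ℝ => AffineMap.lineMap x p t) (𝓝 0) (𝓝 x) := by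
    have h1 : Continuous fun t : ℝ => AffineMap.lineMap x p t := AffineMap.lineMap_continuous
    simpa using h1.tendsto 0
  obtain ⟨t, ht, ht0⟩ := (((hl.eventually h).filter_mono nhdsWithin_le_nhds).and
    (self_mem_nhdsWithin : Ioi (0 : ℝ) ∈ 𝓝[>] 0)).exists
  have ht0' : t ≠ 0 := ne_of_gt ht0
  have h1 : ∀ e : Plane →ᵃⁱ[ℝ] Space, e (AffineMap.lineMap x p t) = t • (e p - e x) + e x := by
    intro e
    have := e.toAffineMap.apply_lineMap x p t
    rw [AffineMap.lineMap_apply, vsub_eq_sub, vadd_eq_add] at this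
    exact this
  rw [h1, h1, h.self_of_nhds] at ht
  have h2 := smul_right_injective Space ht0' (add_right_cancel ht)
  exact sub_left_injective h2

/-- Being a development is a local property. -/
lemma IsDevelopment.of_local [Finite ι] (hHole : P.HoleFree) {E : unitInterval → Plane → Op}
    {F : unitInterval → Plane → Space}
    (h : ∀ y ∈ P.paper, ∃ U, IsOpen U ∧ y ∈ U ∧ ∃ E' F', IsDevelopment P f m U E' F' ∧
      ∀ x ∈ U, (∀ u, F u x = F' u x) ∧ (x ∈ P.uncreased → ∀ u, E u x = E' u x)) :
    IsDevelopment P f m P.paper E F := by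
  choose! U hUo hyU E' F' hD hFE using h
  have hev : ∀ y ∈ P.paper, ∀ u, F u =ᶠ[𝓝 y] F' y u := fun y hy u =>
    Filter.eventually_of_mem ((hUo y hy).mem_nhds (hyU y hy)) fun x hx => (hFE y hy x hx).1 u
  have hevE : ∀ y ∈ P.uncreased, ∀ u, E u =ᶠ[𝓝 y] E' y u := fun y hy u =>
    Filter.eventually_of_mem (inter_mem ((hUo y hy.1).mem_nhds (hyU y hy.1))
      ((isOpen_uncreased P).mem_nhds hy)) fun x hx => (hFE y hy.1 x hx.1).2 hx.2 u
  refine ⟨fun u y hy => ?_, fun y hy => ?_, ?_, fun u y hy => ?_, fun u y hy => ?_,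
    fun u x hx => ?_, fun u i s hs hsU => ?_, fun y hy => ?_, ?_⟩
  · rw [(hFE y hy.1 y (hyU y hy.1)).2 hy.2 u]
    exact (hD y hy.1).isRot u y ⟨hyU y hy.1, hy.2⟩
  · simp only [fun u => (hFE y hy.1 y (hyU y hy.1)).2 hy.2 u]
    exact (hD y hy.1).continuous_frame y ⟨hyU y hy.1, hy.2⟩
  · rintro ⟨u, y⟩ ⟨-, hy⟩
    refine ContinuousAt.continuousWithinAt ?_
    have h1 : univ ×ˢ U y ∈ 𝓝 (u, y) :=
      (isOpen_univ.prod (hUo y hy)).mem_nhds ⟨mem_univ _, hyU y hy⟩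
    exact ((hD y hy).continuousOn.continuousAt h1).congr
      (Filter.eventually_of_mem h1 fun q hq => ((hFE y hy q.2 hq.2).1 q.1).symm)
  · rw [(hFE y hy.1 y (hyU y hy.1)).2 hy.2 u]
    exact ((hD y hy.1).deriv_frame u y ⟨hyU y hy.1, hy.2⟩).congr_of_eventuallyEq (hevE y hy.2 u)
  · rw [(hFE y hy.1 y (hyU y hy.1)).2 hy.2 u]
    exact ((hD y hy.1).deriv_surface u y ⟨hyU y hy.1, hy.2⟩).congr_of_eventuallyEq (hev y hy.1 u)
  · intro y hy
    have h1 := (hD y hy.1).contDiffOn u x hx y ⟨hyU y hy.1, hy.2⟩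
    have h2 : U y ∩ closure (connectedComponentIn P.uncreased x) ∈
        𝓝[P.paper ∩ closure (connectedComponentIn P.uncreased x)] y :=
      inter_mem (mem_nhdsWithin_of_mem_nhds ((hUo y hy.1).mem_nhds (hyU y hy.1)))
        (mem_of_superset self_mem_nhdsWithin inter_subset_right)
    exact (h1.mono_of_mem_nhdsWithin h2).congr_of_eventuallyEq
      ((hev y hy.1 u).filter_mono nhdsWithin_le_nhds) (hev y hy.1 u).self_of_nhds
  · obtain ⟨EL, ER, hL, hR, htw, hd⟩ := (hD _ hsU).crease u i s hs (hyU _ hsU)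
    obtain ⟨a₁, U₁, S, η, hB₁⟩ := exists_isFermiBox P hs
    obtain ⟨a, V, hVU, -, hB⟩ := hB₁.shrink ((hUo _ hsU).mem_nhds (hyU _ hsU))
    have hside : ∀ σ, ∀ x ∈ openSide V η σ, E' (P.crease i s) u x = E u x := fun σ x hx =>
      ((hFE _ hsU x (hVU hx.1)).2 (hB.openSide_subset hx) u).symm
    refine ⟨EL, ER, hL.congr' ?_, hR.congr' ?_, htw, hd.congr_of_eventuallyEq ?_⟩
    · filter_upwards [hB.fermi_mem_openSide hB.self_mem (σ := 1) (by norm_num)] with ε hε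
      refine hside 1 _ ?_
      simpa [fermi] using hε
    · filter_upwards [hB.fermi_mem_openSide hB.self_mem (σ := -1) (by norm_num)] with ε hε
      refine hside (-1) _ ?_
      simpa [fermi, sub_eq_add_neg] using hε
    · exact (hasStrictDerivAt_crease hs).hasDerivAt.continuousAt.eventually (hev _ hsU u)
  · rw [(hFE y hy y (hyU y hy)).1 1]
    exact (hD y hy).one y (hyU y hy)
  · have hz : ∀ y ∈ P.paper, ∃ e : Plane →ᵃⁱ[ℝ] Space, F 0 =ᶠ[𝓝 y] e := by
      intro y hy
      obtain ⟨e, he⟩ := (hD y hy).zero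
      exact ⟨e, (hev y hy 0).trans
        (Filter.eventually_of_mem ((hUo y hy).mem_nhds (hyU y hy)) he)⟩
    have : Nonempty (Plane →ᵃⁱ[ℝ] Space) := ⟨flatPlacement IsRot.one 0⟩
    choose! e he using hz
    have : SimplyConnectedSpace P.paper := hHole
    have hloc : IsLocallyConstant fun y : P.paper => e y := by
      rw [IsLocallyConstant.iff_eventually_eq]
      intro y
      have h1 := (he y y.2).eventually_nhds
      filter_upwards [continuous_subtype_val.continuousAt.eventually h1] with x hx
      exact affineIsometry_eq_of_eventuallyEq ((he x x.2).symm.trans hx)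
    obtain ⟨y₀⟩ : Nonempty P.paper := inferInstance
    refine ⟨e y₀, fun y hy => ?_⟩
    rw [(he y hy).self_of_nhds]
    exact congrArg (fun e : Plane →ᵃⁱ[ℝ] Space => e y)
      (hloc.apply_eq_of_preconnectedSpace ⟨y, hy⟩ y₀)

/-- On hole-free paper, local developments can be glued to a global one. -/
theorem exists_global_development [Finite ι] (hV : P.VertexFree) (hHole : P.HoleFree)
    (hf : P.IsFolding f)
    (h : ∀ z ∈ P.paper, ∃ U, IsOpen U ∧ z ∈ U ∧ U ⊆ P.paper ∧ ∃ E F, IsDevelopment P f m U E F) :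
    ∃ E F, IsDevelopment P f m P.paper E F := by
  choose! U hUo hzU hUp E F hD using h
  have : SimplyConnectedSpace P.paper := hHole
  have : LocallyPathConnectedSpace P.paper := P.paper_open.locallyPathConnectedSpace
  -- every point is the centre of one of the charts; the motions `g i j` between them are unique
  have huniq : ∀ i j : P.paper, ∀ x ∈ U i ∩ U j, ∀ g g' : Motion,
      (∀ᶠ y in 𝓝 x, g.Carries P (E j) (E i) (F j) (F i) y) →
      (∀ᶠ y in 𝓝 x, g'.Carries P (E j) (E i) (F j) (F i) y) → g = g' := by
    intro i j x hx g g' hg hg'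
    have h1 : ∃ᶠ y in 𝓝 x, y ∈ P.uncreased :=
      mem_closure_iff_frequently.1 (hV.mem_closure_uncreased (hUp i i.2 hx.1))
    obtain ⟨y, hyu, hyg, hyg', hyU⟩ := (h1.and_eventually (hg.and (hg'.and
      ((hUo j j.2).mem_nhds hx.2)))).exists
    exact hyg.unique hyu (fun u => (hD j j.2).isRot u y ⟨hyU, hyu⟩) hyg'
  have hex : ∀ i j : P.paper, ∀ x : P.paper, (x : Plane) ∈ U i ∩ U j →
      ∃ g : Motion, ∀ᶠ y in 𝓝 (x : Plane), g.Carries P (E j) (E i) (F j) (F i) y := by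
    intro i j x hx
    exact ((hD i i.2).mono inter_subset_left).exists_carries hV hf
      ((hD j j.2).mono inter_subset_right) ((hUo i i.2).inter (hUo j j.2))
      (inter_subset_left.trans (hUp i i.2)) hx
  choose! g hg using hex
  obtain ⟨h, hh⟩ := exists_section_of_cocycle (fun i : P.paper => Subtype.val ⁻¹' U i)
    (fun i => (hUo i i.2).preimage continuous_subtype_val) (fun i => hzU i i.2) g
    (fun i x hx => huniq i i x ⟨hx, hx⟩ _ _ (hg i i x ⟨hx, hx⟩)
      (Eventually.of_forall fun y => Motion.Carries.one))
    (fun i j k x hx => huniq i k x ⟨hx.1.1, hx.2⟩ _ _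
      ((hg i j x hx.1).and (hg j k x ⟨hx.1.2, hx.2⟩) |>.mono fun y hy => hy.1.mul hy.2)
      (hg i k x ⟨hx.1.1, hx.2⟩))
    (fun i j x hx => by
      have h1 := continuous_subtype_val.continuousAt.eventually (hg i j x hx).eventually_nhds
      have h2 := continuous_subtype_val.continuousAt.eventually
        (((hUo i i.2).inter (hUo j j.2)).mem_nhds hx)
      filter_upwards [h1, h2] with y hy hyU
      exact huniq i j y hyU _ _ (hg i j y hyU) hy)
  classical
  let k : Plane → Motion := fun x => if hx : x ∈ P.paper then h ⟨x, hx⟩ else 1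
  have hk : ∀ x : P.paper, k x = h x := fun x => by simp [k]
  refine ⟨fun u x => (k x).rot u * E x u x, fun u x => (k x).rot u (F x u x) + (k x).trans u,
    IsDevelopment.of_local hHole fun y hy => ?_⟩
  have h1 := hh ⟨y, hy⟩
  rw [nhds_subtype_eq_comap, eventually_comap] at h1
  obtain ⟨W, hW, hWo, hyW⟩ := mem_nhds_iff.1 (inter_mem h1
    (inter_mem ((hUo y hy).mem_nhds (hzU y hy)) (P.paper_open.mem_nhds hy)))
  refine ⟨W, hWo, hyW, _, _, ((hD y hy).mono (fun x hx => (hW hx).2.1)).motion (k y),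
    fun x hx => ?_⟩
  have hxp : x ∈ P.paper := (hW hx).2.2
  have h2 : h ⟨x, hxp⟩ * g ⟨x, hxp⟩ ⟨y, hy⟩ ⟨x, hxp⟩ = h ⟨y, hy⟩ := (hW hx).1 ⟨x, hxp⟩ rfl
  have h3 := (hg ⟨x, hxp⟩ ⟨y, hy⟩ ⟨x, hxp⟩ ⟨hzU x hxp, (hW hx).2.1⟩).self_of_nhds
  rw [← hk, ← hk] at h2
  simp only at h2 h3
  refine ⟨fun u => ?_, fun hxu u => ?_⟩
  · rw [h3.1 u, ← h2, Motion.mul_rot, Motion.mul_trans, map_add, Op.mul_apply, add_assoc]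
  · rw [h3.2 hxu u, ← h2, Motion.mul_rot, mul_assoc]

end

/-! ### The folding motion of a global development -/

section

open CreaseRulePattern

variable {ι : Type*} {P : CreaseRulePattern ι} {f : Plane → Space} {m : ι → ℝ}

namespace IsDevelopment

variable {U : Set Plane} {E : unitInterval → Plane → Op} {F : unitInterval → Plane → Space}

lemma surfaceNormal_eq (h : IsDevelopment P f m U E F) (u : unitInterval) {y : Plane}
    (hy : y ∈ U ∩ P.uncreased) : surfaceNormal (F u) y = E u y e3 := by
  rw [CurvedCrease.surfaceNormal_eq, (h.deriv_surface u y hy).fderiv, ← (h.isRot u y hy).eq_frameOf]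

/-- A developed surface has a constant frame along each rule segment of `f`, because its frame
turns in proportion to that of `f`. -/
lemma rule [Finite ι] (h : IsDevelopment P f m P.paper E F) (hf : P.IsFolding f)
    (u : unitInterval) {a b : Plane} (hab : (a, b) ∈ P.rules) {x y : Plane}
    (hx : x ∈ openSegment ℝ a b) (hy : y ∈ openSegment ℝ a b) :
    E u x = E u y ∧ F u x - E u x (emb x) = F u y - E u y (emb y) := by
  rw [openSegment_eq_image'] at hx hy
  obtain ⟨l, hl, rfl⟩ := hx
  obtain ⟨l', hl', rfl⟩ := hy
  have hmem : ∀ r ∈ Ioo (0 : ℝ) 1, a + r • (b - a) ∈ openSegment ℝ a b := fun r hr => by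
    rw [openSegment_eq_image']; exact ⟨r, hr, rfl⟩
  have hc : ∀ r : ℝ, HasDerivAt (fun r : ℝ => a + r • (b - a)) (b - a) r := fun r => by
    simpa using ((hasDerivAt_id r).smul_const (b - a)).const_add a
  have hun : ∀ r ∈ Ioo (0 : ℝ) 1, a + r • (b - a) ∈ P.paper ∩ P.uncreased := fun r hr =>
    have h1 := mem_uncreased_of_rule hab (hmem r hr)
    ⟨h1.1, h1⟩
  have hE : ∀ r ∈ Ioo (0 : ℝ) 1, HasDerivAt (fun r : ℝ => E u (a + r • (b - a))) 0 r := by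
    intro r hr
    refine ((h.deriv_frame u _ (hun r hr)).comp_hasDerivAt r (hc r)).congr_deriv ?_
    simp [(hf.fderiv_frame_rule hab (hmem r hr) 0).1]
  have h1 : ∀ r ∈ Ioo (0 : ℝ) 1, E u (a + r • (b - a)) = E u (a + l • (b - a)) := fun r hr =>
    eq_of_hasDerivAt_zero (convex_Ioo 0 1) hE hr hl
  have hF : ∀ r ∈ Ioo (0 : ℝ) 1, HasDerivAt
      (fun r : ℝ => F u (a + r • (b - a)) - E u (a + l • (b - a)) (emb (a + r • (b - a)))) 0 r := by
    intro r hr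
    refine (((h.deriv_surface u _ (hun r hr)).comp_hasDerivAt r (hc r)).sub
      (((Op.act (E u (a + l • (b - a)))).comp emb).hasFDerivAt.comp_hasDerivAt r
        (hc r))).congr_deriv ?_
    rw [h1 r hr, sub_self]
  refine ⟨(h1 l' hl').symm, ?_⟩
  rw [h1 l' hl']
  exact eq_of_hasDerivAt_zero (convex_Ioo 0 1) hF hl hl'

theorem isFolding [Finite ι] (h : IsDevelopment P f m P.paper E F) (hf : P.IsFolding f)
    (u : unitInterval) : P.IsFolding (F u) where
  continuousOn := h.continuousOn_surface u
  contDiffOn_face := h.contDiffOn u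
  isometric x hx v := by
    rw [(h.deriv_surface u x ⟨hx.1, hx⟩).fderiv]
    exact ((h.isRot u x ⟨hx.1, hx⟩).norm_map _).trans (norm_emb v)
  rule_straight a b hab x hx y hy := by
    obtain ⟨h1, h2⟩ := h.rule hf u hab hx hy
    have hxu := mem_uncreased_of_rule hab hx
    rw [← h1, sub_eq_sub_iff_sub_eq_sub, ← map_sub, ← map_sub] at h2
    rw [dist_eq_norm, h2, (h.isRot u x ⟨hxu.1, hxu⟩).norm_map, norm_emb, dist_eq_norm]
  rule_normal a b hab x hx y hy := by
    have hxu := mem_uncreased_of_rule hab hx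
    have hyu := mem_uncreased_of_rule hab hy
    rw [h.surfaceNormal_eq u ⟨hxu.1, hxu⟩, h.surfaceNormal_eq u ⟨hyu.1, hyu⟩,
      (h.rule hf u hab hx hy).1]

theorem hasFoldAngle [Finite ι] (h : IsDevelopment P f m P.paper E F) (u : unitInterval) {i : ι}
    {s : ℝ} (hs : s ∈ Ioo 0 (P.len i)) :
    P.HasFoldAngle (F u) i s (2 * Real.arctan (u * m i)) := by
  obtain ⟨EL, ER, hL, hR, htw, hd⟩ := h.crease u i s hs (P.crease_mem i s hs)
  obtain ⟨a, V, S, η, hB⟩ := exists_isFermiBox P hs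
  have hmL : ∀ᶠ ε in 𝓝[>] (0 : ℝ),
      P.crease i s + ε • P.leftNormal i s ∈ P.paper ∩ P.uncreased := by
    filter_upwards [hB.fermi_mem_openSide hB.self_mem (σ := 1) (by norm_num)] with ε hε
    have h1 := hB.openSide_subset hε
    simpa [fermi] using (⟨h1.1, h1⟩ : _ ∈ P.paper ∩ P.uncreased)
  have hmR : ∀ᶠ ε in 𝓝[>] (0 : ℝ),
      P.crease i s - ε • P.leftNormal i s ∈ P.paper ∩ P.uncreased := by
    filter_upwards [hB.fermi_mem_openSide hB.self_mem (σ := -1) (by norm_num)] with ε hε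
    have h1 := hB.openSide_subset hε
    simpa [fermi, sub_eq_add_neg] using (⟨h1.1, h1⟩ : _ ∈ P.paper ∩ P.uncreased)
  have hEL : IsRot EL := isClosed_isRot.mem_of_tendsto hL (hmL.mono fun ε hε => h.isRot u _ hε)
  have hER : IsRot ER := isClosed_isRot.mem_of_tendsto hR (hmR.mono fun ε hε => h.isRot u _ hε)
  have hact : Continuous fun A : Op => A e3 := by fun_prop
  refine ⟨EL e3, ER e3, ((hact.tendsto _).comp hL).congr' ?_, ((hact.tendsto _).comp hR).congr' ?_,
    ?_⟩
  · exact hmL.mono fun ε hε => (h.surfaceNormal_eq u hε).symm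
  · exact hmR.mono fun ε hε => (h.surfaceNormal_eq u hε).symm
  · rw [hd.deriv]
    exact ((mul_darboux_eq_iff hEL hER (norm_tangent hs) _).1 htw).2

theorem isProperlyFolded [Finite ι] (h : IsDevelopment P f m P.paper E F) (hf : P.IsFolding f)
    (hm : ∀ i, m i ≠ 0) {u : unitInterval} (hu : (u : ℝ) ≠ 0) : P.IsProperlyFolded (F u) := by
  refine ⟨h.isFolding hf u, fun i s hs => ⟨_, ⟨?_, ?_⟩, ?_, h.hasFoldAngle u hs⟩⟩
  · linarith [Real.neg_pi_div_two_lt_arctan (u * m i)]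
  · linarith [Real.arctan_lt_pi_div_two (u * m i)]
  · exact mul_ne_zero two_ne_zero (by rw [Ne, Real.arctan_eq_zero_iff]; exact mul_ne_zero hu (hm i))

theorem isRigidRulingMotion [Finite ι] (h : IsDevelopment P f m P.paper E F) (hf : P.IsFolding f)
    (hm : ∀ i, m i ≠ 0) : P.IsRigidRulingMotion fun u => F (projIcc 0 1 zero_le_one u) where
  continuousOn := h.continuousOn.comp
    (f := fun q : ℝ × Plane => (projIcc (0 : ℝ) 1 zero_le_one q.1, q.2))
    ((continuous_projIcc.comp continuous_fst).prodMk continuous_snd).continuousOn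
    fun _ hq => ⟨mem_univ _, hq.2⟩
  flat := by
    obtain ⟨e, he⟩ := h.zero
    exact ⟨e, by rwa [projIcc_left]⟩
  folded u hu := by
    refine h.isProperlyFolded hf hm ?_
    rw [projIcc_of_mem zero_le_one ⟨hu.1.le, hu.2⟩]
    exact hu.1.ne'

end IsDevelopment

end

end CurvedCrease

end

theorem mainTheorem4 {ι : Type*} [Finite ι] (P : CurvedCrease.CreaseRulePattern ι)
    (hVertex : P.VertexFree) (hHole : P.HoleFree) (hUnique : P.UniquelyRuled)
    (hReflect : P.ReflectingRulings)
    (f : CurvedCrease.Plane → CurvedCrease.Space) (hf : P.IsProperlyFolded f) :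
    ∃ ρ : ι → ℝ,
      (∀ i, ρ i ∈ Set.Ioo (-Real.pi) Real.pi ∧ ρ i ≠ 0 ∧
        ∀ s ∈ Set.Ioo 0 (P.len i), P.HasFoldAngle f i s (ρ i)) ∧
      ∃ F : ℝ → CurvedCrease.Plane → CurvedCrease.Space,
        P.IsRigidRulingMotion F ∧ Set.EqOn (F 1) f P.paper ∧
        ∀ u ∈ Set.Icc (0 : ℝ) 1, ∀ i, ∀ s ∈ Set.Ioo 0 (P.len i),
          P.HasFoldAngle (F u) i s (2 * Real.arctan (u * Real.tan (ρ i / 2))) := by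
  obtain ⟨ρ, hρ⟩ := hf.exists_foldAngle hUnique hReflect
  refine ⟨ρ, hρ, ?_⟩
  obtain ⟨E, F, h⟩ := CurvedCrease.exists_global_development
    (m := fun i => Real.tan (ρ i / 2)) hVertex hHole hf.1 fun z hz => by
      rcases hVertex.mem_cases hz with hzu | ⟨i, s, hs, rfl⟩
      · exact hf.1.exists_development_uncreased _ hzu
      · exact hf.exists_development_crease hUnique hReflect hρ hs
  have hm : ∀ i, Real.tan (ρ i / 2) ≠ 0 := by
    intro i h0
    have := CurvedCrease.two_arctan_tan (hρ i).1
    rw [h0, Real.arctan_zero, mul_zero] at this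
    exact (hρ i).2.1 this.symm
  refine ⟨_, h.isRigidRulingMotion hf.1 hm, fun y hy => ?_, fun u hu i s hs => ?_⟩
  · simp only [Set.projIcc_right]
    exact h.one y hy
  · simp only [Set.projIcc_of_mem zero_le_one hu]
    exact h.hasFoldAngle ⟨u, hu⟩ hs
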